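/- Let $\Omega\subset\mathbb R^d$ be open, and let $\mathcal A$ be the set of $f\in C^\infty(\Omega)$ all of whose derivatives (including $f$ itself) grow at most polynomially at infinity: for every $n\ge 0$ there are $k\in\mathbb N$ and $C,R\in\mathbb R$ with $|D^nf(x)|\le C|x|^k$ for all $x\in\Omega$ with $|x|\ge R$. **The process.** Let $b:\Omega\to\mathbb R^d$ be $C^\infty$, with Jacobian $J_b$, and assume that its flow $\varphi_x(t)$ ($\partial_t\varphi_x(t)=b(\varphi_x(t))$, $\varphi_x(0)=x$) is defined for all $t\ge0$ and stays in $\Omega$. Let $\lambda>0$ be a constant and $Q$ a Markov transition kernel on $\Omega$; write $Qf(x)=\int f(y)\,Q(x,dy)$. Assume that $Qf\in\mathcal A$ for every $f\in\mathcal A$ that is $Q(x,\cdot)$-integrable for all $x\in\Omega$. Let $(X_t)_{t\ge0}$ be the piecewise deterministic Markov process which follows the flow between jumps, jumps at constant rate $\lambda$ (the waiting times before the jumps are independent exponential variables of parameter $\lambda$), and at a jump from position $z$ moves to a point of law $Q(z,\cdot)$. For a probability measure $\nu$ on $\Omega$, let $\nu P_t$ be the law of $X_t$ when $X_0\sim\nu$.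 **The weight.** Let $a\in\mathcal A$ with $a>0$ on $\Omega$ and $a$ integrable for every $Q(x,\cdot)$; put $\phi_a(f)=a|\nabla f|^2$. Suppose that there are a function $M:\Omega\to\mathbb R$ and a constant $\eta\in\mathbb R$ such that $$\phi_a(Qf)\le M\,Q(\phi_a(f))\quad\text{on }\Omega$$ for all $f\in\mathcal A$ such that $f$ and $\phi_a(f)$ are $Q(x,\cdot)$-integrable for all $x\in\Omega$, and $$2\,u^*J_b(x)u+\Big(\lambda(M(x)-1)-\frac{b(x)^*\nabla a(x)}{a(x)}+\eta\Big)|u|^2\le0\qquad\text{for all }(x,u)\in\Omega\times\mathbb R^d .$$ **The distances.** For $x,y\in\Omega$ let $$d(x,y)=\inf\Big\{\int_0^1\frac{|\gamma'(s)|}{\sqrt{a(\gamma(s))}}\,ds\ :\ \gamma:[0,1]\to\Omega\ \text{smooth},\ \gamma(0)=x,\ \gamma(1)=y\Big\}\in[0,\infty]$$ (with $\inf\emptyset=\infty$), and for probability measures on $\Omega$ let $$\mathcal W_{d,1}(\nu_1,\nu_2)=\inf_{X\sim\nu_1,\,Y\sim\nu_2}\mathbb E[d(X,Y)]\in[0,\infty].$$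 A probability measure $\nu$ has finite first moment if $\int d(x,x_0)\,\nu(dx)<\infty$ for some $x_0\in\Omega$. **Conclusion.** For every $t\ge0$ and all probability measures $\nu_1,\nu_2$ on $\Omega$ with finite first moment such that $\nu_1P_t$ and $\nu_2P_t$ also have finite first moment, $$\mathcal W_{d,1}(\nu_1P_t,\nu_2P_t)\le e^{-\eta t/2}\,\mathcal W_{d,1}(\nu_1,\nu_2).$$ -/

import Mathlib

open MeasureTheory ProbabilityTheory
open scoped ContDiff

noncomputable section

namespace PDMP

/-- The Euclidean space `ℝ^d`. -/
abbrev E (d : ℕ) := EuclideanSpace ℝ (Fin d)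

variable {d : ℕ} {Ω : TopologicalSpace.Opens (E d)}

/-- The extension by zero to `ℝ^d` of a map defined on the open set `Ω`. It is only ever
differentiated at points of `Ω`, where the values outside of `Ω` play no role. -/
def zeroExt {V : Type*} [Zero V] (F : Ω → V) : E d → V :=
  Function.extend Subtype.val F 0

/-- `F` is a `C^∞` map on `Ω`. -/
def SmoothOn {V : Type*} [NormedAddCommGroup V] [NormedSpace ℝ V] (F : Ω → V) : Prop :=
  ContDiffOn ℝ ∞ (zeroExt F) (Ω : Set (E d))

/-- The gradient of `f : Ω → ℝ` at a point of `Ω`. -/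
def grad (f : Ω → ℝ) (x : Ω) : E d := gradient (zeroExt f) (x : E d)

/-- The differential at `x` of a vector field `b : Ω → ℝ^d`; its matrix is the Jacobian matrix. -/
def jac (b : Ω → E d) (x : Ω) : E d →L[ℝ] E d := fderiv ℝ (zeroExt b) (x : E d)

/-- The class `𝒜` of test functions: the `C^∞` functions on `Ω` all of whose derivatives (the
function itself included) grow at most polynomially at infinity, i.e. as `|x| → ∞` in `Ω`. -/
def testFunctions (Ω : TopologicalSpace.Opens (E d)) : Set (Ω → ℝ) :=
  {f | SmoothOn f ∧ ∀ n : ℕ, ∃ (k : ℕ) (C R : ℝ), ∀ x : Ω, R ≤ ‖(x : E d)‖ →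
    ‖iteratedFDeriv ℝ n (zeroExt f) (x : E d)‖ ≤ C * ‖(x : E d)‖ ^ k}

/-- The action of a transition kernel on functions, `Q f (x) = ∫ f(y) Q(x, dy)`. -/
def act (Q : Kernel Ω Ω) (f : Ω → ℝ) (x : Ω) : ℝ := ∫ y, f y ∂(Q x)

/-- The weighted squared gradient `φ_a(f) = a |∇ f|²`. -/
def phi (a : Ω → ℝ) (f : Ω → ℝ) (x : Ω) : ℝ := a x * ‖grad f x‖ ^ 2

/-- `φ` is the semiflow of the vector field `b`: every integral curve `t ↦ φ t x` of `b` started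
at a point of `Ω` is defined for all `t ≥ 0` and stays in `Ω`. Only the times `t ≥ 0` matter. -/
def IsFlow (b : Ω → E d) (φ : ℝ → Ω → Ω) : Prop :=
  ∀ x : Ω, φ 0 x = x ∧
    ∀ t : ℝ, 0 ≤ t → HasDerivWithinAt (fun s => (φ s x : E d)) (b (φ t x)) (Set.Ici 0) t

/-- For the process with flow `φ`, constant jump rate `lam` and jump kernel `Q` started at `x`:
the sub-probability measure `A ↦ ℙ(X_t ∈ A, exactly n jumps occur up to time t)`.
The first jump time has the exponential law of parameter `lam`. Without a jump up to time `t`, the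
process is at `φ t x`; if the first jump occurs at a time `s ≤ t`, the process is then at `φ s x`,
jumps to a point `y` with law `Q (φ s x)`, and starts anew from `y`. -/
def jumpLaw (φ : ℝ → Ω → Ω) (lam : ℝ) (Q : Kernel Ω Ω) : ℕ → ℝ → Ω → Measure Ω
  | 0, t, x => expMeasure lam (Set.Ioi t) • Measure.dirac (φ t x)
  | n + 1, t, x => ((expMeasure lam).restrict (Set.Icc 0 t)).bind fun s =>
      (Q (φ s x)).bind fun y => jumpLaw φ lam Q n (t - s) y

/-- The law of `X_t` for the process started at `x`, by summation over the number of jumps up to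
time `t` (which is almost surely finite, the rate being constant): this is `P_t(x, ·)`. -/
def transition (φ : ℝ → Ω → Ω) (lam : ℝ) (Q : Kernel Ω Ω) (t : ℝ) (x : Ω) : Measure Ω :=
  Measure.sum fun n => jumpLaw φ lam Q n t x

/-- The law `ν P_t`, i.e. the law of `X_t` when `X_0` has law `ν`. -/
def evolve (φ : ℝ → Ω → Ω) (lam : ℝ) (Q : Kernel Ω Ω) (t : ℝ) (ν : Measure Ω) : Measure Ω :=
  ν.bind (transition φ lam Q t)

/-- The distance associated to the weighted gradient `√a ∇`: the infimum of the weighted lengths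
of the smooth paths `γ : [0,1] → Ω` from `x` to `y` (`⊤` if there is none, which happens exactly
if `x` and `y` lie in different connected components of `Ω`). -/
def wdist (a : Ω → ℝ) (x y : Ω) : ENNReal :=
  ⨅ (γ : ℝ → E d) (_ : ContDiffOn ℝ ∞ γ (Set.Icc 0 1) ∧ Set.MapsTo γ (Set.Icc 0 1) Ω ∧
      γ 0 = x ∧ γ 1 = y),
    ∫⁻ s in Set.Icc (0 : ℝ) 1,
      ENNReal.ofReal (‖derivWithin γ (Set.Icc 0 1) s‖ / Real.sqrt (zeroExt a (γ s)))

/-- The Wasserstein-1 distance for `wdist a`: the infimum of `𝔼 d(X,Y)` over all couplings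
`(X,Y)` of `ν₁` and `ν₂`, a coupling being given by its joint law `π`. -/
def wasserstein (a : Ω → ℝ) (ν₁ ν₂ : Measure Ω) : ENNReal :=
  ⨅ (π : Measure (Ω × Ω)) (_ : π.map Prod.fst = ν₁ ∧ π.map Prod.snd = ν₂),
    ∫⁻ p, wdist a p.1 p.2 ∂π

/-- `ν` has a finite first moment for the distance `wdist a`. -/
def FiniteFirstMoment (a : Ω → ℝ) (ν : Measure Ω) : Prop :=
  ∃ x₀ : Ω, ∫⁻ x, wdist a x x₀ ∂ν < ⊤

end PDMP

end

/-! ### The weighted distance and its Lipschitz functions -/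

namespace PDMP
open Set Filter Topology

variable {d : ℕ} {Ω : TopologicalSpace.Opens (E d)} {a : Ω → ℝ}

/-! By Kantorovich duality it suffices that `P_t` maps bounded functions that are 1-Lipschitz for
`wdist a` to `e^{-ηt/2}`-Lipschitz ones: integrating this against any coupling of `ν₁` and `ν₂`
bounds every dual expression for `ν₁P_t`, `ν₂P_t`. Being `L`-Lipschitz for the weighted distance is
a local condition: the pointwise Euclidean Lipschitz constant is at most `L/√a` (`DLip.of_local`,
`DLip.abs_sub_le`).

Two effects compete. At a jump, `φ_a(Qf) ≤ M Q(φ_a(f))` says that `Q` multiplies the weighted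
Lipschitz constant by at most `√M`. Along the flow, the weighted length `|u|/√a` of an infinitesimal
displacement grows at rate at most `Λ - b·∇a/(2a)`, with `Λ(x)` the maximum of `u*J_b(x)u` over unit
vectors. As `M` need not be continuous, a continuous `m` is defined by equating this rate with
`λ(1-m) - η/2`. The balance condition then reads `M ≤ 2m-1`, and `2m-1 ≤ m²`, so `Q` multiplies
Lipschitz constants by at most `m` (`exists_continuous_kernelBound`).

Let `E(s)` be the exponential of the integral of `λ(1-m) - η/2` along the orbit of `x` up to time
`s`. Decomposing at the first jump, and inducting on the number of jumps allowed, gives at `x` the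
weighted Lipschitz constant `e^{-λt}E(t) + ∫₀ᵗ λ e^{-λs} m(φ_s x) E(s) e^{-η(t-s)/2} ds`. It equals
`e^{-ηt/2}`, because `P(s) = e^{-λs+ηs/2}E(s)` satisfies `P' = -λmP` and `P(0) = 1`
(`expansion_balance`, `truncatedMean_dlip`).

Two gaps remain. The hypothesis on `Q` concerns test functions only, so Lipschitz functions are
smoothed with control of the gradient and then cut off at infinity (`exists_smooth_approx`,
`abs_act_sub_le`). The distance may be infinite, so duality is proved by hand: quantize both
measures, solve the finite problem by Hahn–Banach, and glue (`exists_coupling_of_dual`). -/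

lemma zeroExt_coe {V : Type*} [Zero V] (F : Ω → V) (x : Ω) : zeroExt F x = F x :=
  Subtype.val_injective.extend_apply _ _ _

lemma zeroExt_mk {V : Type*} [Zero V] (F : Ω → V) {x : E d} (hx : x ∈ Ω) :
    zeroExt F x = F ⟨x, hx⟩ := zeroExt_coe F ⟨x, hx⟩

section Smooth
variable {V : Type*} [NormedAddCommGroup V] [NormedSpace ℝ V] {F : Ω → V}

lemma SmoothOn.continuous (hF : SmoothOn F) : Continuous F := by
  have h : ContinuousOn (zeroExt F) (Ω : Set (E d)) := ContDiffOn.continuousOn hF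
  rw [continuousOn_iff_continuous_domRestrict] at h
  refine h.congr fun x => ?_
  exact zeroExt_coe F x

lemma SmoothOn.contDiffAt (hF : SmoothOn F) (x : Ω) : ContDiffAt ℝ ∞ (zeroExt F) (x : E d) :=
  ContDiffOn.contDiffAt hF (Ω.isOpen.mem_nhds x.2)

lemma SmoothOn.differentiableAt (hF : SmoothOn F) (x : Ω) :
    DifferentiableAt ℝ (zeroExt F) (x : E d) :=
  (hF.contDiffAt x).differentiableAt (by simp)

lemma SmoothOn.continuousOn_fderiv (hF : SmoothOn F) :
    ContinuousOn (fderiv ℝ (zeroExt F)) (Ω : Set (E d)) :=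
  ContDiffOn.continuousOn_fderiv_of_isOpen hF Ω.isOpen (by simp)

end Smooth

/-- `γ` is a smooth path in `Ω` from `x` to `y`. -/
def IsPath (γ : ℝ → E d) (x y : Ω) : Prop :=
  ContDiffOn ℝ ∞ γ (Icc 0 1) ∧ MapsTo γ (Icc 0 1) Ω ∧ γ 0 = x ∧ γ 1 = y

/-- The weighted length of a path. -/
noncomputable def plen (a : Ω → ℝ) (γ : ℝ → E d) : ENNReal :=
  ∫⁻ s in Icc (0 : ℝ) 1,
      ENNReal.ofReal (‖derivWithin γ (Icc 0 1) s‖ / Real.sqrt (zeroExt a (γ s)))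

lemma wdist_eq (a : Ω → ℝ) (x y : Ω) : wdist a x y = ⨅ (γ : ℝ → E d) (_ : IsPath γ x y), plen a γ :=
  rfl

lemma wdist_le_plen {γ : ℝ → E d} {x y : Ω} (h : IsPath γ x y) : wdist a x y ≤ plen a γ :=
  iInf₂_le γ h

lemma wdist_self (x : Ω) : wdist a x x = 0 := by
  refine le_antisymm ((wdist_le_plen (γ := fun _ => (x : E d))
    ⟨contDiffOn_const, fun _ _ => x.2, rfl, rfl⟩).trans ?_) zero_le
  simp [plen]

lemma IsPath.hasDerivWithinAt {γ : ℝ → E d} {x y : Ω} (h : IsPath γ x y) {s : ℝ}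
    (hs : s ∈ Icc (0 : ℝ) 1) :
    HasDerivWithinAt γ (derivWithin γ (Icc 0 1) s) (Icc 0 1) s :=
  ((h.1.differentiableOn (by simp)) s hs).hasDerivWithinAt

lemma wdist_comm_le (x y : Ω) : wdist a x y ≤ wdist a y x := by
  rw [wdist_eq a y x]
  refine le_iInf₂ fun γ h => ?_
  have hm : MapsTo (fun s : ℝ => 1 - s) (Icc 0 1) (Icc 0 1) := fun s hs =>
    ⟨by linarith [hs.2], by linarith [hs.1]⟩
  have hp : IsPath (fun s => γ (1 - s)) x y :=
    ⟨h.1.comp (by fun_prop) hm, fun s hs => h.2.1 (hm hs), by simp [h.2.2.2], by simp [h.2.2.1]⟩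
  refine (wdist_le_plen hp).trans (le_of_eq ?_)
  have hder : ∀ s ∈ Icc (0 : ℝ) 1, derivWithin (fun s => γ (1 - s)) (Icc 0 1) s =
      -derivWithin γ (Icc 0 1) (1 - s) := by
    intro s hs
    have h1 : HasDerivWithinAt (fun s : ℝ => 1 - s) (-1) (Icc 0 1) s := by
      simpa using ((hasDerivAt_id s).const_sub 1).hasDerivWithinAt
    have := (HasDerivWithinAt.scomp s (h.hasDerivWithinAt (hm hs)) h1 hm).derivWithin
      (uniqueDiffOn_Icc zero_lt_one s hs)
    simpa [Function.comp_def] using this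
  unfold plen
  rw [← lintegral_indicator measurableSet_Icc, ← lintegral_indicator measurableSet_Icc,
    ← lintegral_sub_left_eq_self _ (1 : ℝ)]
  refine lintegral_congr fun s => ?_
  by_cases hs : s ∈ Icc (0 : ℝ) 1
  · rw [indicator_of_mem (hm hs), indicator_of_mem hs, hder _ (hm hs)]
    simp
  · have hs' : 1 - s ∉ Icc (0 : ℝ) 1 := fun hs' => hs (by simpa using hm hs')
    rw [indicator_of_notMem hs, indicator_of_notMem hs']

lemma wdist_comm (x y : Ω) : wdist a x y = wdist a y x :=
  le_antisymm (wdist_comm_le x y) (wdist_comm_le y x)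

/-- The weighted length is invariant under a monotone reparametrisation. -/
lemma lintegral_reparam {γ : ℝ → E d} {x y : Ω} (h : IsPath γ x y) {θ : ℝ → ℝ}
    (hθ : Differentiable ℝ θ) (hm : Monotone θ) (hθI : ∀ s, θ s ∈ Icc (0 : ℝ) 1) {p q : ℝ}
    (hpq : p ≤ q) (hp : θ p = 0) (hq : θ q = 1) :
    ∫⁻ s in Icc p q, ENNReal.ofReal (‖deriv (γ ∘ θ) s‖ / Real.sqrt (zeroExt a (γ (θ s)))) =
      plen a γ := by
  have himg : θ '' Icc p q = Icc 0 1 := by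
    refine Subset.antisymm (image_subset_iff.2 fun s _ => hθI s) ?_
    have := intermediate_value_Icc hpq hθ.continuous.continuousOn
    rwa [hp, hq] at this
  unfold plen
  rw [← himg, lintegral_image_eq_lintegral_deriv_mul_of_monotoneOn measurableSet_Icc
    (fun s _ => (hθ s).hasDerivAt.hasDerivWithinAt) (hm.monotoneOn _), himg]
  refine lintegral_congr fun s => ?_
  have hd : HasDerivAt (γ ∘ θ) (deriv θ s • derivWithin γ (Icc 0 1) (θ s)) s :=
    HasDerivWithinAt.scomp_hasDerivAt s (h.hasDerivWithinAt (hθI s)) (hθ s).hasDerivAt hθI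
  rw [hd.deriv, norm_smul, Real.norm_of_nonneg hm.deriv_nonneg, mul_div_assoc,
    ENNReal.ofReal_mul hm.deriv_nonneg]

lemma wdist_triangle (x y z : Ω) : wdist a x z ≤ wdist a x y + wdist a y z := by
  rw [wdist_eq a x y, wdist_eq a y z]
  simp only [ENNReal.iInf_add, ENNReal.add_iInf]
  refine le_iInf₂ fun γ₂ h₂ => le_iInf₂ fun γ₁ h₁ => ?_
  set θ₁ : ℝ → ℝ := fun s => Real.smoothTransition (2 * s) with hθ₁
  set θ₂ : ℝ → ℝ := fun s => Real.smoothTransition (2 * s - 1) with hθ₂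
  have hI₁ : ∀ s, θ₁ s ∈ Icc (0 : ℝ) 1 := fun s =>
    ⟨Real.smoothTransition.nonneg _, Real.smoothTransition.le_one _⟩
  have hI₂ : ∀ s, θ₂ s ∈ Icc (0 : ℝ) 1 := fun s =>
    ⟨Real.smoothTransition.nonneg _, Real.smoothTransition.le_one _⟩
  have hs₁ : ContDiff ℝ ∞ θ₁ := Real.smoothTransition.contDiff.comp (by fun_prop)
  have hs₂ : ContDiff ℝ ∞ θ₂ := Real.smoothTransition.contDiff.comp (by fun_prop)
  have hm₁ : Monotone θ₁ := fun s t h => Real.smoothTransition.monotone (by linarith)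
  have hm₂ : Monotone θ₂ := fun s t h => Real.smoothTransition.monotone (by linarith)
  have ho₁ : ∀ s, 1 / 2 ≤ s → θ₁ s = 1 := fun s hs =>
    Real.smoothTransition.one_of_one_le (by linarith)
  have ho₂ : ∀ s, s ≤ 1 / 2 → θ₂ s = 0 := fun s hs =>
    Real.smoothTransition.zero_of_nonpos (by linarith)
  have z₁ : θ₁ 0 = 0 := by simp [hθ₁]
  have z₂ : θ₂ 1 = 1 := by rw [hθ₂]; norm_num
  have hA : ContDiff ℝ ∞ (γ₁ ∘ θ₁) := by
    rw [← contDiffOn_univ]; exact h₁.1.comp hs₁.contDiffOn fun s _ => hI₁ s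
  have hB : ContDiff ℝ ∞ (γ₂ ∘ θ₂) := by
    rw [← contDiffOn_univ]; exact h₂.1.comp hs₂.contDiffOn fun s _ => hI₂ s
  -- On each half of the interval one of the two reparametrised paths rests at `y`, so the sum minus
  -- `y` is the concatenation. It is smooth at the junction because `Real.smoothTransition` is flat
  -- there.
  set γ : ℝ → E d := fun s => (γ₁ ∘ θ₁) s + (γ₂ ∘ θ₂) s - y with hγ
  have hγs : ContDiff ℝ ∞ γ := (hA.add hB).sub contDiff_const
  have e₁ : ∀ s, s ≤ 1 / 2 → γ s = γ₁ (θ₁ s) := fun s hs => by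
    simp [hγ, ho₂ s hs, h₂.2.2.1]
  have e₂ : ∀ s, 1 / 2 ≤ s → γ s = γ₂ (θ₂ s) := fun s hs => by
    simp [hγ, ho₁ s hs, h₁.2.2.2]
  have hp : IsPath γ x z := by
    refine ⟨hγs.contDiffOn, fun s _ => ?_, ?_, ?_⟩
    · rcases le_total s (1 / 2) with hs | hs
      · rw [e₁ s hs]; exact h₁.2.1 (hI₁ s)
      · rw [e₂ s hs]; exact h₂.2.1 (hI₂ s)
    · rw [e₁ 0 (by norm_num), z₁, h₁.2.2.1]
    · rw [e₂ 1 (by norm_num), z₂, h₂.2.2.2]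
  refine (wdist_le_plen hp).trans ?_
  have r₁ := lintegral_reparam (a := a) h₁ (hs₁.differentiable (by simp)) hm₁ hI₁
    (p := 0) (q := 1 / 2) (by norm_num) z₁ (ho₁ _ le_rfl)
  have r₂ := lintegral_reparam (a := a) h₂ (hs₂.differentiable (by simp)) hm₂ hI₂
    (p := 1 / 2) (q := 1) (by norm_num) (ho₂ _ le_rfl) z₂
  rw [← r₁, ← r₂, plen]
  have hder : ∀ s ∈ Icc (0 : ℝ) 1, derivWithin γ (Icc 0 1) s = deriv γ s := fun s hs =>
    (hγs.differentiable (by simp) s).derivWithin (uniqueDiffOn_Icc zero_lt_one s hs)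
  rw [setLIntegral_congr_fun (g := fun s =>
      ENNReal.ofReal (‖deriv γ s‖ / Real.sqrt (zeroExt a (γ s)))) measurableSet_Icc
      (fun s hs => by simp only [hder s hs])]
  have hU : Icc (0 : ℝ) 1 = Icc 0 (1 / 2) ∪ Icc (1 / 2) 1 :=
    (Icc_union_Icc_eq_Icc (by norm_num) (by norm_num)).symm
  rw [hU]
  refine (lintegral_union_le _ _ _).trans (le_of_eq ?_)
  rw [← Measure.restrict_congr_set (Ioo_ae_eq_Icc (a := (0 : ℝ)) (b := 1 / 2)),
    ← Measure.restrict_congr_set (Ioo_ae_eq_Icc (a := (1 / 2 : ℝ)) (b := 1))]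
  congr 1
  · refine setLIntegral_congr_fun measurableSet_Ioo fun s hs => ?_
    have : γ =ᶠ[𝓝 s] γ₁ ∘ θ₁ := by
      filter_upwards [Iio_mem_nhds hs.2] with u hu using e₁ u (le_of_lt hu)
    simp only [this.deriv_eq, e₁ s hs.2.le]
  · refine setLIntegral_congr_fun measurableSet_Ioo fun s hs => ?_
    have : γ =ᶠ[𝓝 s] γ₂ ∘ θ₂ := by
      filter_upwards [Ioi_mem_nhds hs.1] with u hu using e₂ u (le_of_lt hu)
    simp only [this.deriv_eq, e₂ s hs.1.le]

/-- The straight segment is a competitor. This is how Euclidean estimates enter the weighted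
distance. -/
lemma wdist_le_of_segment {x y : Ω} {G : ℝ} (hseg : segment ℝ (x : E d) y ⊆ Ω)
    (hG : ∀ z : Ω, (z : E d) ∈ segment ℝ (x : E d) y → 1 / Real.sqrt (a z) ≤ G) :
    wdist a x y ≤ ENNReal.ofReal (G * ‖(y : E d) - x‖) := by
  have hmem : ∀ s ∈ Icc (0 : ℝ) 1, (x : E d) + s • ((y : E d) - x) ∈ segment ℝ (x : E d) y := by
    intro s hs
    rw [segment_eq_image']
    exact ⟨s, hs, rfl⟩
  have hp : IsPath (fun s : ℝ => (x : E d) + s • ((y : E d) - (x : E d))) x y :=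
    ⟨by fun_prop, fun s hs => hseg (hmem s hs), by simp, by simp⟩
  refine (wdist_le_plen hp).trans ?_
  have : ∀ s ∈ Icc (0 : ℝ) 1, ENNReal.ofReal
      (‖derivWithin (fun s : ℝ => (x : E d) + s • ((y : E d) - (x : E d))) (Icc 0 1) s‖ /
        Real.sqrt (zeroExt a ((x : E d) + s • ((y : E d) - x)))) ≤
      ENNReal.ofReal (G * ‖(y : E d) - x‖) := by
    intro s hs
    apply ENNReal.ofReal_le_ofReal
    have hd : HasDerivAt (fun s : ℝ => (x : E d) + s • ((y : E d) - (x : E d))) ((y : E d) - x) s := by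
      simpa using ((hasDerivAt_id s).smul_const ((y : E d) - x)).const_add (x : E d)
    rw [hd.hasDerivWithinAt.derivWithin (uniqueDiffOn_Icc zero_lt_one s hs),
      zeroExt_mk a (hseg (hmem s hs)), div_eq_mul_one_div, mul_comm]
    exact mul_le_mul_of_nonneg_right (hG ⟨_, hseg (hmem s hs)⟩ (hmem s hs)) (norm_nonneg _)
  unfold plen
  refine (setLIntegral_mono measurable_const this).trans ?_
  simp

/-- `f` is `L`-Lipschitz for the weighted distance. -/
def DLip (a : Ω → ℝ) (L : ℝ) (f : Ω → ℝ) : Prop :=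
  ∀ x y, ENNReal.ofReal (f x - f y) ≤ ENNReal.ofReal L * wdist a x y

/-- A function whose pointwise Lipschitz constant is bounded by `L / √a` is Lipschitz for the
weighted distance. -/
lemma DLip.of_local (ha : Continuous a) (hpos : ∀ x, 0 < a x) {L : ℝ} (hL : 0 < L) {h : Ω → ℝ}
    (hloc : ∀ x : Ω, ∀ ε > 0, ∀ᶠ y in 𝓝 x,
      |h y - h x| ≤ (L / Real.sqrt (a x) + ε) * ‖(y : E d) - x‖) : DLip a L h := by
  intro x y
  rw [wdist_eq, ENNReal.mul_iInf_of_ne (by simpa using hL) ENNReal.ofReal_ne_top]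
  refine le_iInf fun γ => ?_
  rw [ENNReal.mul_iInf_of_ne (by simpa using hL) ENNReal.ofReal_ne_top]
  refine le_iInf fun hγ => ?_
  have h01 : (0 : ℝ) ≤ 1 := zero_le_one
  have hcd : ContinuousOn (derivWithin γ (Icc 0 1)) (Icc 0 1) :=
    hγ.1.continuousOn_derivWithin (uniqueDiffOn_Icc zero_lt_one) (by simp)
  set γ' : Icc (0 : ℝ) 1 → Ω := fun s => ⟨γ s, hγ.2.1 s.2⟩ with hγ'
  have hγ'c : Continuous γ' := by
    refine Continuous.subtype_mk ?_ _
    exact continuousOn_iff_continuous_domRestrict.1 hγ.1.continuousOn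
  set ψ₀ : Icc (0 : ℝ) 1 → ℝ := fun s => ‖derivWithin γ (Icc 0 1) s‖ / Real.sqrt (a (γ' s))
  have hψ₀ : Continuous ψ₀ := by
    refine Continuous.div ?_ ?_ fun s => (Real.sqrt_pos.2 (hpos _)).ne'
    · exact (continuousOn_iff_continuous_domRestrict.1 hcd).norm
    · exact (ha.comp hγ'c).sqrt
  set ψ : ℝ → ℝ := IccExtend h01 ψ₀
  have hψ : Continuous ψ := hψ₀.Icc_extend'
  set B : ℝ → ℝ := fun s => ∫ u in (0 : ℝ)..s, L * ψ u with hB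
  have hBd : ∀ s, HasDerivAt B (L * ψ s) s := fun s =>
    intervalIntegral.integral_hasDerivAt_right ((hψ.const_mul L).intervalIntegrable _ _)
      ((hψ.const_mul L).stronglyMeasurableAtFilter _ _) (hψ.const_mul L).continuousAt
  have hcont : Continuous h := by
    rw [continuous_iff_continuousAt]
    intro z
    rw [ContinuousAt, tendsto_iff_norm_sub_tendsto_zero]
    have h0 : Tendsto (fun y : Ω => (L / Real.sqrt (a z) + 1) * ‖(y : E d) - z‖) (𝓝 z) (𝓝 0) := by
      have : Continuous fun y : Ω => (L / Real.sqrt (a z) + 1) * ‖(y : E d) - z‖ := by fun_prop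
      simpa using this.tendsto z
    exact squeeze_zero' (Eventually.of_forall fun _ => norm_nonneg _) (hloc z 1 one_pos) h0
  set f : ℝ → ℝ := IccExtend h01 fun s => h x - h (γ' s) with hf
  have hfc : Continuous f := (continuous_const.sub (hcont.comp hγ'c)).Icc_extend'
  -- Mean value inequality along the path: `h` is not assumed differentiable, but the right slopes
  -- of `h x - h (γ s)` are controlled, and this suffices to compare it with the running weighted
  -- length `B`.
  have key := image_le_of_liminf_slope_right_le_deriv_boundary (f := f) (a := 0) (b := 1)
    hfc.continuousOn (B := B) (B' := fun s => L * ψ s) ?_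
    (fun s _ => (hBd s).continuousAt.continuousWithinAt) (fun s _ => (hBd s).hasDerivWithinAt) ?_
    (right_mem_Icc.2 h01)
  · have f1 : f 1 = h x - h y := by
      rw [hf, IccExtend_of_mem _ _ (right_mem_Icc.2 h01)]
      congr 2
      exact Subtype.ext hγ.2.2.2
    rw [f1] at key
    refine (ENNReal.ofReal_le_ofReal key).trans (le_of_eq ?_)
    have hψ0 : ∀ s, 0 ≤ ψ s := fun s => div_nonneg (norm_nonneg _) (Real.sqrt_nonneg _)
    rw [hB]
    simp only
    rw [intervalIntegral.integral_const_mul, ENNReal.ofReal_mul hL.le,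
      intervalIntegral.integral_of_le h01, ← integral_Icc_eq_integral_Ioc,
      ofReal_integral_eq_lintegral_ofReal (hψ.integrableOn_Icc) (ae_of_all _ hψ0), plen]
    congr 1
    refine setLIntegral_congr_fun measurableSet_Icc fun s hs => ?_
    simp only [ψ]
    rw [IccExtend_of_mem h01 ψ₀ hs, zeroExt_mk a (hγ.2.1 hs)]
  · have : γ' ⟨0, left_mem_Icc.2 h01⟩ = x := Subtype.ext hγ.2.2.1
    rw [hf, IccExtend_of_mem _ _ (left_mem_Icc.2 h01), this]
    simp [hB]
  · intro s hs r hr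
    have hsI : s ∈ Icc (0 : ℝ) 1 := ⟨hs.1, hs.2.le⟩
    set z : Ω := γ' ⟨s, hsI⟩ with hz
    set v := derivWithin γ (Icc 0 1) s with hv
    have hψs : L * ψ s = L / Real.sqrt (a z) * ‖v‖ := by
      simp only [ψ, IccExtend_of_mem h01 ψ₀ hsI, ψ₀]
      ring
    simp only [hψs] at hr
    obtain ⟨ε, hε, hεr⟩ : ∃ ε > 0, (L / Real.sqrt (a z) + ε) * ‖v‖ < r := by
      have hc : Continuous fun ε : ℝ => (L / Real.sqrt (a z) + ε) * ‖v‖ := by fun_prop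
      have h0 := hc.tendsto 0
      simp only [add_zero] at h0
      have h1 := (h0.eventually_lt_const hr).filter_mono (nhdsWithin_le_nhds (s := Ioi 0))
      obtain ⟨ε, h2, h3⟩ := (h1.and self_mem_nhdsWithin).exists
      exact ⟨ε, h3, h2⟩
    have hI : Icc (0 : ℝ) 1 ∈ 𝓝[>] s :=
      mem_of_superset (Ioo_mem_nhdsGT hs.2) fun u hu => ⟨hs.1.trans hu.1.le, hu.2.le⟩
    have hdv : HasDerivWithinAt γ v (Ioi s) s :=
      (hγ.hasDerivWithinAt hsI).mono_of_mem_nhdsWithin hI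
    rw [hasDerivWithinAt_iff_tendsto_slope' (by simp)] at hdv
    have h4 := ((hdv.norm.const_mul (L / Real.sqrt (a z) + ε)).eventually_lt_const hεr)
    have hgam : Tendsto (fun u => (projIcc 0 1 h01 u)) (𝓝[>] s) (𝓝 ⟨s, hsI⟩) := by
      have := (continuous_projIcc (h := h01)).tendsto s
      rw [projIcc_of_mem h01 hsI] at this
      exact this.mono_left nhdsWithin_le_nhds
    have h5 := ((hγ'c.tendsto _).comp hgam).eventually (hloc z ε hε)
    refine Eventually.frequently ?_
    filter_upwards [h4, h5, self_mem_nhdsWithin, hI] with u h4 h5 hu huI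
    refine lt_of_le_of_lt ?_ h4
    have hu' : 0 < u - s := sub_pos.2 hu
    simp only [Function.comp, projIcc_of_mem h01 huI] at h5
    rw [slope_def_field, slope_def_module, norm_smul, norm_inv, Real.norm_of_nonneg hu'.le, hf,
      IccExtend_of_mem _ _ huI, IccExtend_of_mem _ _ hsI, div_le_iff₀ hu']
    have : (L / Real.sqrt (a z) + ε) * ((u - s)⁻¹ * ‖γ u - γ s‖) * (u - s) =
        (L / Real.sqrt (a z) + ε) * ‖γ u - γ s‖ := by field_simp
    rw [this]
    refine le_trans ?_ h5
    rw [abs_sub_comm]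
    refine le_trans (le_of_eq ?_) (le_abs_self _)
    rw [← hz]
    ring

end PDMP

/-! ### Finite optimal transport by separation -/

namespace PDMP
open Set Filter Topology
open scoped Pointwise

/-- Finite-dimensional Kantorovich duality. -/
lemma exists_finite_coupling {ι κ : Type*} [Fintype ι] [Fintype κ] (C : ι → κ → ℝ) (p : ι → ℝ)
    (q : κ → ℝ) (hp : ∀ i, 0 ≤ p i) (hq : ∀ j, 0 ≤ q j) (hp1 : ∑ i, p i = 1) (hq1 : ∑ j, q j = 1)
    (w : ℝ) (h : ∀ (f : ι → ℝ) (g : κ → ℝ), (∀ i j, f i + g j ≤ C i j) →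
      ∑ i, p i * f i + ∑ j, q j * g j ≤ w) :
    ∃ π : ι → κ → ℝ, (∀ i j, 0 ≤ π i j) ∧ (∀ i, ∑ j, π i j = p i) ∧ (∀ j, ∑ i, π i j = q j) ∧
      ∑ i, ∑ j, π i j * C i j ≤ w := by
  classical
  -- A plan is sent to its marginals and its cost. The claim is that `(p, q, w)` lies in the image
  -- of the simplex plus the ray of larger costs, a closed convex set.
  let T : (ι × κ → ℝ) →ₗ[ℝ] (ι → ℝ) × (κ → ℝ) × ℝ :=
    { toFun := fun π => (fun i => ∑ j, π (i, j), fun j => ∑ i, π (i, j), ∑ i, ∑ j, π (i, j) * C i j)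
      map_add' := by
        intro x y
        ext <;> simp [Finset.sum_add_distrib, add_mul]
      map_smul' := by
        intro c x
        ext <;> simp [Finset.mul_sum, mul_assoc] }
  have hTc : Continuous T := T.continuous_of_finiteDimensional
  set K : Set ((ι → ℝ) × (κ → ℝ) × ℝ) := T '' stdSimplex ℝ (ι × κ) with hK
  set R : Set ((ι → ℝ) × (κ → ℝ) × ℝ) := {0} ×ˢ ({0} ×ˢ Ici 0) with hR
  have hKc : IsCompact K := (isCompact_stdSimplex ℝ _).image hTc
  have hKconv : Convex ℝ K := (convex_stdSimplex ℝ _).linear_image T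
  have hRc : IsClosed R := isClosed_singleton.prod (isClosed_singleton.prod isClosed_Ici)
  have hRconv : Convex ℝ R := (convex_singleton _).prod ((convex_singleton _).prod (convex_Ici _))
  have hKR : IsClosed (K + R) := hRc.add_left_of_isCompact hKc
  by_cases hmem : (p, q, w) ∈ K + R
  · obtain ⟨_, ⟨π, hπ, rfl⟩, r, hr, hsum⟩ := hmem
    obtain ⟨r1, r2, r3⟩ := r
    simp only [hR, mem_prod, mem_singleton_iff, mem_Ici] at hr
    obtain ⟨rfl, rfl, h3⟩ := hr
    simp only [T, LinearMap.coe_mk, AddHom.coe_mk, Prod.mk_add_mk, add_zero, Prod.mk.injEq] at hsum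
    refine ⟨fun i j => π (i, j), fun i j => hπ.1 _, fun i => congrFun hsum.1 i,
      fun j => congrFun hsum.2.1 j, ?_⟩
    linarith [hsum.2.2]
  -- Otherwise a linear functional separates. Its components are potentials `f`, `g` and a
  -- multiplier `k` of the cost.
  · exfalso
    obtain ⟨ℓ, u, hlt, hgt⟩ :=
      geometric_hahn_banach_closed_point (hKconv.add hRconv) hKR hmem
    set f : ι → ℝ := fun i => ℓ (Pi.single i 1, 0, 0) with hf
    set g : κ → ℝ := fun j => ℓ (0, Pi.single j 1, 0) with hg
    set k : ℝ := ℓ (0, 0, 1) with hk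
    have hdec : ∀ (x : ι → ℝ) (y : κ → ℝ) (z : ℝ),
        ℓ (x, y, z) = ∑ i, x i * f i + ∑ j, y j * g j + z * k := by
      intro x y z
      have e1 : (x, (0 : κ → ℝ), (0 : ℝ)) =
          ∑ i, x i • ((Pi.single i 1 : ι → ℝ), (0 : κ → ℝ), (0 : ℝ)) := by
        ext i
        · simp [Prod.fst_sum, Finset.sum_apply, Pi.single_apply]
        · simp [Prod.snd_sum]
        · simp [Prod.snd_sum]
      have e2 : ((0 : ι → ℝ), y, (0 : ℝ)) =
          ∑ j, y j • ((0 : ι → ℝ), (Pi.single j 1 : κ → ℝ), (0 : ℝ)) := by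
        ext i
        · simp [Prod.fst_sum]
        · simp [Prod.snd_sum, Prod.fst_sum, Finset.sum_apply, Pi.single_apply]
        · simp [Prod.snd_sum]
      have e3 : ((0 : ι → ℝ), (0 : κ → ℝ), z) = z • ((0 : ι → ℝ), (0 : κ → ℝ), (1 : ℝ)) := by
        simp
      have e : (x, y, z) = (x, (0 : κ → ℝ), (0 : ℝ)) + ((0 : ι → ℝ), y, (0 : ℝ)) +
          ((0 : ι → ℝ), (0 : κ → ℝ), z) := by simp
      rw [e, map_add, map_add, e1, e2, e3, map_sum, map_sum, map_smul]
      simp only [map_smul, smul_eq_mul, hf, hg, hk]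
    have hv : ∀ i j r, 0 ≤ r → f i + g j + (C i j + r) * k < u := by
      intro i j r hr
      have := hlt ((Pi.single i 1, Pi.single j 1, C i j) + (0, 0, r))
        (add_mem_add ⟨Pi.single (i, j) 1, single_mem_stdSimplex ℝ _, ?_⟩ ⟨rfl, rfl, hr⟩)
      · simp only [Prod.mk_add_mk, add_zero] at this
        rw [hdec] at this
        simpa [Pi.single_apply] using this
      · simp only [T, LinearMap.coe_mk, AddHom.coe_mk]
        ext i'
        · simp [Pi.single_apply, Prod.ext_iff, ite_and]
        · simp [Pi.single_apply, Prod.ext_iff, ite_and]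
        · simp [Pi.single_apply, Prod.ext_iff, ite_and]
    rw [hdec] at hgt
    obtain ⟨i₀⟩ : Nonempty ι := by
      by_contra hne
      rw [not_nonempty_iff] at hne
      simp at hp1
    obtain ⟨j₀⟩ : Nonempty κ := by
      by_contra hne
      rw [not_nonempty_iff] at hne
      simp at hq1
    -- The functional is bounded above along the ray of increasing costs.
    have hk0 : k ≤ 0 := by
      by_contra! hkp
      have h1 := hv i₀ j₀ (|(u - f i₀ - g j₀ - C i₀ j₀ * k) / k|) (abs_nonneg _)
      have h2 := le_abs_self ((u - f i₀ - g j₀ - C i₀ j₀ * k) / k)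
      rw [div_le_iff₀ hkp] at h2
      linarith
    rcases hk0.lt_or_eq with hk0 | hk0
    -- For `k < 0`, normalising by `-k` and charging the constant `u` to `g` gives an admissible
    -- dual pair, whose value must be at most `w`; this contradicts the separation.
    · have h1 := h (fun i => f i / (-k)) (fun j => (g j - u) / (-k)) ?_
      · have hk' : 0 < -k := by linarith
        have e : ∑ i, p i * (f i / (-k)) + ∑ j, q j * ((g j - u) / (-k)) =
            (∑ i, p i * f i + ∑ j, q j * g j - u) / (-k) := by
          simp only [← mul_div_assoc, mul_sub, ← Finset.sum_div, Finset.sum_sub_distrib,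
            ← Finset.sum_mul, hq1]
          ring
        rw [e, div_le_iff₀ hk'] at h1
        linarith
      · intro i j
        have hk' : 0 < -k := by linarith
        rw [← add_div, div_le_iff₀ hk']
        have := hv i j 0 le_rfl
        nlinarith
    -- For `k = 0` the cost plays no role, and the product plan has the marginals `p` and `q`:
    -- averaging `f i + g j < u` against it contradicts the separation.
    · have h1 : ∑ i, ∑ j, p i * q j * (f i + g j) ≤ ∑ i, ∑ j, p i * q j * u := by
        refine Finset.sum_le_sum fun i _ => Finset.sum_le_sum fun j _ => ?_
        refine mul_le_mul_of_nonneg_left ?_ (mul_nonneg (hp i) (hq j))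
        have := hv i j 0 le_rfl
        rw [hk0] at this
        linarith
      have e1 : ∑ i, ∑ j, p i * q j * (f i + g j) = ∑ i, p i * f i + ∑ j, q j * g j := by
        have a1 : ∀ i, ∑ j, p i * q j * (f i + g j) = p i * f i + p i * ∑ j, q j * g j := by
          intro i
          calc ∑ j, p i * q j * (f i + g j) = ∑ j, (p i * f i * q j + p i * (q j * g j)) :=
                Finset.sum_congr rfl fun j _ => by ring
            _ = _ := by rw [Finset.sum_add_distrib, ← Finset.mul_sum, ← Finset.mul_sum, hq1, mul_one]
        simp only [a1, Finset.sum_add_distrib, ← Finset.sum_mul, hp1, one_mul]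
      have e2 : ∑ i, ∑ j, p i * q j * u = u := by
        simp only [← Finset.sum_mul, ← Finset.mul_sum, hq1, mul_one, hp1, one_mul]
      rw [e1, e2] at h1
      rw [hk0] at hgt
      linarith

end PDMP

/-! ### Kantorovich duality for a metric cost with values in `[0, ∞]` -/

namespace PDMP
open Set Filter Topology
open scoped Pointwise

section Duality
variable {X : Type*} [MeasurableSpace X] {c : X → X → ENNReal}

/-- A probability measure with finite first moment can be moved to finitely many atoms at an
arbitrarily small cost. -/
lemma exists_quantization
    (hcover : ∀ ε : ENNReal, 0 < ε → ∃ (ξ : ℕ → X) (A : ℕ → Set X), (∀ k, MeasurableSet (A k)) ∧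
      (⋃ k, A k) = univ ∧ ∀ k, ∀ y ∈ A k, c y (ξ k) ≤ ε)
    (μ : Measure X) [IsProbabilityMeasure μ] (x₀ : X) (hμ : ∫⁻ x, c x x₀ ∂μ < ⊤)
    {ε : ENNReal} (hε : 0 < ε) :
    ∃ (N : ℕ) (ξ : Option (Fin N) → X) (A : Option (Fin N) → Set X), (∀ i, MeasurableSet (A i)) ∧
      Pairwise (fun i j => Disjoint (A i) (A j)) ∧ (⋃ i, A i) = univ ∧
      ∑ i, ∫⁻ x in A i, c x (ξ i) ∂μ ≤ ε := by
  obtain ⟨ξ, A, hA, hU, hc⟩ := hcover (ε / 2) (ENNReal.half_pos hε.ne')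
  set D := disjointed A with hD
  have hDm : ∀ k, MeasurableSet (D k) := fun k => MeasurableSet.disjointed hA k
  have hDd : Pairwise (Function.onFun Disjoint D) := disjoint_disjointed A
  have hDU : ⋃ k, D k = univ := by rw [hD, iUnion_disjointed, hU]
  -- The tail left over by the first `N` cells is sent to `x₀` (index `none`). Its cost tends to `0`
  -- because the first moment is finite.
  set T : ℕ → Set X := fun N => (⋃ k, ⋃ (_ : k < N), D k)ᶜ with hT
  have hTm : ∀ N, MeasurableSet (T N) := fun N =>
    (MeasurableSet.iUnion fun k => MeasurableSet.iUnion fun _ => hDm k).compl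
  have hTa : Antitone T := fun M N h => compl_subset_compl.2 <|
    iUnion_mono fun k => iUnion_subset fun hk => subset_iUnion_of_subset (hk.trans_le h) subset_rfl
  have hTi : ⋂ N, T N = ∅ := by
    rw [eq_empty_iff_forall_notMem]
    intro x hx
    have hxU : x ∈ ⋃ k, D k := hDU ▸ mem_univ x
    obtain ⟨k, hk⟩ := mem_iUnion.1 hxU
    exact mem_iInter.1 hx (k + 1) (mem_iUnion₂.2 ⟨k, Nat.lt_succ_self k, hk⟩)
  have htend : Tendsto (fun N => μ.withDensity (fun x => c x x₀) (T N)) atTop (𝓝 0) := by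
    have h0 : ∀ N, μ.withDensity (fun x => c x x₀) (T N) ≠ ⊤ := by
      intro N
      rw [withDensity_apply _ (hTm N)]
      exact ((setLIntegral_le_lintegral _ _).trans_lt hμ).ne
    have := tendsto_measure_iInter_atTop (μ := μ.withDensity fun x => c x x₀)
      (fun N => (hTm N).nullMeasurableSet) hTa ⟨0, h0 0⟩
    rwa [hTi, measure_empty] at this
  obtain ⟨N, hN⟩ := (htend.eventually_le_const (ENNReal.half_pos hε.ne')).exists
  rw [withDensity_apply _ (hTm N)] at hN
  refine ⟨N, fun i => i.elim x₀ fun k => ξ k, fun i => i.elim (T N) fun k => D k, ?_, ?_, ?_, ?_⟩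
  · rintro (_ | k)
    · exact hTm N
    · exact hDm k
  · rintro (_ | k) (_ | l) hkl
    · exact absurd rfl hkl
    · exact (disjoint_compl_left_iff_subset.2
        (subset_iUnion₂ (s := fun k (_ : k < N) => D k) (l : ℕ) l.2))
    · exact (disjoint_compl_left_iff_subset.2
        (subset_iUnion₂ (s := fun k (_ : k < N) => D k) (k : ℕ) k.2)).symm
    · exact hDd fun h => hkl (congrArg some (Fin.ext h))
  · rw [eq_univ_iff_forall]
    intro x
    by_cases hx : x ∈ T N
    · exact mem_iUnion.2 ⟨none, hx⟩
    · rw [hT, notMem_compl_iff] at hx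
      obtain ⟨k, hk, hxk⟩ := mem_iUnion₂.1 hx
      exact mem_iUnion.2 ⟨some ⟨k, hk⟩, hxk⟩
  · rw [Fintype.sum_option]
    simp only [Option.elim]
    rw [← ENNReal.add_halves ε]
    refine add_le_add hN ?_
    calc ∑ k : Fin N, ∫⁻ x in D k, c x (ξ k) ∂μ ≤ ∑ k : Fin N, ε / 2 * μ (D k) := by
          refine Finset.sum_le_sum fun k _ => ?_
          rw [← setLIntegral_const]
          exact setLIntegral_mono measurable_const fun x hx =>
            hc k x (disjointed_subset A k hx)
      _ = ε / 2 * ∑ k : Fin N, μ (D k) := by rw [Finset.mul_sum]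
      _ ≤ ε / 2 * 1 := by
          gcongr
          have h := measure_iUnion (μ := μ) (f := fun k : Fin N => D k)
            (fun k l hkl => hDd fun h => hkl (Fin.ext h)) fun k => hDm k
          rw [tsum_fintype] at h
          exact h ▸ prob_le_one
      _ = ε / 2 := mul_one _

/-- On each cell `F` differs from its value at the atom by at most the transport cost, so the
quantization error is bounded by the total cost, uniformly over 1-Lipschitz `F`. Boundedness of `F`
is there for integrability. -/
lemma abs_integral_sub_sum_le {ι : Type*} [Fintype ι] (hcomm : ∀ x y, c x y = c y x)
    (μ : Measure X) [IsProbabilityMeasure μ] {ξ : ι → X} {A : ι → Set X}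
    (hA : ∀ i, MeasurableSet (A i)) (hd : Pairwise fun i j => Disjoint (A i) (A j))
    (hU : (⋃ i, A i) = univ) {ε : ℝ} (hε : 0 ≤ ε)
    (hcost : ∑ i, ∫⁻ x in A i, c x (ξ i) ∂μ ≤ ENNReal.ofReal ε)
    {F : X → ℝ} (hFm : Measurable F) {K : ℝ} (hFK : ∀ x, |F x| ≤ K)
    (hF : ∀ x y, ENNReal.ofReal (F x - F y) ≤ c x y) :
    |∫ x, F x ∂μ - ∑ i, μ.real (A i) * F (ξ i)| ≤ ε := by
  have hint : Integrable F μ := Integrable.of_bound hFm.aestronglyMeasurable K (ae_of_all _ hFK)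
  have h1 : ∫ x, F x ∂μ = ∑ i, ∫ x in A i, F x ∂μ := by
    rw [← setIntegral_univ, ← hU]
    exact integral_iUnion_fintype hA hd fun i => hint.integrableOn
  have h2 : ∀ i, ∫ x in A i, F x ∂μ - μ.real (A i) * F (ξ i) = ∫ x in A i, (F x - F (ξ i)) ∂μ := by
    intro i
    rw [integral_sub hint.integrableOn (integrable_const _), setIntegral_const, smul_eq_mul]
  have hEn : ∀ x y, ENNReal.ofReal |F x - F y| ≤ c x y := by
    intro x y
    rcases abs_choice (F x - F y) with h | h
    · rw [h]; exact hF x y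
    · rw [h, neg_sub, hcomm]; exact hF y x
  rw [h1, ← Finset.sum_sub_distrib]
  simp only [h2]
  refine (Finset.abs_sum_le_sum_abs _ _).trans ?_
  rw [← ENNReal.ofReal_le_ofReal_iff hε, ENNReal.ofReal_sum_of_nonneg fun _ _ => abs_nonneg _]
  refine le_trans (Finset.sum_le_sum fun i _ => ?_) hcost
  refine (ENNReal.ofReal_le_ofReal (norm_integral_le_integral_norm (fun x => F x - F (ξ i)))).trans ?_
  have hi : Integrable (fun x => F x - F (ξ i)) (μ.restrict (A i)) :=
    hint.integrableOn.sub (integrable_const _)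
  rw [ofReal_integral_eq_lintegral_ofReal hi.norm (ae_of_all _ fun _ => norm_nonneg _)]
  exact lintegral_mono fun x => hEn _ _

/-- Kantorovich duality for a (possibly infinite) metric cost and two probability measures with
finite first moments. -/
theorem exists_coupling_of_dual (hself : ∀ x, c x x = 0) (hcomm : ∀ x y, c x y = c y x)
    (htri : ∀ x y z, c x z ≤ c x y + c y z) (hmeas : ∀ x, Measurable fun y => c y x)
    (hcover : ∀ ε : ENNReal, 0 < ε → ∃ (ξ : ℕ → X) (A : ℕ → Set X), (∀ k, MeasurableSet (A k)) ∧
      (⋃ k, A k) = univ ∧ ∀ k, ∀ y ∈ A k, c y (ξ k) ≤ ε)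
    (μ ν : Measure X) [IsProbabilityMeasure μ] [IsProbabilityMeasure ν] {x₁ x₂ : X}
    (hμ : ∫⁻ x, c x x₁ ∂μ < ⊤) (hν : ∫⁻ x, c x x₂ ∂ν < ⊤) {D : ℝ} (hD0 : 0 ≤ D)
    (hD : ∀ F : X → ℝ, Measurable F → (∃ K, ∀ x, |F x| ≤ K) →
      (∀ x y, ENNReal.ofReal (F x - F y) ≤ c x y) → ∫ x, F x ∂μ - ∫ x, F x ∂ν ≤ D)
    {ε : ℝ} (hε : 0 < ε) :
    ∃ π : Measure (X × X), (π.map Prod.fst = μ ∧ π.map Prod.snd = ν) ∧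
      ∫⁻ p, c p.1 p.2 ∂π ≤ ENNReal.ofReal (D + 4 * ε) := by
  -- the truncated cost
  let cK : ℝ → X → X → ℝ := fun K x y => (min (c x y) (ENNReal.ofReal K)).toReal
  have cKfin : ∀ K x y, min (c x y) (ENNReal.ofReal K) ≠ ⊤ := fun K x y =>
    ne_top_of_le_ne_top ENNReal.ofReal_ne_top (min_le_right _ _)
  have cK0 : ∀ K x y, 0 ≤ cK K x y := fun K x y => ENNReal.toReal_nonneg
  have cKle : ∀ K, 0 ≤ K → ∀ x y, cK K x y ≤ K := fun K hK x y =>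
    ENNReal.toReal_le_of_le_ofReal hK (min_le_right _ _)
  have cKc : ∀ K x y, ENNReal.ofReal (cK K x y) ≤ c x y := fun K x y => by
    rw [ENNReal.ofReal_toReal (cKfin K x y)]
    exact min_le_left _ _
  -- Truncation preserves the triangle inequality, so functions that are 1-Lipschitz for the
  -- truncated cost are admissible in `hD`.
  have cKtri : ∀ K x y z, cK K x z ≤ cK K x y + cK K y z := by
    intro K x y z
    rw [← ENNReal.toReal_add (cKfin _ _ _) (cKfin _ _ _)]
    refine ENNReal.toReal_mono (ENNReal.add_ne_top.2 ⟨cKfin _ _ _, cKfin _ _ _⟩) ?_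
    rw [min_add, add_min, add_min]
    refine le_min (le_min ((min_le_left _ _).trans (htri x y z)) ?_) (le_min ?_ ?_)
    · exact (min_le_right _ _).trans le_add_self
    · exact (min_le_right _ _).trans le_self_add
    · exact (min_le_right _ _).trans le_self_add
  have cKm : ∀ K x, Measurable fun y => cK K y x := fun K x =>
    ((hmeas x).min measurable_const).ennreal_toReal
  -- the two measures live at a finite distance
  have hfin : c x₁ x₂ < ⊤ := by
    by_contra! htop
    rw [top_le_iff] at htop
    set m := (∫⁻ x, c x x₂ ∂ν).toReal
    have hm : 0 ≤ m := ENNReal.toReal_nonneg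
    -- If `c x₁ x₂ = ⊤`, then `μ`-almost every point is infinitely far from `x₂`. The truncated
    -- distance to `x₂` then has `μ`-integral `K` and `ν`-integral at most `m`, a gap of `D + 1` at
    -- least.
    set K := D + m + 1
    have hK : 0 ≤ K := by positivity
    have h1 := hD (fun x => cK K x x₂) (cKm _ _)
      ⟨K, fun x => by rw [abs_of_nonneg (cK0 _ _ _)]; exact cKle _ hK _ _⟩ fun x y =>
        (ENNReal.ofReal_le_ofReal (by linarith [cKtri K x y x₂])).trans (cKc K x y)
    have h2 : ∫ x, cK K x x₂ ∂μ = K := by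
      have : ∀ᵐ x ∂μ, cK K x x₂ = K := by
        filter_upwards [ae_lt_top (hmeas x₁) hμ.ne] with x hx
        have h3 : c x x₂ = ⊤ := by
          have := htri x₁ x x₂
          rw [htop, top_le_iff, ENNReal.add_eq_top, hcomm] at this
          exact this.resolve_left hx.ne
        simp only [cK, h3]
        rw [min_eq_right le_top, ENNReal.toReal_ofReal hK]
      rw [integral_congr_ae this]
      simp
    have h3 : ∫ x, cK K x x₂ ∂ν ≤ m := by
      rw [integral_eq_lintegral_of_nonneg_ae (ae_of_all _ fun _ => cK0 _ _ _)
        (cKm _ _).aestronglyMeasurable]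
      exact ENNReal.toReal_mono hν.ne (lintegral_mono fun x => cKc _ _ _)
    linarith
  obtain ⟨N₁, ξ, A, hA, hAd, hAU, hAc⟩ := exists_quantization hcover μ x₁ hμ
    (ENNReal.ofReal_pos.2 hε)
  obtain ⟨N₂, ζ, B, hB, hBd, hBU, hBc⟩ := exists_quantization hcover ν x₂ hν
    (ENNReal.ofReal_pos.2 hε)
  -- Truncating at this level changes no finite cost between atoms; infinite costs contribute `0` to
  -- the sum.
  set K := ∑ i, ∑ j, (c (ξ i) (ζ j)).toReal
  have hK : 0 ≤ K := Finset.sum_nonneg fun _ _ => Finset.sum_nonneg fun _ _ => ENNReal.toReal_nonneg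
  have hsum : ∀ (ρ : Measure X) [IsProbabilityMeasure ρ] {n : ℕ} {S : Option (Fin n) → Set X},
      (∀ i, MeasurableSet (S i)) → (Pairwise fun i j => Disjoint (S i) (S j)) →
      (⋃ i, S i) = univ → ∑ i, ρ.real (S i) = 1 := by
    intro ρ _ n S hS hSd hSU
    rw [← measureReal_iUnion_fintype hSd hS, hSU]
    simp
  obtain ⟨π, hπ0, hπ1, hπ2, hπc⟩ := exists_finite_coupling (fun i j => cK K (ξ i) (ζ j))
    (fun i => μ.real (A i)) (fun j => ν.real (B j)) (fun _ => measureReal_nonneg)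
    (fun _ => measureReal_nonneg) (hsum μ hA hAd hAU) (hsum ν hB hBd hBU) (D + 2 * ε) (by
      intro f g hfg
      -- The `c`-transform of `g`: it is 1-Lipschitz for the truncated cost, lies above `f` at the
      -- `ξ i` and below `-g` at the `ζ j`. The dual value is thus at most the difference of the
      -- discretised integrals of `F`, that is `D` plus two quantization errors `ε`.
      let F : X → ℝ := fun x => Finset.univ.inf' Finset.univ_nonempty fun j => cK K x (ζ j) - g j
      have hFm : Measurable F := by
        have : F = Finset.univ.inf' Finset.univ_nonempty fun j x => cK K x (ζ j) - g j := by
          ext x; simp [F]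
        rw [this]
        exact Finset.inf'_induction Finset.univ_nonempty _ (fun f hf g hg => hf.inf hg)
          fun j _ => (cKm K _).sub_const _
      have hF1 : ∀ x j, F x ≤ cK K x (ζ j) - g j := fun x j => Finset.inf'_le _ (Finset.mem_univ j)
      have hF2 : ∀ x y, F x - F y ≤ cK K x y := by
        intro x y
        obtain ⟨j, -, hj⟩ := Finset.exists_mem_eq_inf' Finset.univ_nonempty
          fun j => cK K y (ζ j) - g j
        have e : F y = cK K y (ζ j) - g j := hj
        rw [e]
        linarith [hF1 x j, cKtri K x y (ζ j)]
      have hFb : ∃ K', ∀ x, |F x| ≤ K' := by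
        refine ⟨|F (ζ none)| + K, fun x => ?_⟩
        have h1 := (hF2 x (ζ none)).trans (cKle K hK _ _)
        have h2 := (hF2 (ζ none) x).trans (cKle K hK _ _)
        have h3 : |F x - F (ζ none)| ≤ K := abs_le.2 ⟨by linarith, h1⟩
        have h4 := abs_sub_abs_le_abs_sub (F x) (F (ζ none))
        linarith
      have hFl : ∀ x y, ENNReal.ofReal (F x - F y) ≤ c x y := fun x y =>
        (ENNReal.ofReal_le_ofReal (hF2 x y)).trans (cKc K x y)
      have h1 := hD F hFm hFb hFl
      obtain ⟨K', hK'⟩ := hFb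
      have h2 := (abs_le.1 (abs_integral_sub_sum_le hcomm μ hA hAd hAU hε.le hAc hFm hK' hFl)).1
      have h3 := (abs_le.1 (abs_integral_sub_sum_le hcomm ν hB hBd hBU hε.le hBc hFm hK' hFl)).2
      have h4 : ∑ i, μ.real (A i) * f i ≤ ∑ i, μ.real (A i) * F (ξ i) := by
        refine Finset.sum_le_sum fun i _ => mul_le_mul_of_nonneg_left ?_ measureReal_nonneg
        exact Finset.le_inf' _ _ fun j _ => by linarith [hfg i j]
      have h5 : ∑ j, ν.real (B j) * F (ζ j) ≤ -∑ j, ν.real (B j) * g j := by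
        rw [← Finset.sum_neg_distrib]
        refine Finset.sum_le_sum fun j _ => ?_
        rw [← mul_neg]
        refine mul_le_mul_of_nonneg_left ?_ measureReal_nonneg
        have := hF1 (ζ j) j
        have h0 : cK K (ζ j) (ζ j) = 0 := by simp [cK, hself]
        linarith
      linarith)
  have hfinμ : ∀ i, μ (A i) ≠ 0 → c (ξ i) x₁ < ⊤ := by
    intro i hi
    have h1 : ∫⁻ x in A i, c x (ξ i) ∂μ ≠ ⊤ :=
      ((Finset.single_le_sum (f := fun i => ∫⁻ x in A i, c x (ξ i) ∂μ) (fun _ _ => zero_le)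
        (Finset.mem_univ i)).trans hAc).trans_lt ENNReal.ofReal_lt_top |>.ne
    have h2 := ae_lt_top (μ := μ.restrict (A i)) (hmeas _) h1
    have h3 := ae_restrict_of_ae (s := A i) (ae_lt_top (hmeas x₁) hμ.ne)
    have : (ae (μ.restrict (A i))).NeBot := by
      rw [ae_neBot]
      simpa using hi
    obtain ⟨x, hx1, hx2⟩ := (h2.and h3).exists
    rw [hcomm] at hx1
    exact (htri _ x _).trans_lt (ENNReal.add_lt_top.2 ⟨hx1, hx2⟩)
  have hfinν : ∀ j, ν (B j) ≠ 0 → c (ζ j) x₂ < ⊤ := by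
    intro i hi
    have h1 : ∫⁻ x in B i, c x (ζ i) ∂ν ≠ ⊤ :=
      ((Finset.single_le_sum (f := fun i => ∫⁻ x in B i, c x (ζ i) ∂ν) (fun _ _ => zero_le)
        (Finset.mem_univ i)).trans hBc).trans_lt ENNReal.ofReal_lt_top |>.ne
    have h2 := ae_lt_top (μ := ν.restrict (B i)) (hmeas _) h1
    have h3 := ae_restrict_of_ae (s := B i) (ae_lt_top (hmeas x₂) hν.ne)
    have : (ae (ν.restrict (B i))).NeBot := by
      rw [ae_neBot]
      simpa using hi
    obtain ⟨x, hx1, hx2⟩ := (h2.and h3).exists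
    rw [hcomm] at hx1
    exact (htri _ x _).trans_lt (ENNReal.add_lt_top.2 ⟨hx1, hx2⟩)
  -- The plan charges only pairs of cells of positive mass. Their atoms are at finite distance from
  -- `x₁` and `x₂`, hence from each other, so the truncated cost is the true one.
  have hπcost : ∀ i j, ENNReal.ofReal (π i j) * c (ξ i) (ζ j) =
      ENNReal.ofReal (π i j * cK K (ξ i) (ζ j)) := by
    intro i j
    rcases (hπ0 i j).eq_or_lt with h0 | h0
    · simp [← h0]
    · have hi : μ (A i) ≠ 0 := by
        intro hi
        have := Finset.single_le_sum (f := fun j => π i j) (fun j _ => hπ0 i j) (Finset.mem_univ j)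
        rw [hπ1 i, measureReal_def, hi] at this
        simp at this
        linarith
      have hj : ν (B j) ≠ 0 := by
        intro hj
        have := Finset.single_le_sum (f := fun i => π i j) (fun i _ => hπ0 i j) (Finset.mem_univ i)
        rw [hπ2 j, measureReal_def, hj] at this
        simp at this
        linarith
      have hcf : c (ξ i) (ζ j) ≠ ⊤ := by
        refine ((htri _ x₁ _).trans_lt (ENNReal.add_lt_top.2 ⟨hfinμ i hi, ?_⟩)).ne
        refine (htri _ x₂ _).trans_lt (ENNReal.add_lt_top.2 ⟨hfin, ?_⟩)
        rw [hcomm]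
        exact hfinν j hj
      rw [ENNReal.ofReal_mul h0.le, ENNReal.ofReal_toReal (cKfin _ _ _), min_eq_left]
      rw [← ENNReal.ofReal_toReal hcf]
      refine ENNReal.ofReal_le_ofReal ?_
      exact (Finset.single_le_sum (f := fun j => (c (ξ i) (ζ j)).toReal)
        (fun _ _ => ENNReal.toReal_nonneg) (Finset.mem_univ j)).trans
        (Finset.single_le_sum (f := fun i => ∑ j, (c (ξ i) (ζ j)).toReal)
        (fun _ _ => Finset.sum_nonneg fun _ _ => ENNReal.toReal_nonneg) (Finset.mem_univ i))
  -- the coupling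
  have condp : ∀ (ρ : Measure X) [IsProbabilityMeasure ρ] (S : Set X),
      ENNReal.ofReal (ρ.real S) • (ProbabilityTheory.cond ρ S) = ρ.restrict S := by
    intro ρ _ S
    rw [ProbabilityTheory.cond, smul_smul, ofReal_measureReal]
    rcases eq_or_ne (ρ S) 0 with h0 | h0
    · simp [h0, Measure.restrict_eq_zero.2 h0]
    · rw [ENNReal.mul_inv_cancel h0 (measure_ne_top _ _), one_smul]
  have condle : ∀ (ρ : Measure X) [IsProbabilityMeasure ρ] (S : Set X), ProbabilityTheory.cond ρ S univ ≤ 1 := by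
    intro ρ _ S
    rw [ProbabilityTheory.cond, Measure.smul_apply, Measure.restrict_apply_univ, smul_eq_mul]
    exact ENNReal.inv_mul_le_one _
  -- Conditioning on a null cell gives the zero measure instead of a probability, but the plan has
  -- no weight there.
  have hmassν : ∀ i j, ENNReal.ofReal (π i j) * ProbabilityTheory.cond ν (B j) univ = ENNReal.ofReal (π i j) := by
    intro i j
    rcases (hπ0 i j).eq_or_lt with h0 | h0
    · simp [← h0]
    · have hj : ν (B j) ≠ 0 := by
        intro hj
        have := Finset.single_le_sum (f := fun i => π i j) (fun i _ => hπ0 i j) (Finset.mem_univ i)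
        rw [hπ2 j, measureReal_def, hj] at this
        simp at this
        linarith
      have := cond_isProbabilityMeasure hj
      simp
  have hmassμ : ∀ i j, ENNReal.ofReal (π i j) * ProbabilityTheory.cond μ (A i) univ = ENNReal.ofReal (π i j) := by
    intro i j
    rcases (hπ0 i j).eq_or_lt with h0 | h0
    · simp [← h0]
    · have hi : μ (A i) ≠ 0 := by
        intro hi
        have := Finset.single_le_sum (f := fun j => π i j) (fun j _ => hπ0 i j) (Finset.mem_univ j)
        rw [hπ1 i, measureReal_def, hi] at this
        simp at this
        linarith
      have := cond_isProbabilityMeasure hi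
      simp
  have hrest : ∀ (ρ : Measure X) {n : ℕ} {S : Option (Fin n) → Set X},
      (∀ i, MeasurableSet (S i)) → (Pairwise fun i j => Disjoint (S i) (S j)) →
      (⋃ i, S i) = univ → ∑ i, ρ.restrict (S i) = ρ := by
    intro ρ n S hS hSd hSU
    rw [← Measure.sum_fintype, ← Measure.restrict_iUnion hSd hS, hSU, Measure.restrict_univ]
  have hsumπ : ∀ i, ∑ j, ENNReal.ofReal (π i j) = ENNReal.ofReal (μ.real (A i)) := fun i => by
    rw [← ENNReal.ofReal_sum_of_nonneg fun j _ => hπ0 i j, hπ1]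
  have hsumπ' : ∀ j, ∑ i, ENNReal.ofReal (π i j) = ENNReal.ofReal (ν.real (B j)) := fun j => by
    rw [← ENNReal.ofReal_sum_of_nonneg fun i _ => hπ0 i j, hπ2]
  -- The finite plan is spread back over the cells by independent conditional laws. Going from a
  -- point to its atom, along the finite plan, then from an atom to its point costs `ε + (D + 2ε) +
  -- ε`.
  refine ⟨∑ i, ∑ j, ENNReal.ofReal (π i j) • (ProbabilityTheory.cond μ (A i)).prod (ProbabilityTheory.cond ν (B j)), ⟨?_, ?_⟩, ?_⟩
  · rw [Measure.map_finset_sum measurable_fst.aemeasurable]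
    simp only [Measure.map_finset_sum measurable_fst.aemeasurable, Measure.map_smul,
      Measure.map_fst_prod, smul_smul, hmassν, ← Finset.sum_smul, hsumπ, condp]
    exact hrest μ hA hAd hAU
  · rw [Measure.map_finset_sum measurable_snd.aemeasurable]
    simp only [Measure.map_finset_sum measurable_snd.aemeasurable, Measure.map_smul,
      Measure.map_snd_prod, smul_smul, hmassμ]
    rw [Finset.sum_comm]
    simp only [← Finset.sum_smul, hsumπ', condp]
    exact hrest ν hB hBd hBU
  · simp only [lintegral_finsetSum_measure, lintegral_smul_measure, smul_eq_mul]
    have hij : ∀ i j, ENNReal.ofReal (π i j) *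
        ∫⁻ p, c p.1 p.2 ∂((ProbabilityTheory.cond μ (A i)).prod (ProbabilityTheory.cond ν (B j))) ≤
        ENNReal.ofReal (π i j) * ∫⁻ x, c x (ξ i) ∂(ProbabilityTheory.cond μ (A i)) +
        (ENNReal.ofReal (π i j * cK K (ξ i) (ζ j)) +
        ENNReal.ofReal (π i j) * ∫⁻ y, c y (ζ j) ∂(ProbabilityTheory.cond ν (B j))) := by
      intro i j
      rw [← hπcost, ← mul_add, ← mul_add]
      gcongr
      have m1 : Measurable fun p : X × X => c p.1 (ξ i) := (hmeas _).comp measurable_fst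
      have m2 : Measurable fun p : X × X => c p.2 (ζ j) := (hmeas _).comp measurable_snd
      calc ∫⁻ p, c p.1 p.2 ∂((ProbabilityTheory.cond μ (A i)).prod (ProbabilityTheory.cond ν (B j)))
          ≤ ∫⁻ p, (c p.1 (ξ i) + (c (ξ i) (ζ j) + c p.2 (ζ j)))
            ∂((ProbabilityTheory.cond μ (A i)).prod (ProbabilityTheory.cond ν (B j))) := by
            refine lintegral_mono fun p => (htri _ (ξ i) _).trans ?_
            gcongr
            rw [hcomm p.2]
            exact htri _ _ _
        _ = ∫⁻ p, c p.1 (ξ i) ∂((ProbabilityTheory.cond μ (A i)).prod (ProbabilityTheory.cond ν (B j))) +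
            (c (ξ i) (ζ j) * ((ProbabilityTheory.cond μ (A i)).prod (ProbabilityTheory.cond ν (B j))) univ +
            ∫⁻ p, c p.2 (ζ j) ∂((ProbabilityTheory.cond μ (A i)).prod (ProbabilityTheory.cond ν (B j)))) := by
            rw [lintegral_add_left m1, lintegral_add_left measurable_const, lintegral_const]
        _ ≤ _ := by
            gcongr
            · rw [← lintegral_map (hmeas (ξ i)) measurable_fst, Measure.map_fst_prod,
                lintegral_smul_measure, smul_eq_mul]
              exact mul_le_of_le_one_left' (condle ν _)
            · refine mul_le_of_le_one_right' ?_
              rw [← univ_prod_univ, Measure.prod_prod]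
              exact mul_le_one' (condle μ _) (condle ν _)
            · rw [← lintegral_map (hmeas (ζ j)) measurable_snd, Measure.map_snd_prod,
                lintegral_smul_measure, smul_eq_mul]
              exact mul_le_of_le_one_left' (condle μ _)
    refine (Finset.sum_le_sum fun i _ => Finset.sum_le_sum fun j _ => hij i j).trans ?_
    simp only [Finset.sum_add_distrib]
    have s1 : ∑ i, ∑ j, ENNReal.ofReal (π i j) * ∫⁻ x, c x (ξ i) ∂(ProbabilityTheory.cond μ (A i)) ≤
        ENNReal.ofReal ε := by
      refine le_trans (le_of_eq (Finset.sum_congr rfl fun i _ => ?_)) hAc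
      rw [← Finset.sum_mul, hsumπ, ← smul_eq_mul, ← lintegral_smul_measure, condp]
    have s2 : ∑ i, ∑ j, ENNReal.ofReal (π i j * cK K (ξ i) (ζ j)) ≤
        ENNReal.ofReal (D + 2 * ε) := by
      simp only [← ENNReal.ofReal_sum_of_nonneg fun j (_ : j ∈ Finset.univ) =>
        mul_nonneg (hπ0 _ j) (cK0 K _ (ζ j))]
      rw [← ENNReal.ofReal_sum_of_nonneg fun i _ => Finset.sum_nonneg fun j _ =>
        mul_nonneg (hπ0 i j) (cK0 K _ _)]
      exact ENNReal.ofReal_le_ofReal hπc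
    have s3 : ∑ i, ∑ j, ENNReal.ofReal (π i j) * ∫⁻ y, c y (ζ j) ∂(ProbabilityTheory.cond ν (B j)) ≤
        ENNReal.ofReal ε := by
      rw [Finset.sum_comm]
      refine le_trans (le_of_eq (Finset.sum_congr rfl fun i _ => ?_)) hBc
      rw [← Finset.sum_mul, hsumπ', ← smul_eq_mul, ← lintegral_smul_measure, condp]
    refine (add_le_add s1 (add_le_add s2 s3)).trans (le_of_eq ?_)
    rw [← ENNReal.ofReal_add (by positivity) hε.le, ← ENNReal.ofReal_add hε.le (by positivity)]
    congr 1
    ring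

end Duality

end PDMP

/-! ### Smooth approximation with control of the gradient -/

namespace PDMP
open Set Filter Topology
open scoped Pointwise

section Smoothing
variable {V : Type*} [NormedAddCommGroup V] [NormedSpace ℝ V] [FiniteDimensional ℝ V]

/-- A continuous function is almost constant on small balls centred in a compact set. -/
lemma exists_radius {X Y : Type*} [PseudoMetricSpace X] [PseudoMetricSpace Y] {U : Set X}
    (hU : IsOpen U) {K : Set X} (hK : IsCompact K) (hKU : K ⊆ U) {u : X → Y}
    (hu : ContinuousOn u U) {η : ℝ} (hη : 0 < η) :
    ∃ r > 0, ∀ x ∈ K, ∀ z, dist z x ≤ r → z ∈ U ∧ dist (u z) (u x) ≤ η := by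
  have h1 := hK.uniformContinuousAt_of_continuousAt u
    (fun x hx => hu.continuousAt (hU.mem_nhds (hKU hx))) (Metric.dist_mem_uniformity hη)
  obtain ⟨r₁, hr₁, h1⟩ := Metric.mem_uniformity_dist.1 h1
  obtain ⟨r₂, hr₂, h2⟩ := hK.exists_cthickening_subset_open hU hKU
  refine ⟨min (r₁ / 2) r₂, by positivity, fun x hx z hz => ⟨h2 ?_, ?_⟩⟩
  · exact Metric.mem_cthickening_of_dist_le z x r₂ K hx (hz.trans (min_le_right _ _))
  · have : dist x z < r₁ := by
      rw [dist_comm]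
      have := hz.trans (min_le_left _ _)
      linarith
    have := h1 this hx
    rw [dist_comm]
    exact (le_of_lt this)

/-- Mollification near a compact set of a locally Lipschitz function. -/
lemma exists_local_mollification [MeasurableSpace V] [BorelSpace V] {U : Set V} (hU : IsOpen U)
    {f w : V → ℝ}
    (hf : ContinuousOn f U) (hw : ContinuousOn w U) (hw0 : ∀ x ∈ U, 0 ≤ w x)
    (hlip : ∀ y z G, segment ℝ y z ⊆ U → (∀ v ∈ segment ℝ y z, w v ≤ G) →
      |f z - f y| ≤ G * ‖z - y‖)
    {K : Set V} (hK : IsCompact K) (hKU : K ⊆ U) {η : ℝ} (hη : 0 < η) :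
    ∃ F : V → ℝ, ContDiff ℝ ∞ F ∧ ∀ x ∈ K, |F x - f x| ≤ η ∧ ‖fderiv ℝ F x‖ ≤ w x + η := by
  obtain ⟨r₁, hr₁, h1⟩ := exists_radius hU hK hKU hf hη
  obtain ⟨r₂, hr₂, h2⟩ := exists_radius hU hK hKU hw hη
  set r := min r₁ r₂ with hr
  have hr0 : 0 < r := lt_min hr₁ hr₂
  set T := Metric.cthickening r K with hT
  have hTc : IsCompact T := hK.cthickening
  have hTU : T ⊆ U := by
    rw [hT, hK.cthickening_eq_biUnion_closedBall hr0.le]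
    exact iUnion₂_subset fun x hx z hz => (h1 x hx z (hz.trans (min_le_left _ _))).1
  -- Cutting `f` to a compact thickening makes it integrable without changing it within distance `r`
  -- of `K`.
  set g : V → ℝ := T.indicator f with hg
  have hgi : Integrable g (Measure.addHaar (G := V)) :=
    ((hf.mono hTU).integrableOn_compact hTc).integrable_indicator hTc.measurableSet
  have hgT : ∀ x ∈ K, ∀ z, dist z x ≤ r → g z = f z := fun x hx z hz =>
    indicator_of_mem (Metric.mem_cthickening_of_dist_le z x r K hx hz) f
  -- Support radius `r / 2`: for `y` within `r / 2` of `x ∈ K`, both `x - t` and `y - t` stay within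
  -- `r` of `x`.
  let φ : ContDiffBump (0 : V) := ⟨r / 4, r / 2, by positivity, by linarith⟩
  have hφs : HasCompactSupport (φ.normed (Measure.addHaar (G := V))) :=
    φ.hasCompactSupport_normed
  have hφc : ContDiff ℝ ∞ (φ.normed (Measure.addHaar (G := V))) := φ.contDiff_normed
  set F := convolution (φ.normed (Measure.addHaar (G := V))) g (ContinuousLinearMap.lsmul ℝ ℝ)
    Measure.addHaar with hF
  have hFc : ContDiff ℝ ∞ F := hφs.contDiff_convolution_left _ hφc hgi.locallyIntegrable
  have hex := hφs.convolutionExists_left (ContinuousLinearMap.lsmul ℝ ℝ) hφc.continuous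
    hgi.locallyIntegrable
  refine ⟨F, hFc, fun x hx => ⟨?_, ?_⟩⟩
  · have := φ.dist_normed_convolution_le (μ := Measure.addHaar (G := V)) (x₀ := x) (g := g) (ε := η)
      hgi.aestronglyMeasurable ?_
    · rw [hgT x hx x (by simpa using hr0.le)] at this
      exact this
    · intro z hz
      have hz' : dist z x ≤ r := by
        have : dist z x < r / 2 := hz
        linarith
      rw [hgT x hx z hz', hgT x hx x (by simpa using hr0.le)]
      exact (h1 x hx z (hz'.trans (min_le_left _ _))).2
  -- The gradient of the mollification is bounded through difference quotients: it averages
  -- increments of `f`, each controlled by `w x + η`.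
  · refine norm_fderiv_le_of_lip' ℝ (add_nonneg (hw0 x (hKU hx)) hη.le) ?_
    filter_upwards [Metric.ball_mem_nhds x (half_pos hr0)] with y hy
    rw [hF, convolution_def, convolution_def, ← integral_sub (hex y) (hex x)]
    simp only [ContinuousLinearMap.lsmul_apply, smul_eq_mul, ← mul_sub]
    have hb : ∀ t, ‖φ.normed (Measure.addHaar (G := V)) t * (g (y - t) - g (x - t))‖ ≤
        φ.normed (Measure.addHaar (G := V)) t * ((w x + η) * ‖y - x‖) := by
      intro t
      by_cases ht : t ∈ Metric.ball (0 : V) (r / 2)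
      · rw [norm_mul, Real.norm_of_nonneg (φ.nonneg_normed t)]
        refine mul_le_mul_of_nonneg_left ?_ (φ.nonneg_normed t)
        have ht' : ‖t‖ < r / 2 := by simpa using ht
        have hy' : ‖y - x‖ < r / 2 := by simpa [dist_eq_norm] using hy
        have hxt : dist (x - t) x ≤ r := by
          rw [dist_eq_norm, sub_sub_cancel_left, norm_neg]; linarith
        have hyt : dist (y - t) x ≤ r := by
          rw [dist_eq_norm, sub_right_comm]
          exact (norm_sub_le _ _).trans (by linarith)
        have hseg : ∀ v ∈ segment ℝ (x - t) (y - t), dist v x ≤ r := fun v hv =>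
          (convex_closedBall x r).segment_subset hxt hyt hv
        rw [hgT x hx _ hxt, hgT x hx _ hyt]
        have := hlip (x - t) (y - t) (w x + η)
          (fun v hv => (h1 x hx v ((hseg v hv).trans (min_le_left _ _))).1) (fun v hv => by
            have := (h2 x hx v ((hseg v hv).trans (min_le_right _ _))).2
            rw [Real.dist_eq] at this
            linarith [le_abs_self (w v - w x)])
        simpa using this
      · have : φ.normed (Measure.addHaar (G := V)) t = 0 := by
          rw [← Function.notMem_support, φ.support_normed_eq]
          exact ht
        simp [this]
    refine (norm_integral_le_of_norm_le
      ((hφc.continuous.integrable_of_hasCompactSupport hφs).mul_const _)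
      (ae_of_all _ hb)).trans (le_of_eq ?_)
    rw [integral_mul_const, φ.integral_normed, one_mul]

/-- The bumps of a partition of unity of the half line `[0, ∞)` by smooth functions. -/
noncomputable def unitBump (k : ℕ) (s : ℝ) : ℝ :=
  Real.smoothTransition (s - k + 1) - Real.smoothTransition (s - k)

lemma unitBump_contDiff (k : ℕ) : ContDiff ℝ ∞ (unitBump k) :=
  (Real.smoothTransition.contDiff.comp (by fun_prop)).sub
    (Real.smoothTransition.contDiff.comp (by fun_prop))

lemma unitBump_nonneg (k : ℕ) (s : ℝ) : 0 ≤ unitBump k s :=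
  sub_nonneg.2 (Real.smoothTransition.monotone (by linarith))

lemma unitBump_le_one (k : ℕ) (s : ℝ) : unitBump k s ≤ 1 := by
  have h1 := Real.smoothTransition.le_one (s - k + 1)
  have h2 := Real.smoothTransition.nonneg (s - k)
  unfold unitBump
  linarith

lemma unitBump_eq_zero_of_le {k : ℕ} {s : ℝ} (h : s ≤ k - 1) : unitBump k s = 0 := by
  rw [unitBump, Real.smoothTransition.zero_of_nonpos (by linarith),
    Real.smoothTransition.zero_of_nonpos (by linarith), sub_zero]

lemma unitBump_eq_zero_of_ge {k : ℕ} {s : ℝ} (h : k + 1 ≤ s) : unitBump k s = 0 := by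
  rw [unitBump, Real.smoothTransition.one_of_one_le (by linarith),
    Real.smoothTransition.one_of_one_le (by linarith), sub_self]

lemma sum_unitBump {N : ℕ} {s : ℝ} (h0 : 0 ≤ s) (h : s ≤ N) :
    ∑ k ∈ Finset.range (N + 1), unitBump k s = 1 := by
  have h1 : ∀ k : ℕ, unitBump k s = (fun k : ℕ => Real.smoothTransition (s - k + 1)) k -
      (fun k : ℕ => Real.smoothTransition (s - k + 1)) (k + 1) := by
    intro k
    simp only [unitBump, Nat.cast_add, Nat.cast_one]
    congr 2
    ring
  simp only [h1]
  rw [Finset.sum_range_sub']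
  rw [Real.smoothTransition.one_of_one_le (by simpa using h0),
    Real.smoothTransition.zero_of_nonpos (by push_cast; linarith), sub_zero]

/-- Greene–Wu approximation: a continuous function on an open set, whose local Lipschitz constant
is bounded by the continuous function `w`, is approximated by smooth functions, the gradient being
almost bounded by `w`. -/
theorem exists_smooth_approx [MeasurableSpace V] [BorelSpace V] {U : Set V} (hU : IsOpen U)
    {f w e : V → ℝ} (hf : ContinuousOn f U) (hw : ContinuousOn w U) (hw0 : ∀ x ∈ U, 0 ≤ w x)
    (hlip : ∀ y z G, segment ℝ y z ⊆ U → (∀ v ∈ segment ℝ y z, w v ≤ G) →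
      |f z - f y| ≤ G * ‖z - y‖) (he : ContinuousOn e U) (he0 : ∀ x ∈ U, 0 < e x) :
    ∃ g : V → ℝ, ContDiffOn ℝ ∞ g U ∧
      ∀ x ∈ U, |g x - f x| ≤ e x ∧ ‖fderiv ℝ g x‖ ≤ w x + e x := by
  -- With `h > 0` exactly on `U`, the function `ρ = 1/h + ‖L x‖²` is a smooth exhaustion of `U`. The
  -- Euclidean coordinates `L` are needed because the norm of `V` may fail to be smooth.
  obtain ⟨h, hsupp, hhc, hrange⟩ := hU.exists_contDiff_support_eq (n := ⊤)
  have hh0 : ∀ x ∈ U, 0 < h x := fun x hx => by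
    have h1 : 0 ≤ h x := (hrange ⟨x, rfl⟩).1
    have h2 : h x ≠ 0 := by rw [← Function.mem_support, hsupp]; exact hx
    exact lt_of_le_of_ne h1 h2.symm
  let V' := EuclideanSpace ℝ (Fin (Module.finrank ℝ V))
  let L : V ≃L[ℝ] V' := ContinuousLinearEquiv.ofFinrankEq (by simp [V'])
  set ρ : V → ℝ := fun x => (h x)⁻¹ + ‖L x‖ ^ 2 with hρ
  have hρc : ContDiffOn ℝ ∞ ρ U := by
    refine (hhc.contDiffOn.inv fun x hx => (hh0 x hx).ne').add ?_
    exact (L.contDiff.norm_sq ℝ).contDiffOn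
  have hρ0 : ∀ x ∈ U, 0 ≤ ρ x := fun x hx => by
    have := hh0 x hx
    positivity
  -- The sublevel set `ρ ≤ n`, written without an inverse so that it is visibly closed in `V` and
  -- excludes the zeros of `h`.
  set K : ℕ → Set V := fun n => {x | 1 ≤ h x * (n - ‖L x‖ ^ 2)} with hK
  have hKρ : ∀ n : ℕ, ∀ x ∈ U, ρ x ≤ n → x ∈ K n := by
    intro n x hx hxn
    have h1 := hh0 x hx
    have h2 : (h x)⁻¹ ≤ n - ‖L x‖ ^ 2 := by simp only [hρ] at hxn; linarith
    rwa [inv_le_iff_one_le_mul₀' h1] at h2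
  have hKU : ∀ n, K n ⊆ U := by
    intro n x hx
    rw [← hsupp, Function.mem_support]
    intro h0
    simp only [hK, mem_ofPred_eq, h0, zero_mul] at hx
    linarith
  have hKc : ∀ n, IsCompact (K n) := by
    intro n
    have hcl : IsClosed (K n) := by
      refine isClosed_le continuous_const (hhc.continuous.mul ?_)
      exact continuous_const.sub (L.continuous.norm.pow 2)
    have hsub : K n ⊆ L ⁻¹' Metric.closedBall 0 (n + 1) := by
      intro x hx
      have h1 := hh0 x (hKU n hx)
      simp only [hK, mem_ofPred_eq] at hx
      have h2 : 0 < (n : ℝ) - ‖L x‖ ^ 2 := by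
        by_contra! h3
        nlinarith
      simp only [mem_preimage, mem_closedBall_zero_iff]
      have h4 : (0 : ℝ) ≤ n := Nat.cast_nonneg n
      nlinarith [norm_nonneg (L x)]
    refine IsCompact.of_isClosed_subset ?_ hcl hsub
    exact L.toHomeomorph.isClosedEmbedding.isCompact_preimage (isCompact_closedBall _ _)
  -- the cutoffs
  set ψ : ℕ → V → ℝ := fun k x => unitBump k (ρ x) with hψ
  have hψc : ∀ k, ContDiffOn ℝ ∞ (ψ k) U := fun k => (unitBump_contDiff k).comp_contDiffOn hρc
  have hψd : ∀ k, ContinuousOn (fderiv ℝ (ψ k)) U := fun k =>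
    (hψc k).continuousOn_fderiv_of_isOpen hU (by simp)
  have hbound : ∀ k, ∃ D, 0 ≤ D ∧ ∀ x ∈ K (k + 1), ‖fderiv ℝ (ψ k) x‖ ≤ D := by
    intro k
    obtain ⟨D, hD⟩ := (hKc (k + 1)).exists_bound_of_continuousOn ((hψd k).mono (hKU _))
    exact ⟨max D 0, le_max_right _ _, fun x hx => (hD x hx).trans (le_max_left _ _)⟩
  choose D hD0 hD using hbound
  have hmin : ∀ k, ∃ c > 0, ∀ x ∈ K (k + 1), c ≤ e x := by
    intro k
    rcases (K (k + 1)).eq_empty_or_nonempty with hemp | hne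
    · exact ⟨1, one_pos, by simp [hemp]⟩
    · obtain ⟨x, hx, hmin⟩ := (hKc (k + 1)).exists_isMinOn hne (he.mono (hKU _))
      exact ⟨e x, he0 x (hKU _ hx), fun y hy => hmin hy⟩
  choose c hc0 hc using hmin
  -- The precision on the `k`-th shell absorbs the derivative bound `D k` of its cutoff, and the
  -- errors add up to at most `e` through the geometric series.
  set η : ℕ → ℝ := fun k => c k * (1 / 2) ^ (k + 1) / (1 + D k) with hη
  have hη0 : ∀ k, 0 < η k := fun k => by
    have := hc0 k
    have := hD0 k
    positivity
  choose F hFc hF using fun k => exists_local_mollification hU hf hw hw0 hlip (hKc (k + 1))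
    (hKU _) (hη0 k)
  have hηe : ∀ k, ∀ x ∈ K (k + 1), (1 + D k) * η k ≤ e x * (1 / 2) ^ (k + 1) := by
    intro k x hx
    have h1 : 0 < 1 + D k := by linarith [hD0 k]
    have : (1 + D k) * η k = c k * (1 / 2) ^ (k + 1) := by
      simp only [hη]
      field_simp
    rw [this]
    exact mul_le_mul_of_nonneg_right (hc k x hx) (by positivity)
  have hgeom : ∀ N, ∑ k ∈ Finset.range N, (1 / 2 : ℝ) ^ (k + 1) ≤ 1 := by
    intro N
    have := sum_geometric_two_le N
    simp only [pow_succ, ← Finset.sum_mul]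
    linarith
  set g : V → ℝ := fun x => ∑' k, ψ k x * F k x with hg
  have hρcont : ∀ x ∈ U, ContinuousAt ρ x := fun x hx =>
    hρc.continuousOn.continuousAt (hU.mem_nhds hx)
  -- local finite expression
  have hloc : ∀ x ∈ U, ∃ N : ℕ, ∀ᶠ y in 𝓝 x, y ∈ U ∧
      ∑ k ∈ Finset.range (N + 1), ψ k y = 1 ∧
      g y = ∑ k ∈ Finset.range (N + 1), ψ k y * F k y := by
    intro x hx
    obtain ⟨N, hN⟩ := exists_nat_gt (ρ x)
    refine ⟨N, ?_⟩
    filter_upwards [hU.mem_nhds hx, (hρcont x hx).eventually_lt_const hN] with y hy hyN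
    refine ⟨hy, sum_unitBump (hρ0 y hy) hyN.le, tsum_eq_sum fun k hk => ?_⟩
    rw [Finset.mem_range, not_lt] at hk
    have : (N : ℝ) + 1 ≤ k := by exact_mod_cast hk
    simp only [hψ]
    rw [unitBump_eq_zero_of_le (by linarith), zero_mul]
  have hout : ∀ k, ∀ x ∈ U, x ∉ K (k + 1) → ψ k x = 0 ∧ fderiv ℝ (ψ k) x = 0 := by
    intro k x hx hxK
    have h1 : (k : ℝ) + 1 < ρ x := by
      by_contra! h2
      exact hxK (hKρ (k + 1) x hx (by push_cast; exact h2))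
    have h3 : ψ k =ᶠ[𝓝 x] fun _ => 0 := by
      filter_upwards [(hρcont x hx).eventually_const_lt h1] with y hy
      exact unitBump_eq_zero_of_ge hy.le
    refine ⟨h3.eq_of_nhds, ?_⟩
    rw [h3.fderiv_eq]
    simp
  refine ⟨g, fun x hx => ?_, fun x hx => ?_⟩
  · obtain ⟨N, hN⟩ := hloc x hx
    have h1 : ContDiffAt ℝ ∞ (fun y => ∑ k ∈ Finset.range (N + 1), ψ k y * F k y) x :=
      ContDiffAt.sum fun k _ => ((hψc k).contDiffAt (hU.mem_nhds hx)).mul (hFc k).contDiffAt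
    exact (h1.congr_of_eventuallyEq (hN.mono fun y hy => hy.2.2)).contDiffWithinAt
  · obtain ⟨N, hN⟩ := hloc x hx
    have hNx := hN.self_of_nhds
    have hterm : ∀ k, ψ k x * |F k x - f x| + ‖fderiv ℝ (ψ k) x‖ * |F k x - f x| ≤
        e x * (1 / 2) ^ (k + 1) ∧ ψ k x * ‖fderiv ℝ (F k) x‖ + ‖fderiv ℝ (ψ k) x‖ * |F k x - f x| ≤
        ψ k x * w x + e x * (1 / 2) ^ (k + 1) := by
      intro k
      by_cases hxK : x ∈ K (k + 1)
      · obtain ⟨h1, h2⟩ := hF k x hxK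
        have h3 := hηe k x hxK
        have h4 := hD k x hxK
        have h5 : ‖fderiv ℝ (ψ k) x‖ * |F k x - f x| ≤ D k * η k :=
          mul_le_mul h4 h1 (abs_nonneg _) (hD0 k)
        have h6 := unitBump_nonneg k (ρ x)
        have h7 := unitBump_le_one k (ρ x)
        have h8 : ψ k x * |F k x - f x| ≤ 1 * η k := mul_le_mul h7 h1 (abs_nonneg _) zero_le_one
        have h9 : ψ k x * ‖fderiv ℝ (F k) x‖ ≤ ψ k x * (w x + η k) :=
          mul_le_mul_of_nonneg_left h2 h6
        have h10 : ψ k x * η k ≤ 1 * η k := mul_le_mul_of_nonneg_right h7 (hη0 k).le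
        constructor <;> nlinarith
      · obtain ⟨h1, h2⟩ := hout k x hx hxK
        have := he0 x hx
        rw [h1, h2]
        constructor <;> simp <;> positivity
    have hsum1 : ∑ k ∈ Finset.range (N + 1), e x * (1 / 2) ^ (k + 1) ≤ e x := by
      rw [← Finset.mul_sum]
      have := mul_le_mul_of_nonneg_left (hgeom (N + 1)) (he0 x hx).le
      linarith
    constructor
    · have e1 : g x - f x = ∑ k ∈ Finset.range (N + 1), ψ k x * (F k x - f x) := by
        simp only [mul_sub, Finset.sum_sub_distrib, ← Finset.sum_mul]
        rw [hNx.2.1, hNx.2.2, one_mul]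
      rw [e1]
      refine (Finset.abs_sum_le_sum_abs _ _).trans (le_trans (Finset.sum_le_sum fun k _ => ?_) hsum1)
      rw [abs_mul, abs_of_nonneg (unitBump_nonneg k (ρ x))]
      have := (hterm k).1
      have : 0 ≤ ‖fderiv ℝ (ψ k) x‖ * |F k x - f x| := by positivity
      linarith
    -- As the cutoffs sum to `1` near `x`, the constant `f x` may be subtracted from each `F k`. The
    -- derivatives of the cutoffs then multiply only the small errors `F k x - f x`.
    · have e1 : g =ᶠ[𝓝 x] fun y => ∑ k ∈ Finset.range (N + 1), ψ k y * (F k y - f x) + f x := by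
        filter_upwards [hN] with y hy
        simp only [mul_sub, Finset.sum_sub_distrib, ← Finset.sum_mul]
        rw [hy.2.1, hy.2.2, one_mul]
        ring
      have hd : HasFDerivAt (fun y => ∑ k ∈ Finset.range (N + 1), ψ k y * (F k y - f x) + f x)
          (∑ k ∈ Finset.range (N + 1), (ψ k x • fderiv ℝ (F k) x +
            (F k x - f x) • fderiv ℝ (ψ k) x)) x := by
        refine HasFDerivAt.add_const _ (HasFDerivAt.fun_sum fun k _ => ?_)
        have d1 := (((hψc k).contDiffAt (hU.mem_nhds hx)).differentiableAt (by simp)).hasFDerivAt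
        have d2 := ((hFc k).differentiable (by simp) x).hasFDerivAt
        exact d1.mul (d2.sub_const (f x))
      rw [e1.fderiv_eq, hd.fderiv]
      calc _ ≤ ∑ k ∈ Finset.range (N + 1), (ψ k x * w x + e x * (1 / 2) ^ (k + 1)) := by
            refine norm_sum_le_of_le _ fun k _ => (norm_add_le _ _).trans ?_
            rw [norm_smul, norm_smul, Real.norm_of_nonneg (unitBump_nonneg k (ρ x)),
              Real.norm_eq_abs, mul_comm |F k x - f x|]
            exact (hterm k).2
        _ ≤ w x + e x := by
            rw [Finset.sum_add_distrib, ← Finset.sum_mul, hNx.2.1, one_mul]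
            linarith

end Smoothing

end PDMP

/-! ### Action of the jump kernel on Lipschitz functions -/

namespace PDMP
open Set Filter Topology

variable {d : ℕ} {Ω : TopologicalSpace.Opens (E d)} {a : Ω → ℝ}

section TestFunctions
variable {F : E d → ℝ}

lemma zeroExt_restrict_eventuallyEq (F : E d → ℝ) (x : Ω) :
    zeroExt (fun z : Ω => F z) =ᶠ[𝓝 (x : E d)] F := by
  filter_upwards [Ω.isOpen.mem_nhds x.2] with z hz using zeroExt_mk _ hz

lemma smoothOn_restrict (hF : ContDiffOn ℝ ∞ F (Ω : Set (E d))) :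
    SmoothOn (fun z : Ω => F z) :=
  ContDiffOn.congr hF fun _ hz => zeroExt_mk _ hz

lemma norm_grad (f : Ω → ℝ) (x : Ω) : ‖grad f x‖ = ‖fderiv ℝ (zeroExt f) (x : E d)‖ := by
  simp [grad, gradient]

lemma norm_grad_restrict (F : E d → ℝ) (x : Ω) :
    ‖grad (fun z : Ω => F z) x‖ = ‖fderiv ℝ F (x : E d)‖ := by
  rw [norm_grad, (zeroExt_restrict_eventuallyEq F x).fderiv_eq]

lemma mem_testFunctions_of_eventually_zero (hF : ContDiffOn ℝ ∞ F (Ω : Set (E d))) {R : ℝ}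
    (hR : ∀ x, R < ‖x‖ → F x = 0) : (fun z : Ω => F z) ∈ testFunctions Ω := by
  refine ⟨smoothOn_restrict hF, fun n => ⟨0, 0, R + 1, fun x hx => ?_⟩⟩
  have h0 : zeroExt (fun z : Ω => F z) =ᶠ[𝓝 (x : E d)] fun _ => 0 := by
    have : ∀ᶠ z in 𝓝 (x : E d), R < ‖z‖ :=
      continuous_norm.continuousAt.eventually_const_lt (by linarith)
    filter_upwards [this, zeroExt_restrict_eventuallyEq F x] with z h1 h2
    rw [h2, hR z h1]
  rw [(h0.iteratedFDeriv ℝ n).eq_of_nhds]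
  have : iteratedFDeriv ℝ n (fun _ : E d => (0 : ℝ)) = 0 := iteratedFDeriv_fun_zero
  simp [this]

lemma SmoothOn.continuous_grad {f : Ω → ℝ} (hf : SmoothOn f) : Continuous (grad f) := by
  have h := continuousOn_iff_continuous_domRestrict.1 hf.continuousOn_fderiv
  exact (InnerProductSpace.toDual ℝ (E d)).symm.continuous.comp h

lemma SmoothOn.continuous_phi {f : Ω → ℝ} (ha : Continuous a) (hf : SmoothOn f) :
    Continuous (phi a f) :=
  ha.mul (hf.continuous_grad.norm.pow 2)

end TestFunctions

/-- The domination property of the jump kernel, in terms of a continuous function. -/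
def KernelBound (a : Ω → ℝ) (Q : Kernel Ω Ω) (m : Ω → ℝ) : Prop :=
  ∀ f ∈ testFunctions Ω, (∀ x, Integrable f (Q x)) → (∀ x, Integrable (phi a f) (Q x)) →
    ∀ x, phi a (act Q f) x ≤ m x ^ 2 * act Q (phi a f) x

/-- A smooth cutoff at infinity. -/
noncomputable def cutoff (d : ℕ) : ContDiffBump (0 : E d) := ⟨1, 2, one_pos, one_lt_two⟩

lemma exists_fderiv_cutoff_bound (d : ℕ) : ∃ C, 0 ≤ C ∧ ∀ x, ‖fderiv ℝ (cutoff d) x‖ ≤ C := by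
  obtain ⟨C, hC⟩ := ((cutoff d).hasCompactSupport.fderiv ℝ).exists_bound_of_continuous
    ((cutoff d).contDiff.continuous_fderiv (n := ∞) (by simp))
  exact ⟨max C 0, le_max_right _ _, fun x => (hC x).trans (le_max_left _ _)⟩

/-- A bounded smooth `g` need not be a test function, so it is cut off at scale `n + 1`. The
gradient of the cutoff is `O(1/n)` and adds to `φ_a` at most a multiple of `(1 + a)/n`, whose
`Q`-average vanishes in the limit because `a` is integrable. The bound on `φ_a(Qf)` gives a gradient
bound for each cutoff, which is integrated along the segment before letting `n → ∞`. -/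
lemma abs_act_sub_le_of_smooth {Q : Kernel Ω Ω} [IsMarkovKernel Q]
    (hQ : ∀ f ∈ testFunctions Ω, (∀ x, Integrable f (Q x)) → act Q f ∈ testFunctions Ω)
    (ha : a ∈ testFunctions Ω) (hpos : ∀ x, 0 < a x) (haQ : ∀ x, Integrable a (Q x))
    {m : Ω → ℝ} (hm0 : ∀ x, 0 ≤ m x) (hm : KernelBound a Q m)
    {g : E d → ℝ} (hg : ContDiffOn ℝ ∞ g (Ω : Set (E d))) {B L : ℝ} (hL : 0 ≤ L)
    (hgB : ∀ x : Ω, |g x| ≤ B) (hgL : ∀ x : Ω, ‖fderiv ℝ g x‖ ≤ L / Real.sqrt (a x))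
    {x y : Ω} {G : ℝ} (hseg : segment ℝ (x : E d) y ⊆ Ω)
    (hG : ∀ z : Ω, (z : E d) ∈ segment ℝ (x : E d) y → m z / Real.sqrt (a z) ≤ G) :
    |act Q (fun z => g z) y - act Q (fun z => g z) x| ≤ L * G * ‖(y : E d) - x‖ := by
  have hac : Continuous a := SmoothOn.continuous ha.1
  have hB0 : 0 ≤ B := (abs_nonneg _).trans (hgB x)
  have hG0 : 0 ≤ G := (div_nonneg (hm0 x) (Real.sqrt_nonneg _)).trans
    (hG x (left_mem_segment ℝ _ _))
  obtain ⟨C, hC0, hC⟩ := exists_fderiv_cutoff_bound d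
  -- the cutoffs of `g`
  let χ : ℕ → E d → ℝ := fun n z => cutoff d ((n + 1 : ℝ)⁻¹ • z)
  have hχc : ∀ n, ContDiff ℝ ∞ (χ n) := fun n => (cutoff d).contDiff.comp (by fun_prop)
  have hχ0 : ∀ n z, 0 ≤ χ n z := fun n z => (cutoff d).nonneg
  have hχ1 : ∀ n z, χ n z ≤ 1 := fun n z => (cutoff d).le_one
  have hχd : ∀ n z, ‖fderiv ℝ (χ n) z‖ ≤ C * (n + 1 : ℝ)⁻¹ := by
    intro n z
    have h1 : HasFDerivAt (fun z : E d => (n + 1 : ℝ)⁻¹ • z)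
        ((n + 1 : ℝ)⁻¹ • ContinuousLinearMap.id ℝ (E d)) z :=
      ((n + 1 : ℝ)⁻¹ • ContinuousLinearMap.id ℝ (E d)).hasFDerivAt
    have h2 := (((cutoff d).contDiff (n := ⊤)).differentiable (by simp)
      ((n + 1 : ℝ)⁻¹ • z)).hasFDerivAt
    have h3 : HasFDerivAt (χ n) _ z := h2.comp z h1
    rw [h3.fderiv, ContinuousLinearMap.comp_smul, ContinuousLinearMap.comp_id, norm_smul,
      Real.norm_of_nonneg (by positivity), mul_comm]
    exact mul_le_mul_of_nonneg_right (hC _) (by positivity)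
  let F : ℕ → E d → ℝ := fun n z => g z * χ n z
  have hFc : ∀ n, ContDiffOn ℝ ∞ (F n) (Ω : Set (E d)) := fun n => hg.mul (hχc n).contDiffOn
  let f : ℕ → Ω → ℝ := fun n z => F n z
  have hft : ∀ n, f n ∈ testFunctions Ω := by
    intro n
    refine mem_testFunctions_of_eventually_zero (R := 2 * (n + 1)) (hFc n) fun z hz => ?_
    have : χ n z = 0 := by
      refine (cutoff d).zero_of_le_dist ?_
      rw [dist_zero_right, norm_smul, norm_inv, Real.norm_of_nonneg (by positivity : (0:ℝ) ≤ n + 1)]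
      change (2 : ℝ) ≤ _
      rw [inv_mul_eq_div, le_div_iff₀ (by positivity)]
      exact hz.le
    simp [F, this]
  have hfB : ∀ n z, ‖f n z‖ ≤ B := by
    intro n z
    simp only [f, F, norm_mul, Real.norm_eq_abs, abs_of_nonneg (hχ0 n z)]
    calc |g z| * χ n z ≤ B * 1 := mul_le_mul (hgB z) (hχ1 n z) (hχ0 n z) hB0
      _ = B := mul_one B
  have hfi : ∀ n z, Integrable (f n) (Q z) := fun n z =>
    Integrable.of_bound (SmoothOn.continuous (hft n).1).aestronglyMeasurable B
      (ae_of_all _ (hfB n))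
  have hφ : ∀ n z, phi a (f n) z ≤
      L ^ 2 + (L ^ 2 + 2 * (B * C) ^ 2 * a z) * (n + 1 : ℝ)⁻¹ := by
    intro n z
    have hsq := Real.sqrt_pos.2 (hpos z)
    have h1 : ‖fderiv ℝ (F n) z‖ ≤ L / Real.sqrt (a z) + B * (C * (n + 1 : ℝ)⁻¹) := by
      have d1 := (hg.differentiableOn (by simp)).differentiableAt (Ω.isOpen.mem_nhds z.2)
      have d2 := (hχc n).differentiable (by simp) (z : E d)
      have : fderiv ℝ (F n) z = g z • fderiv ℝ (χ n) z + χ n z • fderiv ℝ g z := fderiv_mul d1 d2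
      rw [this, add_comm]
      refine (norm_add_le _ _).trans (add_le_add ?_ ?_)
      · rw [norm_smul, Real.norm_of_nonneg (hχ0 n z)]
        calc _ ≤ 1 * (L / Real.sqrt (a z)) :=
              mul_le_mul (hχ1 n z) (hgL z) (norm_nonneg _) zero_le_one
          _ = _ := one_mul _
      · rw [norm_smul]
        exact mul_le_mul (hgB z) (hχd n z) (norm_nonneg _) hB0
    set t := Real.sqrt (a z)
    have ht : t ^ 2 = a z := Real.sq_sqrt (hpos z).le
    set r := (n + 1 : ℝ)⁻¹
    have hr0 : 0 ≤ r := by positivity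
    have hr1 : r ≤ 1 := inv_le_one_of_one_le₀ (by linarith [Nat.cast_nonneg (α := ℝ) n])
    have h2 : phi a (f n) z = (t * ‖fderiv ℝ (F n) z‖) ^ 2 := by
      rw [phi, norm_grad_restrict, mul_pow, ht]
    have h3 : t * ‖fderiv ℝ (F n) z‖ ≤ L + t * (B * C) * r := by
      calc _ ≤ t * (L / t + B * (C * r)) := mul_le_mul_of_nonneg_left h1 hsq.le
        _ = _ := by field_simp
    rw [h2, ← ht]
    have h4 : (t * ‖fderiv ℝ (F n) z‖) ^ 2 ≤ (L + t * (B * C) * r) ^ 2 :=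
      pow_le_pow_left₀ (by positivity) h3 2
    refine h4.trans ?_
    -- The cross term is split by `2Lt(BC) ≤ L² + (tBC)²`, and `r² ≤ r` bounds the quadratic one.
    have h5 : 0 ≤ r * (L - t * (B * C)) ^ 2 := by positivity
    have h6 : 0 ≤ r * (1 - r) * (t * (B * C)) ^ 2 :=
      mul_nonneg (mul_nonneg hr0 (by linarith)) (sq_nonneg _)
    nlinarith
  have hdomi : ∀ (n : ℕ) z, Integrable (fun z =>
      L ^ 2 + (L ^ 2 + 2 * (B * C) ^ 2 * a z) * (n + 1 : ℝ)⁻¹) (Q z) := fun n z =>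
    (integrable_const _).add (((integrable_const _).add ((haQ z).const_mul _)).mul_const _)
  have hφ0 : ∀ n z, 0 ≤ phi a (f n) z := fun n z => mul_nonneg (hpos z).le (sq_nonneg _)
  have hφi : ∀ n z, Integrable (phi a (f n)) (Q z) := fun n z =>
    (hdomi n z).mono' (SmoothOn.continuous_phi hac (hft n).1).aestronglyMeasurable
      (ae_of_all _ fun z => by rw [Real.norm_of_nonneg (hφ0 n z)]; exact hφ n z)
  -- Stability of the test functions under `Q`, applied to the weight itself, bounds `Qa` on the
  -- compact segment.
  have hQa : Continuous (act Q a) := SmoothOn.continuous (hQ a ha haQ).1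
  obtain ⟨A, hA⟩ : ∃ A, ∀ z : Ω, (z : E d) ∈ segment ℝ (x : E d) y → act Q a z ≤ A := by
    have hcomp : IsCompact (Subtype.val ⁻¹' segment ℝ (x : E d) y : Set Ω) := by
      rw [Subtype.isCompact_iff, image_preimage_eq_of_subset fun z hz => ⟨⟨z, hseg hz⟩, rfl⟩,
        segment_eq_image_lineMap]
      exact isCompact_Icc.image (by fun_prop)
    obtain ⟨A, hA⟩ := hcomp.exists_bound_of_continuousOn hQa.continuousOn
    exact ⟨A, fun z hz => (le_abs_self _).trans (hA z hz)⟩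
  set c := L ^ 2 + 2 * (B * C) ^ 2 * A with hc
  have hQφ : ∀ n (z : Ω), (z : E d) ∈ segment ℝ (x : E d) y →
      act Q (phi a (f n)) z ≤ L ^ 2 + c * (n + 1 : ℝ)⁻¹ := by
    intro n z hz
    refine (integral_mono (hφi n z) (hdomi n z) (hφ n)).trans ?_
    have i1 := (haQ z).const_mul (2 * (B * C) ^ 2)
    have i2 : Integrable (fun z => L ^ 2 + 2 * (B * C) ^ 2 * a z) (Q z) :=
      (integrable_const _).add i1
    rw [integral_add (integrable_const _) (i2.mul_const _),
      integral_mul_const, integral_add (integrable_const _) i1, integral_const_mul]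
    simp only [integral_const, probReal_univ, one_smul]
    have := hA z hz
    unfold act at this
    rw [hc]
    gcongr
  have hlip : ∀ n, |act Q (f n) y - act Q (f n) x| ≤
      G * Real.sqrt (L ^ 2 + c * (n + 1 : ℝ)⁻¹) * ‖(y : E d) - x‖ := by
    intro n
    have hs : SmoothOn (act Q (f n)) := (hQ _ (hft n) (hfi n)).1
    have hder : ∀ z ∈ segment ℝ (x : E d) y, ‖fderiv ℝ (zeroExt (act Q (f n))) z‖ ≤
        G * Real.sqrt (L ^ 2 + c * (n + 1 : ℝ)⁻¹) := by
      intro z hz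
      set z' : Ω := ⟨z, hseg hz⟩
      have h1 := hm (f n) (hft n) (hfi n) (hφi n) z'
      have h2 := hQφ n z' hz
      have h3 := hG z' hz
      have ht := Real.sqrt_pos.2 (hpos z')
      have h4 : (Real.sqrt (a z') * ‖grad (act Q (f n)) z'‖) ^ 2 ≤
          (m z' * Real.sqrt (L ^ 2 + c * (n + 1 : ℝ)⁻¹)) ^ 2 := by
        have h5 : 0 ≤ act Q (phi a (f n)) z' := integral_nonneg (hφ0 n)
        rw [mul_pow, mul_pow, Real.sq_sqrt (hpos z').le, Real.sq_sqrt (h5.trans h2)]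
        exact h1.trans (mul_le_mul_of_nonneg_left h2 (sq_nonneg _))
      have h6 := abs_le_of_sq_le_sq h4 (mul_nonneg (hm0 z') (Real.sqrt_nonneg _))
      have h7 := (abs_le.1 h6).2
      have h8 : ‖fderiv ℝ (zeroExt (act Q (f n))) z‖ = ‖grad (act Q (f n)) z'‖ :=
        (norm_grad _ z').symm
      rw [h8]
      calc ‖grad (act Q (f n)) z'‖
          ≤ m z' * Real.sqrt (L ^ 2 + c * (n + 1 : ℝ)⁻¹) / Real.sqrt (a z') := by
            rw [le_div_iff₀ ht]; linarith
        _ = m z' / Real.sqrt (a z') * Real.sqrt (L ^ 2 + c * (n + 1 : ℝ)⁻¹) := by ring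
        _ ≤ _ := mul_le_mul_of_nonneg_right h3 (Real.sqrt_nonneg _)
    have := (convex_segment (x : E d) y).norm_image_sub_le_of_norm_fderiv_le
      (fun z hz => hs.differentiableAt ⟨z, hseg hz⟩) hder (left_mem_segment ℝ _ _)
      (right_mem_segment ℝ _ _)
    simpa only [zeroExt_coe, Real.norm_eq_abs] using this
  have htend : ∀ z, Tendsto (fun n => act Q (f n) z) atTop (𝓝 (act Q (fun z => g z) z)) := by
    intro z
    refine tendsto_integral_of_dominated_convergence (fun _ => B)
      (fun n => (hfi n z).aestronglyMeasurable) (integrable_const _)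
      (fun n => ae_of_all _ (hfB n)) (ae_of_all _ fun v => ?_)
    refine tendsto_const_nhds.congr' ?_
    obtain ⟨N, hN⟩ := exists_nat_gt ‖(v : E d)‖
    filter_upwards [eventually_ge_atTop N] with n hn
    have : χ n v = 1 := by
      refine (cutoff d).one_of_mem_closedBall ?_
      rw [mem_closedBall_zero_iff, norm_smul, norm_inv,
        Real.norm_of_nonneg (by positivity : (0:ℝ) ≤ n + 1), inv_mul_eq_div]
      change _ ≤ (1 : ℝ)
      rw [div_le_one (by positivity)]
      have : (N : ℝ) ≤ n := by exact_mod_cast hn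
      linarith
    simp [f, F, this]
  have hr : Tendsto (fun n : ℕ => G * Real.sqrt (L ^ 2 + c * (n + 1 : ℝ)⁻¹) * ‖(y : E d) - x‖)
      atTop (𝓝 (G * Real.sqrt (L ^ 2 + c * 0) * ‖(y : E d) - x‖)) := by
    have h1 : Tendsto (fun n : ℕ => (n + 1 : ℝ)⁻¹) atTop (𝓝 0) := by
      simpa using tendsto_one_div_add_atTop_nhds_zero_nat (𝕜 := ℝ)
    exact (((h1.const_mul c).const_add (L ^ 2)).sqrt.const_mul G).mul_const _
  have := le_of_tendsto_of_tendsto' ((htend y).sub (htend x)).abs hr hlip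
  rwa [mul_zero, add_zero, Real.sqrt_sq hL, mul_comm G] at this

lemma DLip.abs_sub_le {f : Ω → ℝ} {L : ℝ} (hL : 0 < L) (hf : DLip a L f) {y z : Ω} {G : ℝ}
    (hseg : segment ℝ (y : E d) z ⊆ Ω)
    (hG : ∀ v : Ω, (v : E d) ∈ segment ℝ (y : E d) z → L / Real.sqrt (a v) ≤ G) :
    |f z - f y| ≤ G * ‖(z : E d) - y‖ := by
  have hG0 : 0 ≤ G := (div_nonneg hL.le (Real.sqrt_nonneg _)).trans
    (hG y (left_mem_segment ℝ _ _))
  have h1 : wdist a y z ≤ ENNReal.ofReal (G / L * ‖(z : E d) - y‖) :=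
    wdist_le_of_segment hseg fun v hv => by
      rw [le_div_iff₀ hL]
      have := hG v hv
      rwa [one_div, inv_mul_eq_div]
  have h2 : ENNReal.ofReal L * wdist a y z ≤ ENNReal.ofReal (G * ‖(z : E d) - y‖) := by
    refine (mul_le_mul_right h1 _).trans (le_of_eq ?_)
    rw [← ENNReal.ofReal_mul hL.le]
    congr 1
    field_simp
  have h3 : 0 ≤ G * ‖(z : E d) - y‖ := by positivity
  refine abs_le.2 ⟨?_, ?_⟩
  · have := (ENNReal.ofReal_le_ofReal_iff h3).1 ((hf y z).trans h2)
    linarith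
  · have := (hf z y)
    rw [wdist_comm] at this
    exact (ENNReal.ofReal_le_ofReal_iff h3).1 (this.trans h2)

lemma DLip.continuous (hac : Continuous a) (hpos : ∀ x, 0 < a x) {f : Ω → ℝ} {L : ℝ} (hL : 0 < L)
    (hf : DLip a L f) : Continuous f := by
  rw [continuous_iff_continuousAt]
  intro x
  have hw : Continuous fun z : Ω => L / Real.sqrt (a z) :=
    continuous_const.div hac.sqrt fun z => (Real.sqrt_pos.2 (hpos z)).ne'
  have h1 : ∀ᶠ z in 𝓝 x, L / Real.sqrt (a z) < L / Real.sqrt (a x) + 1 :=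
    hw.continuousAt.eventually_lt_const (by linarith)
  rw [nhds_subtype_eq_comap, eventually_comap] at h1
  obtain ⟨r, hr, hball⟩ := Metric.mem_nhds_iff.1 (h1.and (Ω.isOpen.mem_nhds x.2))
  rw [ContinuousAt, tendsto_iff_norm_sub_tendsto_zero]
  have h0 : Tendsto (fun y : Ω => (L / Real.sqrt (a x) + 1) * ‖(y : E d) - x‖) (𝓝 x) (𝓝 0) := by
    have : Continuous fun y : Ω => (L / Real.sqrt (a x) + 1) * ‖(y : E d) - x‖ := by fun_prop
    simpa using this.tendsto x
  refine squeeze_zero' (Eventually.of_forall fun _ => norm_nonneg _) ?_ h0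
  filter_upwards [continuous_subtype_val.continuousAt.preimage_mem_nhds
    (Metric.ball_mem_nhds (x : E d) hr)] with y hy
  have hs : segment ℝ (x : E d) y ⊆ Metric.ball (x : E d) r :=
    (convex_ball _ _).segment_subset (Metric.mem_ball_self hr) hy
  exact hf.abs_sub_le hL (fun v hv => (hball (hs hv)).2)
    fun v hv => ((hball (hs hv)).1 v rfl).le

/-- The regularisation of Lipschitz functions by the jump kernel. -/
theorem abs_act_sub_le {Q : Kernel Ω Ω} [IsMarkovKernel Q]
    (hQ : ∀ f ∈ testFunctions Ω, (∀ x, Integrable f (Q x)) → act Q f ∈ testFunctions Ω)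
    (ha : a ∈ testFunctions Ω) (hpos : ∀ x, 0 < a x) (haQ : ∀ x, Integrable a (Q x))
    {m : Ω → ℝ} (hm0 : ∀ x, 0 ≤ m x) (hm : KernelBound a Q m)
    {f : Ω → ℝ} {B L : ℝ} (hL : 0 < L) (hfB : ∀ x, |f x| ≤ B) (hf : DLip a L f)
    {x y : Ω} {G : ℝ} (hseg : segment ℝ (x : E d) y ⊆ Ω)
    (hG : ∀ z : Ω, (z : E d) ∈ segment ℝ (x : E d) y → m z / Real.sqrt (a z) ≤ G) :
    |act Q f y - act Q f x| ≤ L * G * ‖(y : E d) - x‖ := by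
  have hac : Continuous a := SmoothOn.continuous ha.1
  have hfc : Continuous f := hf.continuous hac hpos hL
  have hzf : ContinuousOn (zeroExt f) (Ω : Set (E d)) := by
    rw [continuousOn_iff_continuous_domRestrict]
    exact hfc.congr fun z => (zeroExt_coe f z).symm
  have hza : ContinuousOn (zeroExt a) (Ω : Set (E d)) := ContDiffOn.continuousOn ha.1
  have hza0 : ∀ z ∈ (Ω : Set (E d)), 0 < Real.sqrt (zeroExt a z) := fun z hz => by
    rw [zeroExt_mk a hz]
    exact Real.sqrt_pos.2 (hpos _)
  have hwc : ∀ b : ℝ, ContinuousOn (fun z => b / Real.sqrt (zeroExt a z)) (Ω : Set (E d)) :=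
    fun b => continuousOn_const.div hza.sqrt fun z hz => (hza0 z hz).ne'
  have key : ∀ ε > 0, |act Q f y - act Q f x| ≤ (L + ε) * G * ‖(y : E d) - x‖ + 2 * ε := by
    intro ε hε
    -- The error function `min ε (ε/√a)` makes `g` uniformly `ε`-close to `f` and enlarges the
    -- weighted gradient bound only from `L` to `L + ε`.
    obtain ⟨g, hg, hgf⟩ := exists_smooth_approx Ω.isOpen hzf (hwc L)
      (fun z hz => div_nonneg hL.le (hza0 z hz).le) (e := fun z =>
        min ε (ε / Real.sqrt (zeroExt a z))) (by
        intro y z G hs hG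
        have h := hf.abs_sub_le hL (y := ⟨y, hs (left_mem_segment ℝ _ _)⟩)
          (z := ⟨z, hs (right_mem_segment ℝ _ _)⟩) (G := G) hs fun v hv => by
            have := hG v hv
            rwa [zeroExt_coe] at this
        rwa [zeroExt_mk f (hs (left_mem_segment ℝ _ _)),
          zeroExt_mk f (hs (right_mem_segment ℝ _ _))])
      (continuousOn_const.inf (hwc ε)) (fun z hz => lt_min hε (div_pos hε (hza0 z hz)))
    have hclose : ∀ z : Ω, |g z - f z| ≤ ε := fun z => by
      have := (hgf z z.2).1.trans (min_le_left _ _)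
      rwa [zeroExt_coe] at this
    have hgB : ∀ z : Ω, |g z| ≤ B + ε := fun z => by
      have h1 := abs_sub_abs_le_abs_sub (g z) (f z)
      linarith [hclose z, hfB z]
    have hgc : Continuous fun z : Ω => g z :=
      continuousOn_iff_continuous_domRestrict.1 hg.continuousOn
    have h1 := abs_act_sub_le_of_smooth hQ ha hpos haQ hm0 hm hg (B := B + ε) (L := L + ε)
      (by positivity) hgB (fun z => by
        have := (hgf z z.2).2
        rw [zeroExt_coe] at this
        refine this.trans ?_
        rw [add_div]
        gcongr
        exact min_le_right _ _) hseg hG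
    have h2 : ∀ z, |act Q (fun z => g z) z - act Q f z| ≤ ε := by
      intro z
      unfold act
      rw [← integral_sub (Integrable.of_bound hgc.aestronglyMeasurable _ (ae_of_all _ hgB))
        (Integrable.of_bound hfc.aestronglyMeasurable _ (ae_of_all _ hfB))]
      have := norm_integral_le_of_norm_le_const (μ := Q z) (f := fun z : Ω => g z - f z)
        (ae_of_all _ hclose)
      simpa using this
    have h3 := abs_le.1 (h2 x)
    have h4 := abs_le.1 (h2 y)
    have h5 := abs_le.1 h1
    exact abs_le.2 ⟨by linarith, by linarith⟩
  have hc : Continuous fun ε : ℝ => (L + ε) * G * ‖(y : E d) - x‖ + 2 * ε := by fun_prop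
  have h0 := (hc.tendsto 0).mono_left (nhdsWithin_le_nhds (s := Ioi 0))
  simp only [add_zero, mul_zero] at h0
  exact ge_of_tendsto h0 (eventually_nhdsWithin_of_forall key)

end PDMP

/-! ### Expansion of the flow in the weighted metric -/

namespace PDMP
open Set Filter Topology

variable {d : ℕ} {Ω : TopologicalSpace.Opens (E d)} {a : Ω → ℝ} {b : Ω → E d} {φ : ℝ → Ω → Ω}

/-- The infinitesimal rate of expansion of the flow of `b` for the weighted distance is at most
`κ`. -/
def FlowBound (a : Ω → ℝ) (b : Ω → E d) (κ : Ω → ℝ) : Prop :=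
  ∀ (z : Ω) (u : E d), inner ℝ u (jac b z u) - inner ℝ (b z) (grad a z) / (2 * a z) * ‖u‖ ^ 2 ≤
    κ z * ‖u‖ ^ 2

/-- The clamp `max s 0` appears because `IsFlow` says nothing about `φ` at negative times. -/
lemma IsFlow.continuous_orbit (hφ : IsFlow b φ) (x : Ω) : Continuous fun s => φ (max s 0) x := by
  refine Continuous.subtype_mk (f := fun s => (φ (max s 0) x : E d)) ?_ _
  have h : ContinuousOn (fun s => (φ s x : E d)) (Ici 0) := fun s hs =>
    ((hφ x).2 s hs).continuousWithinAt
  exact h.comp_continuous (by fun_prop) fun s => mem_Ici.2 (le_max_right _ _)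

/-- The weighted expansion factor of the flow along the orbit of `x`. -/
noncomputable def expansion (φ : ℝ → Ω → Ω) (κ : Ω → ℝ) (s : ℝ) (x : Ω) : ℝ :=
  ∫ r in (0 : ℝ)..s, κ (φ (max r 0) x)

lemma hasDerivAt_expansion (hφ : IsFlow b φ) {κ : Ω → ℝ} (hκ : Continuous κ) (x : Ω) (s : ℝ) :
    HasDerivAt (fun s => expansion φ κ s x) (κ (φ (max s 0) x)) s := by
  have hc : Continuous fun r => κ (φ (max r 0) x) := hκ.comp (hφ.continuous_orbit x)
  exact intervalIntegral.integral_hasDerivAt_right (hc.intervalIntegrable _ _)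
    (hc.stronglyMeasurableAtFilter _ _) hc.continuousAt

lemma continuous_expansion (hφ : IsFlow b φ) {κ : Ω → ℝ} (hκ : Continuous κ) (x : Ω) :
    Continuous fun s => expansion φ κ s x :=
  continuous_iff_continuousAt.2 fun s => (hasDerivAt_expansion hφ hκ x s).continuousAt

lemma IsFlow.isCompact_orbit (hφ : IsFlow b φ) (x : Ω) (t : ℝ) :
    IsCompact ((fun s => (φ (max s 0) x : E d)) '' Icc 0 t) :=
  isCompact_Icc.image (continuous_subtype_val.comp (hφ.continuous_orbit x))

/-- Grönwall estimate for two orbits which stay close to each other. -/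
lemma norm_flow_sub_le (hb : SmoothOn b) (hφ : IsFlow b φ) (ha : SmoothOn a)
    (hpos : ∀ x, 0 < a x) {κ : Ω → ℝ} (hκ : Continuous κ) (hfb : FlowBound a b κ)
    {x y : Ω} {T r ε : ℝ} (hT : 0 ≤ T)
    (hr : ∀ s ∈ Icc 0 T, ∀ z, dist z (φ s x : E d) ≤ r → z ∈ (Ω : Set (E d)) ∧
      dist (fderiv ℝ (zeroExt b) z) (fderiv ℝ (zeroExt b) (φ s x)) ≤ ε)
    (hclose : ∀ s ∈ Ioo 0 T, dist (φ s y : E d) (φ s x) ≤ r) :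
    ‖(φ T y : E d) - φ T x‖ ≤ Real.exp (ε * T + expansion φ κ T x) *
      (Real.sqrt (a (φ T x)) / Real.sqrt (a x)) * ‖(y : E d) - x‖ := by
  set Z : ℝ → E d := fun s => (φ s y : E d) - φ s x with hZ
  set A : ℝ → ℝ := fun s => a (φ s x) with hA
  -- The squared gap, weighted by `1/a` and discounted by twice the accumulated rate, will be
  -- nonincreasing. Working with the gap of two orbits avoids differentiating the flow in its
  -- starting point.
  set H : ℝ → ℝ := fun s => ‖Z s‖ ^ 2 / A s * Real.exp (-(2 * (ε * s + expansion φ κ s x))) with hH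
  have hZd : ∀ s, 0 ≤ s → HasDerivWithinAt Z (b (φ s y) - b (φ s x)) (Ici 0) s := fun s hs =>
    ((hφ y).2 s hs).sub ((hφ x).2 s hs)
  have hAd : ∀ s, 0 ≤ s → HasDerivWithinAt A (inner ℝ (b (φ s x)) (grad a (φ s x))) (Ici 0) s := by
    intro s hs
    have h1 := (ha.differentiableAt (φ s x)).hasFDerivAt.comp_hasDerivWithinAt s ((hφ x).2 s hs)
    have h2 : fderiv ℝ (zeroExt a) (φ s x) (b (φ s x)) = inner ℝ (b (φ s x)) (grad a (φ s x)) := by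
      rw [real_inner_comm, grad, gradient, InnerProductSpace.toDual_symm_apply]
    rw [h2] at h1
    exact h1.congr_of_mem (fun u _ => (zeroExt_coe a (φ u x)).symm) hs
  have hHd : ∀ s, 0 ≤ s → HasDerivWithinAt H
      (((2 * inner ℝ (Z s) (b (φ s y) - b (φ s x))) * A s -
        ‖Z s‖ ^ 2 * inner ℝ (b (φ s x)) (grad a (φ s x))) / A s ^ 2 *
          Real.exp (-(2 * (ε * s + expansion φ κ s x))) +
        ‖Z s‖ ^ 2 / A s * (Real.exp (-(2 * (ε * s + expansion φ κ s x))) *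
          -(2 * (ε + κ (φ s x))))) (Ici 0) s := by
    intro s hs
    have h1 := ((hZd s hs).norm_sq).div (hAd s hs) (hpos _).ne'
    have h2 : HasDerivAt (fun s => -(2 * (ε * s + expansion φ κ s x)))
        (-(2 * (ε + κ (φ s x)))) s := by
      have h3 := hasDerivAt_expansion hφ hκ x s
      rw [max_eq_left hs] at h3
      have h4 := ((((hasDerivAt_id s).const_mul ε).add h3).const_mul 2).neg
      simpa [Pi.neg_def] using h4
    exact h1.mul h2.exp.hasDerivWithinAt
  have hHle : H T ≤ H 0 := by
    refine (antitoneOn_of_deriv_nonpos (convex_Icc 0 T) ?_ ?_ ?_) (left_mem_Icc.2 hT)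
      (right_mem_Icc.2 hT) hT
    · exact fun s hs => ((hHd s hs.1).continuousWithinAt).mono Icc_subset_Ici_self
    · rw [interior_Icc]
      exact fun s hs => ((hHd s hs.1.le).hasDerivAt (Ici_mem_nhds hs.1)).differentiableAt
        |>.differentiableWithinAt
    · rw [interior_Icc]
      intro s hs
      rw [((hHd s hs.1.le).hasDerivAt (Ici_mem_nhds hs.1)).deriv]
      have hsI : s ∈ Icc 0 T := ⟨hs.1.le, hs.2.le⟩
      have hAs : 0 < A s := hpos _
      -- In the tube the Jacobian varies by at most `ε`, so linearising `b` costs `ε ‖Z s‖`.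
      have h1 : ‖b (φ s y) - b (φ s x) - jac b (φ s x) (Z s)‖ ≤ ε * ‖Z s‖ := by
        have hcb := convex_closedBall (φ s x : E d) r
        have hr0 : 0 ≤ r := dist_nonneg.trans (hclose s hs)
        have := hcb.norm_image_sub_le_of_norm_fderiv_le' (𝕜 := ℝ) (f := zeroExt b)
          (φ := jac b (φ s x)) (C := ε)
          (fun z hz => hb.differentiableAt ⟨z, (hr s hsI z hz).1⟩)
          (fun z hz => by
            have := (hr s hsI z hz).2
            rwa [dist_eq_norm] at this)
          (Metric.mem_closedBall_self hr0) (hclose s hs)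
        simpa only [zeroExt_coe] using this
      have h2 : inner ℝ (Z s) (b (φ s y) - b (φ s x)) ≤
          inner ℝ (Z s) (jac b (φ s x) (Z s)) + ε * ‖Z s‖ ^ 2 := by
        have h3 := real_inner_le_norm (Z s) (b (φ s y) - b (φ s x) - jac b (φ s x) (Z s))
        rw [inner_sub_right] at h3
        have h4 := mul_le_mul_of_nonneg_left h1 (norm_nonneg (Z s))
        nlinarith
      have h3 := hfb (φ s x) (Z s)
      have hexp := Real.exp_pos (-(2 * (ε * s + expansion φ κ s x)))
      have e : ((2 * inner ℝ (Z s) (b (φ s y) - b (φ s x))) * A s -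
          ‖Z s‖ ^ 2 * inner ℝ (b (φ s x)) (grad a (φ s x))) / A s ^ 2 *
            Real.exp (-(2 * (ε * s + expansion φ κ s x))) +
          ‖Z s‖ ^ 2 / A s * (Real.exp (-(2 * (ε * s + expansion φ κ s x))) *
            -(2 * (ε + κ (φ s x)))) =
          Real.exp (-(2 * (ε * s + expansion φ κ s x))) * (2 / A s) *
          (inner ℝ (Z s) (b (φ s y) - b (φ s x)) -
            inner ℝ (b (φ s x)) (grad a (φ s x)) / (2 * a (φ s x)) * ‖Z s‖ ^ 2 -
            (ε + κ (φ s x)) * ‖Z s‖ ^ 2) := by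
        have : a (φ s x) = A s := rfl
        rw [this]
        field_simp
        ring
      rw [e]
      refine mul_nonpos_of_nonneg_of_nonpos (by positivity) ?_
      linarith
  have hZ0 : Z 0 = (y : E d) - x := by simp only [hZ, (hφ x).1, (hφ y).1]
  have hA0 : A 0 = a x := by simp only [hA, (hφ x).1]
  have hE0 : expansion φ κ 0 x = 0 := intervalIntegral.integral_same
  have hHT : ‖Z T‖ ^ 2 ≤ (Real.exp (ε * T + expansion φ κ T x) *
      (Real.sqrt (a (φ T x)) / Real.sqrt (a x)) * ‖(y : E d) - x‖) ^ 2 := by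
    have hAT : 0 < A T := hpos _
    have hax := hpos x
    simp only [hH, hZ0, hA0, hE0] at hHle
    rw [mul_pow, mul_pow, div_pow, Real.sq_sqrt (hpos _).le, Real.sq_sqrt (hpos _).le,
      ← Real.exp_nat_mul]
    have e1 : Real.exp (-(2 * (ε * T + expansion φ κ T x))) *
        Real.exp ((2 : ℕ) * (ε * T + expansion φ κ T x)) = 1 := by
      rw [← Real.exp_add]
      simp
    have h5 := mul_le_mul_of_nonneg_right hHle
      (mul_nonneg (Real.exp_pos ((2 : ℕ) * (ε * T + expansion φ κ T x))).le hAT.le)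
    have e2 : ‖Z T‖ ^ 2 / A T * Real.exp (-(2 * (ε * T + expansion φ κ T x))) *
        (Real.exp ((2 : ℕ) * (ε * T + expansion φ κ T x)) * A T) = ‖Z T‖ ^ 2 := by
      calc _ = ‖Z T‖ ^ 2 * (A T / A T) * (Real.exp (-(2 * (ε * T + expansion φ κ T x))) *
        Real.exp ((2 : ℕ) * (ε * T + expansion φ κ T x))) := by ring
        _ = _ := by rw [e1, div_self hAT.ne', mul_one, mul_one]
    rw [e2] at h5
    refine h5.trans (le_of_eq ?_)
    simp only [mul_zero, add_zero, neg_zero, Real.exp_zero, mul_one]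
    have : a (φ T x) = A T := rfl
    rw [this]
    ring
  exact (abs_le_of_sq_le_sq' hHT (by positivity)).2

/-- On a compact time interval, the orbits of nearby points stay close to each other, and the
expansion of the flow is controlled by its infinitesimal rate. -/
theorem exists_flow_tube (hb : SmoothOn b) (hφ : IsFlow b φ) (ha : SmoothOn a)
    (hpos : ∀ x, 0 < a x) {κ : Ω → ℝ} (hκ : Continuous κ) (hfb : FlowBound a b κ)
    (x : Ω) (t : ℝ) {ε r : ℝ} (hε : 0 < ε) (hr : 0 < r) :
    ∃ δ > 0, ∀ y : Ω, ‖(y : E d) - x‖ < δ → ∀ s ∈ Icc 0 t,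
      ‖(φ s y : E d) - φ s x‖ < r ∧
      ‖(φ s y : E d) - φ s x‖ ≤ Real.exp (ε * s + expansion φ κ s x) *
      (Real.sqrt (a (φ s x)) / Real.sqrt (a x)) * ‖(y : E d) - x‖ := by
  have hac : Continuous a := ha.continuous
  obtain ⟨r₀, hr₀, htube⟩ := exists_radius Ω.isOpen (hφ.isCompact_orbit x t)
    (by rintro _ ⟨s, -, rfl⟩; exact (φ (max s 0) x).2) hb.continuousOn_fderiv hε
  set ρ := min r r₀ with hρ
  have hρ0 : 0 < ρ := lt_min hr hr₀
  have horb : ∀ s ∈ Icc 0 t, φ (max s 0) x = φ s x := fun s hs => by rw [max_eq_left hs.1]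
  have htube' : ∀ s ∈ Icc 0 t, ∀ z, dist z (φ s x : E d) ≤ ρ → z ∈ (Ω : Set (E d)) ∧
      dist (fderiv ℝ (zeroExt b) z) (fderiv ℝ (zeroExt b) (φ s x)) ≤ ε := fun s hs z hz =>
    htube _ ⟨s, hs, by simp only [horb s hs]⟩ z (hz.trans (min_le_right _ _))
  have hcont : Continuous fun s => Real.exp (ε * s + expansion φ κ s x) *
      (Real.sqrt (a (φ (max s 0) x)) / Real.sqrt (a x)) := by
    have h1 := continuous_expansion hφ hκ x
    have h2 := (hac.comp (hφ.continuous_orbit x)).sqrt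
    exact (Real.continuous_exp.comp ((continuous_const.mul continuous_id).add h1)).mul
      (h2.div_const _)
  obtain ⟨C, hC⟩ := (isCompact_Icc (a := (0 : ℝ)) (b := t)).exists_bound_of_continuousOn
    hcont.continuousOn
  have hC' : ∀ s ∈ Icc 0 t, Real.exp (ε * s + expansion φ κ s x) *
      (Real.sqrt (a (φ s x)) / Real.sqrt (a x)) ≤ max C 0 := fun s hs => by
    have := (le_abs_self _).trans (hC s hs)
    rw [horb s hs] at this
    exact this.trans (le_max_left _ _)
  -- `max C 0` bounds the expansion factor on the time interval, so this radius keeps the estimated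
  -- gap strictly below `ρ`.
  refine ⟨ρ / (max C 0 + 1), by positivity, fun y hy => ?_⟩
  have hsmall : max C 0 * ‖(y : E d) - x‖ < ρ := by
    rw [lt_div_iff₀ (by positivity)] at hy
    nlinarith [norm_nonneg ((y : E d) - x)]
  have hest : ∀ T ∈ Icc 0 t, (∀ s ∈ Ioo 0 T, dist (φ s y : E d) (φ s x) ≤ ρ) →
      ‖(φ T y : E d) - φ T x‖ ≤ Real.exp (ε * T + expansion φ κ T x) *
      (Real.sqrt (a (φ T x)) / Real.sqrt (a x)) * ‖(y : E d) - x‖ := fun T hT h =>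
    norm_flow_sub_le hb hφ ha hpos hκ hfb hT.1
      (fun s hs => htube' s ⟨hs.1, hs.2.trans hT.2⟩) h
  have hlt : ∀ T ∈ Icc 0 t, (∀ s ∈ Ioo 0 T, dist (φ s y : E d) (φ s x) ≤ ρ) →
      ‖(φ T y : E d) - φ T x‖ < ρ := fun T hT h =>
    ((hest T hT h).trans (mul_le_mul_of_nonneg_right (hC' T hT) (norm_nonneg _))).trans_lt hsmall
  have hall : ∀ s ∈ Icc 0 t, ‖(φ s y : E d) - φ s x‖ < ρ := by
    by_contra! hbad
    -- Continuity argument: at the first time when the gap reaches `ρ` the Grönwall estimate still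
    -- applies and gives a gap smaller than `ρ`.
    set S := Icc 0 t ∩ {s | ρ ≤ ‖(φ (max s 0) y : E d) - φ (max s 0) x‖} with hS
    have hScl : IsClosed S := by
      refine isClosed_Icc.inter (isClosed_le continuous_const ?_)
      exact ((continuous_subtype_val.comp (hφ.continuous_orbit y)).sub
        (continuous_subtype_val.comp (hφ.continuous_orbit x))).norm
    have hSne : S.Nonempty := by
      obtain ⟨s, hs, h⟩ := hbad
      exact ⟨s, hs, by rwa [mem_ofPred_eq, max_eq_left hs.1]⟩
    have hSb : BddBelow S := ⟨0, fun s hs => hs.1.1⟩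
    have hmem := hScl.csInf_mem hSne hSb
    have h1 := hlt (sInf S) hmem.1 fun s hs => by
      by_contra! hlt
      refine (notMem_of_lt_csInf hs.2 hSb) ⟨⟨hs.1.le, hs.2.le.trans hmem.1.2⟩, ?_⟩
      rw [mem_ofPred_eq, max_eq_left hs.1.le, ← dist_eq_norm]
      exact hlt.le
    have h2 := hmem.2
    rw [mem_ofPred_eq, max_eq_left hmem.1.1] at h2
    linarith
  intro s hs
  refine ⟨(hall s hs).trans_le (min_le_left _ _), hest s hs fun u hu => ?_⟩
  rw [dist_eq_norm]
  exact (hall u ⟨hu.1.le, hu.2.le.trans hs.2⟩).le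

/-- The semiflow is jointly continuous. -/
lemma continuous_flow (hb : SmoothOn b) (hφ : IsFlow b φ) (ha : SmoothOn a)
    (hpos : ∀ x, 0 < a x) {κ : Ω → ℝ} (hκ : Continuous κ) (hfb : FlowBound a b κ) :
    Continuous fun p : ℝ × Ω => φ (max p.1 0) p.2 := by
  rw [continuous_iff_continuousAt]
  rintro ⟨s₀, x₀⟩
  rw [Metric.continuousAt_iff']
  intro ε hε
  obtain ⟨δ, hδ, h⟩ := exists_flow_tube hb hφ ha hpos hκ hfb x₀ (max s₀ 0 + 1) one_pos (half_pos hε)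
  have h1 : ∀ᶠ p : ℝ × Ω in 𝓝 (s₀, x₀), max p.1 0 < max s₀ 0 + 1 := by
    have : Continuous fun p : ℝ × Ω => max p.1 0 := by fun_prop
    exact this.continuousAt.eventually_lt_const (by simp)
  have h2 : ∀ᶠ p : ℝ × Ω in 𝓝 (s₀, x₀), ‖(p.2 : E d) - x₀‖ < δ := by
    have : Continuous fun p : ℝ × Ω => ‖(p.2 : E d) - x₀‖ := by fun_prop
    exact this.continuousAt.eventually_lt_const (by simpa using hδ)
  have h3 : ∀ᶠ p : ℝ × Ω in 𝓝 (s₀, x₀), dist (φ (max p.1 0) x₀) (φ (max s₀ 0) x₀) < ε / 2 := by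
    have : Continuous fun p : ℝ × Ω => dist (φ (max p.1 0) x₀) (φ (max s₀ 0) x₀) :=
      ((hφ.continuous_orbit x₀).comp continuous_fst).dist continuous_const
    exact this.continuousAt.eventually_lt_const (by simpa using hε)
  filter_upwards [h1, h2, h3] with p h1 h2 h3
  have h4 := (h p.2 h2 (max p.1 0) ⟨le_max_right _ _, h1.le⟩).1
  refine (dist_triangle _ (φ (max p.1 0) x₀) _).trans_lt ?_
  rw [Subtype.dist_eq, dist_eq_norm]
  linarith

end PDMP

/-! ### Measurability of the process and the first-jump decomposition -/

namespace PDMP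
open Set Filter Topology

variable {d : ℕ} {Ω : TopologicalSpace.Opens (E d)} {b : Ω → E d} {φ : ℝ → Ω → Ω} {lam : ℝ}
  {Q : Kernel Ω Ω}

/-- Only flow times in `[0, t]` enter the law. The flow may thus be replaced by its clamped version,
which is jointly continuous and therefore measurable. -/
lemma jumpLaw_max (n : ℕ) : ∀ {t : ℝ}, 0 ≤ t → ∀ x,
    jumpLaw φ lam Q n t x = jumpLaw (fun s => φ (max s 0)) lam Q n t x := by
  induction n with
  | zero => intro t ht x; simp only [jumpLaw, max_eq_left ht]
  | succ n ih =>
    intro t ht x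
    simp only [jumpLaw]
    refine Measure.bind_congr_right ?_
    filter_upwards [ae_restrict_mem measurableSet_Icc] with s hs
    have e : φ (max s 0) x = φ s x := by rw [max_eq_left hs.1]
    rw [e]
    exact congrArg _ (funext fun y => ih (sub_nonneg.2 hs.2) y)

lemma evolve_max {t : ℝ} (ht : 0 ≤ t) (ν : Measure Ω) :
    evolve φ lam Q t ν = evolve (fun s => φ (max s 0)) lam Q t ν := by
  have : transition φ lam Q t = transition (fun s => φ (max s 0)) lam Q t := by
    ext1 x
    exact congrArg Measure.sum (funext fun n => jumpLaw_max n ht x)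
  rw [evolve, evolve, this]

lemma IsFlow.comp_max (hφ : IsFlow b φ) : IsFlow b (fun s => φ (max s 0)) := by
  intro x
  refine ⟨by simp [(hφ x).1], fun t ht => ?_⟩
  have h := (hφ x).2 t ht
  simp only [max_eq_left ht]
  refine h.congr_of_mem (fun s hs => ?_) ht
  rw [max_eq_left (mem_Ici.1 hs)]

section Measurability
variable [IsMarkovKernel Q]

lemma measurable_jump_step (hφ : Measurable fun p : ℝ × Ω => φ p.1 p.2)
    {J : ℝ → Ω → Measure Ω} (hJ : Measurable fun p : ℝ × Ω => J p.1 p.2) :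
    Measurable fun q : (ℝ × Ω) × ℝ => (Q (φ q.2 q.1.2)).bind fun y => J (q.1.1 - q.2) y := by
  refine Measure.measurable_of_measurable_coe _ fun A hA => ?_
  have hm : ∀ r, Measurable fun y => J r y := fun r => hJ.comp measurable_prodMk_left
  simp_rw [Measure.bind_apply hA (hm _).aemeasurable]
  let κ : Kernel ((ℝ × Ω) × ℝ) Ω := Q.comap (fun q => φ q.2 q.1.2)
    (hφ.comp (measurable_snd.prodMk (measurable_snd.comp measurable_fst)))
  have h2 : Measurable (Function.uncurry fun (q : (ℝ × Ω) × ℝ) (y : Ω) => J (q.1.1 - q.2) y A) := by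
    refine (Measure.measurable_coe hA).comp (hJ.comp (f := fun p : ((ℝ × Ω) × ℝ) × Ω =>
      (p.1.1.1 - p.1.2, p.2)) ?_)
    fun_prop
  exact h2.lintegral_kernel_prod_right (κ := κ)

lemma measurable_jump (hlam : 0 < lam) (hφ : Measurable fun p : ℝ × Ω => φ p.1 p.2)
    {J : ℝ → Ω → Measure Ω} (hJ : Measurable fun p : ℝ × Ω => J p.1 p.2) :
    Measurable fun p : ℝ × Ω => ((expMeasure lam).restrict (Icc 0 p.1)).bind fun s =>
      (Q (φ s p.2)).bind fun y => J (p.1 - s) y := by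
  have := isProbabilityMeasure_expMeasure hlam
  refine Measure.measurable_of_measurable_coe _ fun A hA => ?_
  have hG := measurable_jump_step (Q := Q) hφ hJ
  have hGs : ∀ p : ℝ × Ω, Measurable fun s => (Q (φ s p.2)).bind
      fun y => J (p.1 - s) y := fun p =>
    hG.comp (f := fun s => (p, s)) measurable_prodMk_left
  -- The domain of integration depends on the parameter; an indicator turns it into a fixed one.
  have e : ∀ p : ℝ × Ω, (((expMeasure lam).restrict (Icc 0 p.1)).bind fun s =>
      (Q (φ s p.2)).bind fun y => J (p.1 - s) y) A =
      ∫⁻ s, {q : (ℝ × Ω) × ℝ | 0 ≤ q.2 ∧ q.2 ≤ q.1.1}.indicator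
        (fun q => ((Q (φ q.2 q.1.2)).bind fun y => J (q.1.1 - q.2) y) A) (p, s)
        ∂(expMeasure lam) := by
    intro p
    rw [Measure.bind_apply hA (hGs p).aemeasurable, ← lintegral_indicator measurableSet_Icc]
    rfl
  simp only [e]
  refine Measurable.lintegral_prod_right' (((Measure.measurable_coe hA).comp hG).indicator ?_)
  exact (measurableSet_le measurable_const measurable_snd).inter
    (measurableSet_le measurable_snd (measurable_fst.comp measurable_fst))

lemma measurable_jumpLaw (hlam : 0 < lam) (hφ : Measurable fun p : ℝ × Ω => φ p.1 p.2) (n : ℕ) :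
    Measurable fun p : ℝ × Ω => jumpLaw φ lam Q n p.1 p.2 := by
  induction n with
  | zero =>
    have h1 : Measurable fun t => expMeasure lam (Ioi t) :=
      Antitone.measurable fun s t h => measure_mono (Ioi_subset_Ioi h)
    have h2 : Measurable fun p : ℝ × Ω => Measure.dirac (φ p.1 p.2) :=
      Measure.measurable_dirac.comp hφ
    simp only [jumpLaw]
    refine Measure.measurable_of_measurable_coe _ fun A hA => ?_
    simp only [Measure.smul_apply, smul_eq_mul]
    exact (h1.comp measurable_fst).mul ((Measure.measurable_coe hA).comp h2)
  | succ n ih => exact measurable_jump hlam hφ ih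

lemma measurable_jumpLaw_right (hlam : 0 < lam) (hφ : Measurable fun p : ℝ × Ω => φ p.1 p.2)
    (n : ℕ) (t : ℝ) : Measurable fun x => jumpLaw φ lam Q n t x :=
  (measurable_jumpLaw hlam hφ n).comp measurable_prodMk_left

lemma setLIntegral_expMeasure (g : ℝ → ENNReal) (t : ℝ) :
    ∫⁻ s in Icc 0 t, g s ∂(expMeasure lam) =
      ∫⁻ s in Icc 0 t, ENNReal.ofReal (lam * Real.exp (-(lam * s))) * g s := by
  have hm : Measurable (exponentialPDF lam) := (measurable_exponentialPDFReal lam).ennreal_ofReal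
  have h : expMeasure lam = volume.withDensity (exponentialPDF lam) := rfl
  rw [h, restrict_withDensity measurableSet_Icc,
    lintegral_withDensity_eq_lintegral_mul_non_measurable _ hm
      (ae_of_all _ fun _ => ENNReal.ofReal_lt_top)]
  refine setLIntegral_congr_fun measurableSet_Icc fun s hs => ?_
  simp only [Pi.mul_apply, exponentialPDF_of_nonneg hs.1]

lemma expMeasure_Ioi (hlam : 0 < lam) {t : ℝ} (ht : 0 ≤ t) :
    expMeasure lam (Ioi t) = ENNReal.ofReal (Real.exp (-(lam * t))) := by
  have := isProbabilityMeasure_expMeasure hlam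
  have h1 : cdf (expMeasure lam) t = 1 - Real.exp (-(lam * t)) := by
    rw [cdf_expMeasure_eq hlam, if_pos ht]
  rw [← compl_Iic, prob_compl_eq_one_sub measurableSet_Iic, ← ofReal_cdf, h1,
    ← ENNReal.ofReal_one, ← ENNReal.ofReal_sub _ ?_]
  · congr 1; ring
  · rw [sub_nonneg, Real.exp_le_one_iff]
    have := mul_nonneg hlam.le ht
    linarith

lemma lintegral_jump (hφ : Measurable fun p : ℝ × Ω => φ p.1 p.2)
    {J : ℝ → Ω → Measure Ω} (hJ : Measurable fun p : ℝ × Ω => J p.1 p.2)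
    (t : ℝ) (x : Ω) {f : Ω → ENNReal} (hf : Measurable f) :
    ∫⁻ z, f z ∂(((expMeasure lam).restrict (Icc 0 t)).bind fun s =>
      (Q (φ s x)).bind fun y => J (t - s) y) =
      ∫⁻ s in Icc 0 t, ENNReal.ofReal (lam * Real.exp (-(lam * s))) *
        ∫⁻ y, ∫⁻ z, f z ∂(J (t - s) y) ∂(Q (φ s x)) := by
  have hG := measurable_jump_step (Q := Q) hφ hJ
  have hGs : Measurable fun s => (Q (φ s x)).bind
    fun y => J (t - s) y := hG.comp (f := fun s => ((t, x), s)) measurable_prodMk_left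
  have hm : ∀ r, Measurable fun y => J r y := fun r => hJ.comp measurable_prodMk_left
  rw [Measure.lintegral_bind hGs.aemeasurable hf.aemeasurable, setLIntegral_expMeasure]
  refine lintegral_congr fun s => ?_
  rw [Measure.lintegral_bind (hm _).aemeasurable hf.aemeasurable]

/-- First jump decomposition. -/
lemma lintegral_jumpLaw_succ (hlam : 0 < lam) (hφ : Measurable fun p : ℝ × Ω => φ p.1 p.2) (n : ℕ)
    (t : ℝ) (x : Ω) {f : Ω → ENNReal} (hf : Measurable f) :
    ∫⁻ z, f z ∂(jumpLaw φ lam Q (n + 1) t x) =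
      ∫⁻ s in Icc 0 t, ENNReal.ofReal (lam * Real.exp (-(lam * s))) *
        ∫⁻ y, ∫⁻ z, f z ∂(jumpLaw φ lam Q n (t - s) y) ∂(Q (φ s x)) :=
  lintegral_jump hφ (measurable_jumpLaw hlam hφ n) t x hf

/-- With a constant rate the number of jumps is Poisson, whatever the kernel: conditioning on the
first jump integrates `(t - s)^n` at each step. Summing over `n` shows that the process does not
explode. -/
lemma jumpLaw_univ (hlam : 0 < lam) (hφ : Measurable fun p : ℝ × Ω => φ p.1 p.2) (n : ℕ) :
    ∀ {t : ℝ}, 0 ≤ t → ∀ x, jumpLaw φ lam Q n t x univ =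
      ENNReal.ofReal (Real.exp (-(lam * t)) * (lam * t) ^ n / n.factorial) := by
  induction n with
  | zero =>
    intro t ht x
    simp [jumpLaw, expMeasure_Ioi hlam ht]
  | succ n ih =>
    intro t ht x
    have h := lintegral_jumpLaw_succ (Q := Q) hlam hφ n t x (f := 1) measurable_one
    simp only [Pi.one_apply, lintegral_one] at h
    rw [h]
    have h1 : ∀ s ∈ Icc 0 t, ENNReal.ofReal (lam * Real.exp (-(lam * s))) *
        ∫⁻ y, jumpLaw φ lam Q n (t - s) y univ ∂(Q (φ s x)) =
        ENNReal.ofReal (lam ^ (n + 1) * Real.exp (-(lam * t)) / n.factorial * (t - s) ^ n) := by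
      intro s hs
      simp only [ih (sub_nonneg.2 hs.2), lintegral_const, measure_univ, mul_one]
      rw [← ENNReal.ofReal_mul (by positivity)]
      congr 1
      have : Real.exp (-(lam * t)) = Real.exp (-(lam * s)) * Real.exp (-(lam * (t - s))) := by
        rw [← Real.exp_add]; congr 1; ring
      rw [this, mul_pow]
      ring
    rw [setLIntegral_congr_fun measurableSet_Icc h1, ← ofReal_integral_eq_lintegral_ofReal]
    · rw [integral_Icc_eq_integral_Ioc, ← intervalIntegral.integral_of_le ht,
        intervalIntegral.integral_const_mul,
        intervalIntegral.integral_comp_sub_left (fun u => u ^ n) t]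
      simp only [sub_self, sub_zero, integral_pow]
      congr 1
      rw [Nat.factorial_succ]
      push_cast
      field_simp
      simp [mul_pow]
    · exact (Continuous.integrableOn_Icc (by fun_prop))
    · filter_upwards [ae_restrict_mem measurableSet_Icc] with s hs
      have := sub_nonneg.2 hs.2
      simp only [Pi.zero_apply]
      positivity

lemma transition_univ (hlam : 0 < lam) (hφ : Measurable fun p : ℝ × Ω => φ p.1 p.2)
    {t : ℝ} (ht : 0 ≤ t) (x : Ω) : transition φ lam Q t x univ = 1 := by
  rw [transition, Measure.sum_apply _ MeasurableSet.univ]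
  simp only [jumpLaw_univ hlam hφ _ ht]
  have h0 : 0 ≤ lam * t := by positivity
  have h : HasSum (fun n : ℕ => Real.exp (-(lam * t)) * (lam * t) ^ n / n.factorial) 1 := by
    have h1 := (NormedSpace.expSeries_div_hasSum_exp (lam * t)).mul_left (Real.exp (-(lam * t)))
    rw [← Real.exp_eq_exp_ℝ, ← Real.exp_add, neg_add_cancel, Real.exp_zero] at h1
    simpa only [mul_div_assoc] using h1
  rw [← ENNReal.ofReal_tsum_of_nonneg (fun n => by positivity) h.summable, h.tsum_eq,
    ENNReal.ofReal_one]

lemma measurable_transition (hlam : 0 < lam) (hφ : Measurable fun p : ℝ × Ω => φ p.1 p.2) (t : ℝ) :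
    Measurable (transition φ lam Q t) := by
  refine Measure.measurable_of_measurable_coe _ fun A hA => ?_
  simp only [transition, Measure.sum_apply _ hA]
  exact Measurable.tsum fun n =>
    (Measure.measurable_coe hA).comp (measurable_jumpLaw_right hlam hφ n t)

lemma isProbabilityMeasure_evolve (hlam : 0 < lam) (hφ : Measurable fun p : ℝ × Ω => φ p.1 p.2)
    {t : ℝ} (ht : 0 ≤ t) (ν : Measure Ω) [IsProbabilityMeasure ν] :
    IsProbabilityMeasure (evolve φ lam Q t ν) := by
  refine ⟨?_⟩
  rw [evolve, Measure.bind_apply MeasurableSet.univ (measurable_transition hlam hφ t).aemeasurable]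
  simp [transition_univ hlam hφ ht]

end Measurability

/-- The expectation of `f (X_t)` on the event that there are less than `n` jumps up to time `t`. -/
noncomputable def truncatedMean (φ : ℝ → Ω → Ω) (lam : ℝ) (Q : Kernel Ω Ω) (f : Ω → ENNReal)
    (n : ℕ) (t : ℝ) (x : Ω) : ENNReal :=
  ∑ k ∈ Finset.range n, ∫⁻ z, f z ∂(jumpLaw φ lam Q k t x)

lemma iSup_truncatedMean (f : Ω → ENNReal) (t : ℝ) (x : Ω) :
    ⨆ n, truncatedMean φ lam Q f n t x = ∫⁻ z, f z ∂(transition φ lam Q t x) := by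
  rw [transition, lintegral_sum_measure, ENNReal.tsum_eq_iSup_nat]
  rfl

section Mean
variable [IsMarkovKernel Q] {f : Ω → ENNReal}

lemma measurable_truncatedMean (hlam : 0 < lam) (hφ : Measurable fun p : ℝ × Ω => φ p.1 p.2)
    (hf : Measurable f) (n : ℕ) :
    Measurable fun p : ℝ × Ω => truncatedMean φ lam Q f n p.1 p.2 :=
  Finset.measurable_fun_sum _ fun k _ =>
    (Measure.measurable_lintegral hf).comp (measurable_jumpLaw hlam hφ k)

/-- Either no jump occurs, or the process restarts after the first one with one jump fewer allowed.
This is the recursion behind the contraction estimate. -/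
lemma truncatedMean_succ (hlam : 0 < lam) (hφ : Measurable fun p : ℝ × Ω => φ p.1 p.2)
    (hf : Measurable f) (n : ℕ) {t : ℝ} (ht : 0 ≤ t) (x : Ω) :
    truncatedMean φ lam Q f (n + 1) t x =
      ENNReal.ofReal (Real.exp (-(lam * t))) * f (φ t x) +
      ∫⁻ s in Icc 0 t, ENNReal.ofReal (lam * Real.exp (-(lam * s))) *
        ∫⁻ y, truncatedMean φ lam Q f n (t - s) y ∂(Q (φ s x)) := by
  rw [truncatedMean, Finset.sum_range_succ', add_comm]
  congr 1
  · simp only [jumpLaw]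
    rw [lintegral_smul_measure, lintegral_dirac' _ hf, expMeasure_Ioi hlam ht, smul_eq_mul]
  · simp only [lintegral_jumpLaw_succ hlam hφ _ t x hf]
    have hm : ∀ k, Measurable fun p : ℝ × Ω => ∫⁻ z, f z ∂(jumpLaw φ lam Q k p.1 p.2) := fun k =>
      (Measure.measurable_lintegral hf).comp (measurable_jumpLaw hlam hφ k)
    rw [← lintegral_finsetSum]
    · refine lintegral_congr fun s => ?_
      rw [← Finset.mul_sum]
      congr 1
      exact (lintegral_finsetSum _ fun k _ => (hm k).comp measurable_prodMk_left).symm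
    · intro k _
      refine Measurable.mul (by fun_prop) ?_
      let κ : Kernel ℝ Ω := Q.comap (fun s => φ s x) (hφ.comp measurable_prodMk_right)
      have h2 : Measurable (Function.uncurry fun (s : ℝ) (y : Ω) =>
          ∫⁻ z, f z ∂(jumpLaw φ lam Q k (t - s) y)) :=
        (hm k).comp (f := fun p : ℝ × Ω => (t - p.1, p.2)) (by fun_prop)
      exact h2.lintegral_kernel_prod_right (κ := κ)

lemma truncatedMean_le (hlam : 0 < lam) (hφ : Measurable fun p : ℝ × Ω => φ p.1 p.2)
    {K : ENNReal} (hfK : ∀ x, f x ≤ K) (n : ℕ) {t : ℝ} (ht : 0 ≤ t) (x : Ω) :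
    truncatedMean φ lam Q f n t x ≤ K := by
  refine (le_iSup (fun n => truncatedMean φ lam Q f n t x) n).trans ?_
  rw [iSup_truncatedMean]
  refine (lintegral_mono hfK).trans ?_
  rw [lintegral_const, transition_univ hlam hφ ht, mul_one]

end Mean

end PDMP

/-! ### Contraction of Lipschitz functions by the semigroup -/

namespace PDMP
open Set Filter Topology

variable {d : ℕ} {Ω : TopologicalSpace.Opens (E d)} {a : Ω → ℝ} {b : Ω → E d} {φ : ℝ → Ω → Ω}
  {lam : ℝ} {Q : Kernel Ω Ω}

/-- Comparison of the truncated means at two starting points. -/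
lemma truncatedMean_succ_le [IsMarkovKernel Q] (hlam : 0 < lam)
    (hφ : Measurable fun p : ℝ × Ω => φ p.1 p.2)
    {f : Ω → ℝ} (hf : Measurable f) {K : ℝ} (hfK : ∀ x, f x ≤ K)
    (n : ℕ) {t : ℝ} (ht : 0 ≤ t) {x y : Ω} {c₀ : ℝ} {c : ℝ → ℝ} (hc₀ : 0 ≤ c₀) (hc : Continuous c)
    (hcn : ∀ s ∈ Icc 0 t, 0 ≤ c s)
    (h₀ : f (φ t y) ≤ f (φ t x) + c₀)
    (h : ∀ s ∈ Icc 0 t,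
      act Q (fun z => (truncatedMean φ lam Q (fun z => .ofReal (f z)) n (t - s) z).toReal) (φ s y) ≤
      act Q (fun z => (truncatedMean φ lam Q (fun z => .ofReal (f z)) n (t - s) z).toReal) (φ s x) +
        c s) :
    (truncatedMean φ lam Q (fun z => .ofReal (f z)) (n + 1) t y).toReal ≤
      (truncatedMean φ lam Q (fun z => .ofReal (f z)) (n + 1) t x).toReal +
        (Real.exp (-(lam * t)) * c₀ +
          ∫ s in (0 : ℝ)..t, lam * Real.exp (-(lam * s)) * c s) := by
  set f' : Ω → ENNReal := fun z => ENNReal.ofReal (f z)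
  have hf' : Measurable f' := hf.ennreal_ofReal
  have hle : ∀ n {t : ℝ}, 0 ≤ t → ∀ x, truncatedMean φ lam Q f' n t x ≤ ENNReal.ofReal K :=
    fun n t ht x => truncatedMean_le hlam hφ (fun z => ENNReal.ofReal_le_ofReal (hfK z)) n ht x
  have hfin : ∀ n {t : ℝ}, 0 ≤ t → ∀ x, truncatedMean φ lam Q f' n t x ≠ ⊤ := fun n t ht x =>
    ((hle n ht x).trans_lt ENNReal.ofReal_lt_top).ne
  have hact : ∀ s ∈ Icc 0 t, ∀ p, ∫⁻ z, truncatedMean φ lam Q f' n (t - s) z ∂(Q p) =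
      ENNReal.ofReal (act Q (fun z => (truncatedMean φ lam Q f' n (t - s) z).toReal) p) := by
    intro s hs p
    have hts := sub_nonneg.2 hs.2
    have hm : Measurable fun z => truncatedMean φ lam Q f' n (t - s) z :=
      (measurable_truncatedMean hlam hφ hf' n).comp measurable_prodMk_left
    unfold act
    rw [ofReal_integral_eq_lintegral_ofReal _ (ae_of_all _ fun _ => ENNReal.toReal_nonneg)]
    · exact lintegral_congr fun z => (ENNReal.ofReal_toReal (hfin n hts z)).symm
    · refine Integrable.of_bound hm.ennreal_toReal.aestronglyMeasurable (ENNReal.ofReal K).toReal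
        (ae_of_all _ fun z => ?_)
      rw [Real.norm_of_nonneg ENNReal.toReal_nonneg]
      exact ENNReal.toReal_mono ENNReal.ofReal_ne_top (hle n hts z)
  have hI0 : 0 ≤ ∫ s in (0 : ℝ)..t, lam * Real.exp (-(lam * s)) * c s :=
    intervalIntegral.integral_nonneg ht fun s hs => mul_nonneg (by positivity) (hcn s hs)
  have hcc : Continuous fun s => lam * Real.exp (-(lam * s)) * c s := by fun_prop
  have key : truncatedMean φ lam Q f' (n + 1) t y ≤ truncatedMean φ lam Q f' (n + 1) t x +
      ENNReal.ofReal (Real.exp (-(lam * t)) * c₀ +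
        ∫ s in (0 : ℝ)..t, lam * Real.exp (-(lam * s)) * c s) := by
    rw [truncatedMean_succ hlam hφ hf' n ht, truncatedMean_succ hlam hφ hf' n ht,
      ENNReal.ofReal_add (by positivity) hI0, add_add_add_comm]
    refine add_le_add ?_ ?_
    · rw [ENNReal.ofReal_mul (Real.exp_pos _).le, ← mul_add]
      gcongr
      exact (ENNReal.ofReal_le_ofReal h₀).trans ENNReal.ofReal_add_le
    -- Lower integrals need measurability of the bound `c` only, not of the averages in the time
    -- variable.
    · rw [intervalIntegral.integral_of_le ht, ← integral_Icc_eq_integral_Ioc,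
        ofReal_integral_eq_lintegral_ofReal hcc.integrableOn_Icc (by
          filter_upwards [ae_restrict_mem measurableSet_Icc] with s hs
          exact mul_nonneg (by positivity) (hcn s hs)),
        ← lintegral_add_right _ hcc.measurable.ennreal_ofReal]
      refine setLIntegral_mono' measurableSet_Icc fun s hs => ?_
      have e := ENNReal.ofReal_mul (p := lam * Real.exp (-(lam * s))) (q := c s) (by positivity)
      rw [hact s hs, hact s hs, e, ← mul_add]
      gcongr
      exact (ENNReal.ofReal_le_ofReal (h s hs)).trans ENNReal.ofReal_add_le
  have h1 := ENNReal.toReal_mono (ENNReal.add_ne_top.2 ⟨hfin _ ht x, ENNReal.ofReal_ne_top⟩) key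
  rwa [ENNReal.toReal_add (hfin _ ht x) ENNReal.ofReal_ne_top, ENNReal.toReal_ofReal
    (add_nonneg (by positivity) hI0)] at h1

section Contraction
variable {m : Ω → ℝ} {η : ℝ}

/-- The balance between the expansion of the flow and the jumps. -/
lemma expansion_balance (hφ : IsFlow b φ) (hmax : ∀ s, φ (max s 0) = φ s) (hlam : 0 < lam)
    (hmc : Continuous m) (hm0 : ∀ x, 0 ≤ m x) (x : Ω) {t ε : ℝ} (ht : 0 ≤ t) (hε : 0 ≤ ε) :
    Real.exp (-(lam * t)) * ((1 + ε) *
        Real.exp (expansion φ (fun z => lam * (1 - m z) - η / 2) t x)) +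
      ∫ s in (0 : ℝ)..t, lam * Real.exp (-(lam * s)) * (Real.exp (-(η / 2) * (t - s)) *
        ((m (φ s x) + ε) * Real.exp (expansion φ (fun z => lam * (1 - m z) - η / 2) s x))) ≤
      Real.exp (-(η / 2) * t) * (1 + ε * (1 + lam * t)) := by
  set κ : Ω → ℝ := fun z => lam * (1 - m z) - η / 2 with hκ
  have hκc : Continuous κ := by fun_prop
  -- The rate `κ` is chosen so that `P(s) = exp(-λ∫₀ˢ m)`. Hence `λmP` integrates to `1 - P(t)` and
  -- compensates the no-jump term `P(t)`; only the `ε` terms remain, and `P ≤ 1` bounds them.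
  set P : ℝ → ℝ := fun s => Real.exp (expansion φ κ s x - lam * s + η / 2 * s) with hP
  have hP0 : ∀ s, 0 < P s := fun s => Real.exp_pos _
  have horb : Continuous fun s => φ s x := by
    have := hφ.continuous_orbit x
    simpa only [hmax] using this
  have hPd : ∀ s, HasDerivAt P (-(lam * m (φ s x) * P s)) s := by
    intro s
    have h1 := hasDerivAt_expansion hφ hκc x s
    rw [hmax] at h1
    have h2 := ((h1.fun_sub ((hasDerivAt_id' s).const_mul lam)).fun_add
      ((hasDerivAt_id' s).const_mul (η / 2))).exp
    refine h2.congr_deriv ?_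
    simp only [hP, hκ]
    ring
  have hPc : Continuous P := continuous_iff_continuousAt.2 fun s => (hPd s).continuousAt
  have hi : Continuous fun s => lam * m (φ s x) * P s :=
    (continuous_const.mul (hmc.comp horb)).mul hPc
  have hPI : ∀ T, 0 ≤ T → ∫ s in (0 : ℝ)..T, lam * m (φ s x) * P s = 1 - P T := by
    intro T hT
    have h1 := intervalIntegral.integral_eq_sub_of_hasDerivAt (a := 0) (b := T)
      (fun s _ => hPd s) (hi.neg.intervalIntegrable _ _)
    rw [intervalIntegral.integral_neg] at h1
    have h2 : P 0 = 1 := by simp [hP, expansion]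
    linarith
  have hP1 : ∀ T, 0 ≤ T → P T ≤ 1 := by
    intro T hT
    have h1 := hPI T hT
    have h2 : 0 ≤ ∫ s in (0 : ℝ)..T, lam * m (φ s x) * P s :=
      intervalIntegral.integral_nonneg hT fun s _ =>
        mul_nonneg (mul_nonneg hlam.le (hm0 _)) (hP0 s).le
    linarith
  have e1 : Real.exp (-(lam * t)) * ((1 + ε) * Real.exp (expansion φ κ t x)) =
      Real.exp (-(η / 2) * t) * ((1 + ε) * P t) := by
    have : Real.exp (-(lam * t)) * Real.exp (expansion φ κ t x) =
        Real.exp (-(η / 2) * t) * P t := by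
      simp only [hP]
      rw [← Real.exp_add, ← Real.exp_add]
      congr 1; ring
    linear_combination (1 + ε) * this
  have e2 : ∀ s, lam * Real.exp (-(lam * s)) * (Real.exp (-(η / 2) * (t - s)) *
        ((m (φ s x) + ε) * Real.exp (expansion φ κ s x))) =
      Real.exp (-(η / 2) * t) * (lam * m (φ s x) * P s + ε * lam * P s) := by
    intro s
    have : Real.exp (-(lam * s)) * (Real.exp (-(η / 2) * (t - s)) *
        Real.exp (expansion φ κ s x)) = Real.exp (-(η / 2) * t) * P s := by
      simp only [hP]
      rw [← Real.exp_add, ← Real.exp_add, ← Real.exp_add]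
      congr 1; ring
    linear_combination lam * (m (φ s x) + ε) * this
  have hPle : ∫ s in (0 : ℝ)..t, ε * lam * P s ≤ ε * lam * t := by
    have h1 := intervalIntegral.integral_mono_on (μ := volume) (f := fun s => ε * lam * P s)
      (g := fun _ => ε * lam) ht ((hPc.const_mul _).intervalIntegrable _ _)
      (continuous_const.intervalIntegrable _ _)
      fun s hs => mul_le_of_le_one_right (by positivity) (hP1 s hs.1)
    simpa [mul_comm, mul_left_comm] using h1
  simp only [e2]
  rw [e1, intervalIntegral.integral_const_mul, ← mul_add, intervalIntegral.integral_add
    (hi.intervalIntegrable _ _) ((hPc.const_mul _).intervalIntegrable _ _), hPI t ht]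
  refine mul_le_mul_of_nonneg_left ?_ (Real.exp_pos _).le
  nlinarith [mul_le_mul_of_nonneg_left (hP1 t ht) hε]

variable [IsMarkovKernel Q]

/-- The truncated semigroup contracts Lipschitz functions. -/
theorem truncatedMean_dlip (hb : SmoothOn b) (hφ : IsFlow b φ)
    (hφc : Continuous fun p : ℝ × Ω => φ p.1 p.2) (hmax : ∀ s, φ (max s 0) = φ s) (hlam : 0 < lam)
    (hQ : ∀ f ∈ testFunctions Ω, (∀ x, Integrable f (Q x)) → act Q f ∈ testFunctions Ω)
    (ha : a ∈ testFunctions Ω) (hpos : ∀ x, 0 < a x) (haQ : ∀ x, Integrable a (Q x))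
    (hmc : Continuous m) (hm0 : ∀ x, 0 ≤ m x) (hm : KernelBound a Q m)
    (hfb : FlowBound a b fun z => lam * (1 - m z) - η / 2)
    {f : Ω → ℝ} {K : ℝ} (hfK : ∀ x, f x ≤ K) (hf : DLip a 1 f) (n : ℕ) :
    ∀ t, 0 ≤ t → DLip a (Real.exp (-(η / 2) * t))
      fun x => (truncatedMean φ lam Q (fun z => .ofReal (f z)) n t x).toReal := by
  have hac : Continuous a := SmoothOn.continuous ha.1
  have hfc : Continuous f := hf.continuous hac hpos one_pos
  have hφm := hφc.measurable
  induction n with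
  | zero =>
    intro t ht x y
    simp [truncatedMean]
  | succ n ih =>
    intro t ht
    refine DLip.of_local hac hpos (Real.exp_pos _) fun x ε' hε' => ?_
    set κ : Ω → ℝ := fun z => lam * (1 - m z) - η / 2 with hκ
    have hκc : Continuous κ := by fun_prop
    set Lt := Real.exp (-(η / 2) * t) with hLt
    have hax := Real.sqrt_pos.2 (hpos x)
    have horb : Continuous fun s => φ s x := hφc.comp (by fun_prop : Continuous fun s => (s, x))
    -- One `ε` serves for the flow estimate and for the oscillation of the weights. It is taken so
    -- small that the total error fits in the slack `ε'`.
    obtain ⟨ε, hε, hεε'⟩ : ∃ ε > 0, Real.exp (ε * t) * (Lt * (1 + ε * (1 + lam * t))) *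
        (Real.sqrt (a x))⁻¹ < Lt / Real.sqrt (a x) + ε' := by
      have hc : Continuous fun ε : ℝ => Real.exp (ε * t) * (Lt * (1 + ε * (1 + lam * t))) *
        (Real.sqrt (a x))⁻¹ := by fun_prop
      have h0 := hc.tendsto 0
      simp only [zero_mul, Real.exp_zero, add_zero, mul_one, one_mul] at h0
      have h1 := (h0.eventually_lt_const
        (show Lt * (Real.sqrt (a x))⁻¹ < Lt / Real.sqrt (a x) + ε' by
          rw [div_eq_mul_inv]; linarith)).filter_mono (nhdsWithin_le_nhds (s := Ioi 0))
      obtain ⟨ε, h2, h3⟩ := (h1.and self_mem_nhdsWithin).exists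
      exact ⟨ε, h3, h2⟩
    -- the weights near the orbit
    have hza : ContinuousOn (zeroExt a) (Ω : Set (E d)) := ContDiffOn.continuousOn ha.1
    have hza0 : ∀ z ∈ (Ω : Set (E d)), 0 < Real.sqrt (zeroExt a z) := fun z hz => by
      rw [zeroExt_mk a hz]
      exact Real.sqrt_pos.2 (hpos _)
    have hzm : ContinuousOn (zeroExt m) (Ω : Set (E d)) := by
      rw [continuousOn_iff_continuous_domRestrict]
      exact hmc.congr fun z => (zeroExt_coe m z).symm
    have hw₁ : ContinuousOn (fun z => 1 / Real.sqrt (zeroExt a z)) (Ω : Set (E d)) :=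
      continuousOn_const.div hza.sqrt fun z hz => (hza0 z hz).ne'
    have hw₂ : ContinuousOn (fun z => zeroExt m z / Real.sqrt (zeroExt a z)) (Ω : Set (E d)) :=
      hzm.div hza.sqrt fun z hz => (hza0 z hz).ne'
    have hK := hφ.isCompact_orbit x t
    simp only [hmax] at hK
    have hKΩ : (fun s => (φ s x : E d)) '' Icc 0 t ⊆ Ω := by
      rintro _ ⟨s, -, rfl⟩; exact (φ s x).2
    have hKne : ((fun s => (φ s x : E d)) '' Icc 0 t).Nonempty :=
      ⟨_, 0, left_mem_Icc.2 ht, rfl⟩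
    -- The minimum of `1/√a` over the orbit turns the additive oscillation bound into a relative
    -- one, `ε/√a(φ_s x)`.
    obtain ⟨p₀, hp₀, hmin⟩ := hK.exists_isMinOn hKne (hw₁.mono hKΩ)
    have hη₁ : 0 < ε * (1 / Real.sqrt (zeroExt a p₀)) :=
      mul_pos hε (one_div_pos.2 (hza0 p₀ (hKΩ hp₀)))
    obtain ⟨r₁, hr₁, h₁⟩ := exists_radius Ω.isOpen hK hKΩ hw₁ hη₁
    obtain ⟨r₂, hr₂, h₂⟩ := exists_radius Ω.isOpen hK hKΩ hw₂ hη₁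
    obtain ⟨δ, hδ, htube⟩ := exists_flow_tube hb hφ ha.1 hpos hκc hfb x t hε (lt_min hr₁ hr₂)
    have hnear : ∀ᶠ y : Ω in 𝓝 x, ‖(y : E d) - x‖ < δ := by
      have : Continuous fun y : Ω => ‖(y : E d) - x‖ := by fun_prop
      exact this.continuousAt.eventually_lt_const (by simpa using hδ)
    filter_upwards [hnear] with y hy
    set N := ‖(y : E d) - x‖ / Real.sqrt (a x) with hN
    have hN0 : 0 ≤ N := by positivity
    set Ex : ℝ → ℝ := fun s => Real.exp (expansion φ κ s x) with hEx
    have hExc : Continuous Ex := Real.continuous_exp.comp (continuous_expansion hφ hκc x)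
    -- geometry of the tube
    have hgeo : ∀ s ∈ Icc 0 t, (segment ℝ (φ s x : E d) (φ s y) ⊆ Ω) ∧
        (∀ z : Ω, (z : E d) ∈ segment ℝ (φ s x : E d) (φ s y) →
          1 / Real.sqrt (a z) ≤ (1 + ε) * (1 / Real.sqrt (a (φ s x))) ∧
          m z / Real.sqrt (a z) ≤ (m (φ s x) + ε) * (1 / Real.sqrt (a (φ s x)))) ∧
        1 / Real.sqrt (a (φ s x)) * ‖(φ s y : E d) - φ s x‖ ≤ Real.exp (ε * t) * Ex s * N := by
      intro s hs
      obtain ⟨hlt, hle⟩ := htube y hy s hs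
      have hp : (φ s x : E d) ∈ (fun s => (φ s x : E d)) '' Icc 0 t := ⟨s, hs, rfl⟩
      have hsegr : ∀ z ∈ segment ℝ (φ s x : E d) (φ s y), dist z (φ s x) ≤ min r₁ r₂ := by
        intro z hz
        refine (convex_closedBall (φ s x : E d) (min r₁ r₂)).segment_subset
          (Metric.mem_closedBall_self (lt_min hr₁ hr₂).le) ?_ hz
        rw [Metric.mem_closedBall, dist_eq_norm]
        exact hlt.le
      have hmin' : ε * (1 / Real.sqrt (zeroExt a p₀)) ≤ ε * (1 / Real.sqrt (a (φ s x))) := by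
        refine mul_le_mul_of_nonneg_left ?_ hε.le
        have := hmin hp
        simp only [mem_ofPred_eq, zeroExt_coe] at this
        exact this
      refine ⟨fun z hz => (h₁ _ hp z ((hsegr z hz).trans (min_le_left _ _))).1,
        fun z hz => ⟨?_, ?_⟩, ?_⟩
      · have h := (h₁ _ hp z ((hsegr z hz).trans (min_le_left _ _))).2
        rw [Real.dist_eq, zeroExt_coe, zeroExt_coe] at h
        have := (abs_le.1 h).2
        linarith
      · have h := (h₂ _ hp z ((hsegr z hz).trans (min_le_right _ _))).2
        simp only [Real.dist_eq, zeroExt_coe] at h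
        have := (abs_le.1 h).2
        have e : m (φ s x) / Real.sqrt (a (φ s x)) =
          m (φ s x) * (1 / Real.sqrt (a (φ s x))) := by ring
        linarith
      · have hsq := Real.sqrt_pos.2 (hpos (φ s x))
        have h := mul_le_mul_of_nonneg_left hle (one_div_pos.2 hsq).le
        refine h.trans ?_
        rw [Real.exp_add]
        have e : 1 / Real.sqrt (a (φ s x)) * (Real.exp (ε * s) * Real.exp (expansion φ κ s x) *
            (Real.sqrt (a (φ s x)) / Real.sqrt (a x)) * ‖(y : E d) - x‖) =
            Real.exp (ε * s) * Ex s * N := by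
          simp only [hEx, hN]
          field_simp
        rw [e]
        have : Real.exp (ε * s) ≤ Real.exp (ε * t) :=
          Real.exp_le_exp.2 (mul_le_mul_of_nonneg_left hs.2 hε.le)
        exact mul_le_mul_of_nonneg_right
          (mul_le_mul_of_nonneg_right this (Real.exp_pos _).le) hN0
    -- Increments of the no-jump term and of the term with first jump at time `s`: the Lipschitz
    -- constant (`1`, or `e^{-η(t-s)/2}` by induction), the factor of the kernel (`m` after a jump),
    -- then the gap of the orbits in the weighted metric.
    set c₀ := (1 + ε) * (Real.exp (ε * t) * Ex t * N) with hc₀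
    set c : ℝ → ℝ := fun s => Real.exp (-(η / 2) * (t - s)) *
      ((m (φ s x) + ε) * (Real.exp (ε * t) * Ex s * N)) with hc
    have hcc : Continuous c := by
      have := hmc.comp horb
      simp only [Function.comp_def] at this
      fun_prop
    have hmε : ∀ s, 0 ≤ m (φ s x) + ε := fun s => add_nonneg (hm0 _) hε.le
    have hEx0 : ∀ s, 0 < Ex s := fun s => Real.exp_pos _
    have hc0 : ∀ s, 0 ≤ c s := fun s => by
      have := hmε s
      have := hEx0 s
      positivity
    have hd₀ : |f (φ t y) - f (φ t x)| ≤ c₀ := by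
      obtain ⟨g1, g2, g3⟩ := hgeo t ⟨ht, le_rfl⟩
      refine (hf.abs_sub_le one_pos g1 fun v hv => (g2 v hv).1).trans ?_
      rw [mul_assoc]
      exact mul_le_mul_of_nonneg_left g3 (by positivity)
    have hd : ∀ s ∈ Icc 0 t,
        |act Q (fun z => (truncatedMean φ lam Q (fun z => .ofReal (f z)) n (t - s) z).toReal)
          (φ s y) -
        act Q (fun z => (truncatedMean φ lam Q (fun z => .ofReal (f z)) n (t - s) z).toReal)
          (φ s x)| ≤ c s := by
      intro s hs
      obtain ⟨g1, g2, g3⟩ := hgeo s hs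
      have hts := sub_nonneg.2 hs.2
      have h := abs_act_sub_le hQ ha hpos haQ hm0 hm (B := (ENNReal.ofReal K).toReal)
        (Real.exp_pos _) (fun z => by
          rw [abs_of_nonneg ENNReal.toReal_nonneg]
          exact ENNReal.toReal_mono ENNReal.ofReal_ne_top (truncatedMean_le hlam hφm
            (fun z => ENNReal.ofReal_le_ofReal (hfK z)) n hts z)) (ih (t - s) hts) g1
        fun z hz => (g2 z hz).2
      refine h.trans ?_
      rw [mul_assoc, mul_assoc]
      exact mul_le_mul_of_nonneg_left (mul_le_mul_of_nonneg_left g3 (hmε s)) (Real.exp_pos _).le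
    have hc₀0 : 0 ≤ c₀ := (abs_nonneg _).trans hd₀
    set C := Real.exp (-(lam * t)) * c₀ + ∫ s in (0 : ℝ)..t, lam * Real.exp (-(lam * s)) * c s
      with hC
    have hCle : C ≤ Real.exp (ε * t) * (Lt * (1 + ε * (1 + lam * t))) * N := by
      have h := expansion_balance (η := η) hφ hmax hlam hmc hm0 x ht hε.le
      have e : C = Real.exp (ε * t) * N * (Real.exp (-(lam * t)) * ((1 + ε) * Ex t) +
          ∫ s in (0 : ℝ)..t, lam * Real.exp (-(lam * s)) * (Real.exp (-(η / 2) * (t - s)) *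
            ((m (φ s x) + ε) * Ex s))) := by
        rw [mul_add, ← intervalIntegral.integral_const_mul, hC, hc₀]
        congr 1
        · ring
        · congr 1
          ext s
          simp only [hc]
          ring
      rw [e]
      calc _ ≤ Real.exp (ε * t) * N * (Lt * (1 + ε * (1 + lam * t))) :=
            mul_le_mul_of_nonneg_left h (by positivity)
        _ = _ := by ring
    have hup := truncatedMean_succ_le (Q := Q) (x := x) (y := y) hlam hφm hfc.measurable hfK n ht
      hc₀0 hcc (fun s _ => hc0 s) (by linarith [(abs_le.1 hd₀).2])
      fun s hs => by linarith [(abs_le.1 (hd s hs)).2]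
    have hdown := truncatedMean_succ_le (Q := Q) (x := y) (y := x) hlam hφm hfc.measurable hfK n ht
      hc₀0 hcc (fun s _ => hc0 s) (by linarith [(abs_le.1 hd₀).1])
      fun s hs => by linarith [(abs_le.1 (hd s hs)).1]
    have hfinal : C ≤ (Lt / Real.sqrt (a x) + ε') * ‖(y : E d) - x‖ := by
      refine hCle.trans ?_
      have h := mul_le_mul_of_nonneg_right hεε'.le (norm_nonneg ((y : E d) - x))
      refine le_trans (le_of_eq ?_) h
      rw [hN, div_eq_mul_inv]
      ring
    exact (abs_le.2 ⟨by linarith, by linarith⟩ : _ ≤ C).trans hfinal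

/-- The semigroup contracts Lipschitz functions. -/
theorem transition_dlip (hb : SmoothOn b) (hφ : IsFlow b φ)
    (hφc : Continuous fun p : ℝ × Ω => φ p.1 p.2) (hmax : ∀ s, φ (max s 0) = φ s) (hlam : 0 < lam)
    (hQ : ∀ f ∈ testFunctions Ω, (∀ x, Integrable f (Q x)) → act Q f ∈ testFunctions Ω)
    (ha : a ∈ testFunctions Ω) (hpos : ∀ x, 0 < a x) (haQ : ∀ x, Integrable a (Q x))
    (hmc : Continuous m) (hm0 : ∀ x, 0 ≤ m x) (hm : KernelBound a Q m)
    (hfb : FlowBound a b fun z => lam * (1 - m z) - η / 2)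
    {f : Ω → ℝ} {K : ℝ} (hfK : ∀ x, f x ≤ K) (hf : DLip a 1 f) {t : ℝ} (ht : 0 ≤ t) (x y : Ω) :
    ∫⁻ z, .ofReal (f z) ∂(transition φ lam Q t x) ≤
      ∫⁻ z, .ofReal (f z) ∂(transition φ lam Q t y) +
        ENNReal.ofReal (Real.exp (-(η / 2) * t)) * wdist a x y := by
  simp only [← iSup_truncatedMean (fun z => ENNReal.ofReal (f z))]
  -- The Lipschitz constant does not depend on the number of jumps allowed, so it survives the
  -- monotone limit.
  refine iSup_le fun n => ?_
  have hfin : ∀ x, truncatedMean φ lam Q (fun z => ENNReal.ofReal (f z)) n t x ≠ ⊤ := fun x =>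
    ((truncatedMean_le hlam hφc.measurable (fun z => ENNReal.ofReal_le_ofReal (hfK z)) n
      ht x).trans_lt ENNReal.ofReal_lt_top).ne
  have h := truncatedMean_dlip hb hφ hφc hmax hlam hQ ha hpos haQ hmc hm0 hm hfb hfK hf n t ht x y
  rw [ENNReal.ofReal_sub _ ENNReal.toReal_nonneg, ENNReal.ofReal_toReal (hfin x),
    ENNReal.ofReal_toReal (hfin y), tsub_le_iff_left] at h
  refine h.trans ?_
  gcongr
  exact le_iSup (fun n => truncatedMean φ lam Q (fun z => ENNReal.ofReal (f z)) n t y) n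

end Contraction

end PDMP

/-! ### A continuous substitute for the dominating function -/

namespace PDMP
open Set Filter Topology

variable {d : ℕ} {Ω : TopologicalSpace.Opens (E d)} {a : Ω → ℝ} {b : Ω → E d} {φ : ℝ → Ω → Ω}
  {lam : ℝ} {Q : Kernel Ω Ω}

section Domination
variable {M : Ω → ℝ} {η : ℝ}

lemma phi_nonneg (hpos : ∀ x, 0 < a x) (f : Ω → ℝ) (x : Ω) : 0 ≤ phi a f x :=
  mul_nonneg (hpos x).le (sq_nonneg _)

/-- A function dominating the weighted gradients of the kernel is nonnegative. -/
lemma domination_nonneg [Nontrivial (E d)] [IsMarkovKernel Q] (hac : Continuous a)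
    (hpos : ∀ x, 0 < a x) (haQ : ∀ x, Integrable a (Q x))
    (hM : ∀ f ∈ testFunctions Ω, (∀ x, Integrable f (Q x)) →
      (∀ x, Integrable (phi a f) (Q x)) → ∀ x, phi a (act Q f) x ≤ M x * act Q (phi a f) x)
    (x : Ω) : 0 ≤ M x := by
  -- A cut-off linear form has unit gradient on a ball charged by `Q x`. For it `Q(φ_a(F))` is
  -- positive, whereas `φ_a(QF) ≥ 0`, which fixes the sign of `M x`.
  obtain ⟨e, he⟩ := exists_norm_eq (E d) zero_le_one
  obtain ⟨n, hn⟩ : ∃ n : ℕ, 0 < Q x {z : Ω | ‖(z : E d)‖ < n + 1} := by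
    by_contra! h
    have h1 : Q x (⋃ n : ℕ, {z : Ω | ‖(z : E d)‖ < n + 1}) = 0 :=
      measure_iUnion_null fun n => le_antisymm (h n) zero_le
    have h2 : (⋃ n : ℕ, {z : Ω | ‖(z : E d)‖ < n + 1}) = univ := by
      refine eq_univ_of_forall fun z => mem_iUnion.2 ?_
      obtain ⟨n, hn⟩ := exists_nat_gt ‖(z : E d)‖
      exact ⟨n, hn.trans (lt_add_one _)⟩
    rw [h2, measure_univ] at h1
    exact one_ne_zero h1
  let χ : ContDiffBump (0 : E d) := ⟨n + 1, n + 2, by positivity, by linarith⟩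
  let F : E d → ℝ := fun z => χ z * inner ℝ e z
  have hF : ContDiff ℝ ∞ F := χ.contDiff.mul (contDiff_const.inner ℝ contDiff_id)
  have hFs : HasCompactSupport F := χ.hasCompactSupport.mul_right
  obtain ⟨C, hC⟩ := hFs.exists_bound_of_continuous hF.continuous
  obtain ⟨C', hC'⟩ := (hFs.fderiv ℝ).exists_bound_of_continuous
    (hF.continuous_fderiv (by simp))
  have hFt : (fun z : Ω => F z) ∈ testFunctions Ω :=
    mem_testFunctions_of_eventually_zero hF.contDiffOn (R := n + 2) fun z hz => by
      have : χ z = 0 := χ.zero_of_le_dist (by simpa using hz.le)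
      simp [F, this]
  have hi1 : ∀ x, Integrable (fun z : Ω => F z) (Q x) := fun x =>
    Integrable.of_bound (hF.continuous.comp continuous_subtype_val).aestronglyMeasurable C
      (ae_of_all _ fun z => hC z)
  have hi2 : ∀ x, Integrable (phi a fun z : Ω => F z) (Q x) := fun x =>
    ((haQ x).mul_const (C' ^ 2)).mono'
      (SmoothOn.continuous_phi hac hFt.1).aestronglyMeasurable (ae_of_all _ fun z => by
        rw [Real.norm_of_nonneg (phi_nonneg hpos _ z), phi, norm_grad_restrict]
        exact mul_le_mul_of_nonneg_left (pow_le_pow_left₀ (norm_nonneg _) (hC' z) 2) (hpos z).le)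
  have hgrad : ∀ z : Ω, ‖(z : E d)‖ < n + 1 → ‖grad (fun z : Ω => F z) z‖ = 1 := by
    intro z hz
    have h1 : F =ᶠ[𝓝 (z : E d)] innerSL ℝ e := by
      filter_upwards [continuous_norm.continuousAt.eventually_lt_const hz] with v hv
      have : χ v = 1 := χ.one_of_mem_closedBall (by simpa using hv.le)
      simp [F, this]
    rw [norm_grad_restrict, h1.fderiv_eq, ContinuousLinearMap.fderiv, innerSL_apply_norm, he]
  have hpos' : 0 < act Q (phi a fun z : Ω => F z) x := by
    refine (integral_pos_iff_support_of_nonneg (phi_nonneg hpos _) (hi2 x)).2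
      (hn.trans_le (measure_mono fun z hz => ?_))
    rw [Function.mem_support, phi, hgrad z hz]
    simpa using (hpos z).ne'
  exact nonneg_of_mul_nonneg_left ((phi_nonneg hpos _ x).trans (hM _ hFt hi1 hi2 x)) hpos'

/-- The balance condition, in terms of a continuous dominating function. -/
lemma exists_continuous_kernelBound [IsMarkovKernel Q] (hb : SmoothOn b) (hlam : 0 < lam)
    (ha : SmoothOn a) (hpos : ∀ x, 0 < a x) (haQ : ∀ x, Integrable a (Q x))
    (hM : ∀ f ∈ testFunctions Ω, (∀ x, Integrable f (Q x)) →
      (∀ x, Integrable (phi a f) (Q x)) → ∀ x, phi a (act Q f) x ≤ M x * act Q (phi a f) x)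
    (hbal : ∀ (x : Ω) (u : E d), 2 * inner ℝ u (jac b x u) +
      (lam * (M x - 1) - inner ℝ (b x) (grad a x) / a x + η) * ‖u‖ ^ 2 ≤ 0) :
    ∃ m : Ω → ℝ, Continuous m ∧ (∀ x, 0 ≤ m x) ∧ KernelBound a Q m ∧
      FlowBound a b fun z => lam * (1 - m z) - η / 2 := by
  -- In dimension zero all gradients vanish, and there is no unit vector to test with.
  rcases subsingleton_or_nontrivial (E d) with hE | hE
  · refine ⟨fun _ => 0, continuous_const, fun _ => le_rfl, fun f _ _ _ x => ?_, fun z u => ?_⟩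
    · simp [phi, Subsingleton.elim (grad (act Q f) x) 0]
    · simp [Subsingleton.elim u 0]
  have hac : Continuous a := ha.continuous
  have hjc : Continuous fun x : Ω => jac b x :=
    continuousOn_iff_continuous_domRestrict.1 hb.continuousOn_fderiv
  -- The largest eigenvalue of the symmetric part of the Jacobian: the optimal growth rate,
  -- continuous in `x` by compactness of the sphere.
  let Λ : Ω → ℝ := fun x => sSup ((fun u => inner ℝ u (jac b x u)) '' Metric.sphere (0 : E d) 1)
  have hS : IsCompact (Metric.sphere (0 : E d) 1) := isCompact_sphere _ _
  have hJ : Continuous fun p : Ω × E d => inner ℝ p.2 (jac b p.1 p.2) :=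
    continuous_snd.inner ((hjc.comp continuous_fst).clm_apply continuous_snd)
  have hΛc : Continuous Λ := hS.continuous_sSup hJ
  have hJx : ∀ x, Continuous fun u => inner ℝ u (jac b x u) := fun x =>
    hJ.comp (Continuous.prodMk_right x)
  have hΛ : ∀ x u, inner ℝ u (jac b x u) ≤ Λ x * ‖u‖ ^ 2 := by
    intro x u
    rcases eq_or_ne u 0 with rfl | hu
    · simp
    have hu' : 0 < ‖u‖ := norm_pos_iff.2 hu
    have h1 : inner ℝ (‖u‖⁻¹ • u) (jac b x (‖u‖⁻¹ • u)) ≤ Λ x :=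
      le_csSup (hS.image (hJx x)).bddAbove ⟨_, by simp [norm_smul, hu'.ne'], rfl⟩
    rw [map_smul, real_inner_smul_left, real_inner_smul_right, ← mul_assoc, ← mul_inv, ← sq,
      inv_mul_eq_div, div_le_iff₀ (by positivity)] at h1
    exact h1
  have hatt : ∀ x, ∃ u : E d, ‖u‖ = 1 ∧ inner ℝ u (jac b x u) = Λ x := by
    intro x
    obtain ⟨u, hu, h⟩ := hS.exists_sSup_image_eq (NormedSpace.sphere_nonempty.2 zero_le_one)
      (hJx x).continuousOn
    exact ⟨u, by simpa using hu, h.symm⟩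
  let m : Ω → ℝ := fun x =>
    1 - (Λ x - inner ℝ (b x) (grad a x) / (2 * a x) + η / 2) / lam
  -- The balance condition at a maximising direction. Together with `M ≥ 0` it also gives `m ≥ 1/2`.
  have hMm : ∀ x, M x ≤ 2 * m x - 1 := by
    intro x
    obtain ⟨u, hu, h⟩ := hatt x
    have h1 := hbal x u
    rw [h, hu, one_pow, mul_one] at h1
    have h2 : inner ℝ (b x) (grad a x) / a x = 2 * (inner ℝ (b x) (grad a x) / (2 * a x)) := by
      have := (hpos x).ne'
      field_simp
    rw [h2] at h1
    have h3 : lam * m x =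
        lam - (Λ x - inner ℝ (b x) (grad a x) / (2 * a x) + η / 2) := by
      simp only [m]
      field_simp
    refine le_of_mul_le_mul_left ?_ hlam
    linarith
  have hM0 := domination_nonneg hac hpos haQ hM
  refine ⟨m, ?_, fun x => by linarith [hMm x, hM0 x], fun f hf h1 h2 x => ?_, fun z u => ?_⟩
  · refine continuous_const.sub (((hΛc.sub ?_).add continuous_const).div_const _)
    exact (hb.continuous.inner ha.continuous_grad).div (by fun_prop)
      fun x => (mul_pos two_pos (hpos x)).ne'
  -- Here `M ≤ 2m - 1 ≤ m²`.
  · refine (hM f hf h1 h2 x).trans (mul_le_mul_of_nonneg_right ?_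
      (integral_nonneg (phi_nonneg hpos f)))
    nlinarith [hMm x, sq_nonneg (m x - 1)]
  · have h3 : lam * (1 - m z) - η / 2 = Λ z - inner ℝ (b z) (grad a z) / (2 * a z) := by
      simp only [m]
      field_simp
      ring
    simp only [h3]
    linarith [hΛ z u]

end Domination

/-! ### Measurability and separability of the weighted distance -/

section WeightedDistance

lemma eventually_wdist_le (hac : Continuous a) (hpos : ∀ x, 0 < a x) (x : Ω) {ε : ENNReal}
    (hε : 0 < ε) : ∀ᶠ y in 𝓝 x, wdist a y x ≤ ε := by
  have hw : Continuous fun z : Ω => 1 / Real.sqrt (a z) :=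
    continuous_const.div hac.sqrt fun z => (Real.sqrt_pos.2 (hpos z)).ne'
  set G := 1 / Real.sqrt (a x) + 1 with hG
  have h1 : ∀ᶠ z in 𝓝 x, 1 / Real.sqrt (a z) < G :=
    hw.continuousAt.eventually_lt_const (by linarith)
  rw [nhds_subtype_eq_comap, eventually_comap] at h1
  obtain ⟨r, hr, hball⟩ := Metric.mem_nhds_iff.1 (h1.and (Ω.isOpen.mem_nhds x.2))
  have h0 : Tendsto (fun y : Ω => ENNReal.ofReal (G * ‖(x : E d) - y‖)) (𝓝 x) (𝓝 0) := by
    have : Continuous fun y : Ω => ENNReal.ofReal (G * ‖(x : E d) - y‖) :=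
      ENNReal.continuous_ofReal.comp (by fun_prop)
    simpa using this.tendsto x
  filter_upwards [continuous_subtype_val.continuousAt.preimage_mem_nhds
    (Metric.ball_mem_nhds (x : E d) hr), h0.eventually_lt_const hε] with y hy hyε
  have hs : segment ℝ (y : E d) x ⊆ Metric.ball (x : E d) r :=
    (convex_ball _ _).segment_subset hy (Metric.mem_ball_self hr)
  exact (wdist_le_of_segment (fun v hv => (hball (hs hv)).2)
    fun v hv => ((hball (hs hv)).1 v rfl).le).trans hyε.le

/-- The triangle inequality and local smallness make the sets `wdist a · x < c` open, even where the
distance takes the value `⊤`. -/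
lemma measurable_wdist (hac : Continuous a) (hpos : ∀ x, 0 < a x) (x : Ω) :
    Measurable fun y => wdist a y x := by
  refine measurable_of_Iio fun c => IsOpen.measurableSet (isOpen_iff_mem_nhds.2 fun y hy => ?_)
  obtain ⟨ε, hε, h⟩ := ENNReal.lt_iff_exists_add_pos_lt.1 (show wdist a y x < c from hy)
  filter_upwards [eventually_wdist_le hac hpos y (ε := ε) (by exact_mod_cast hε)] with z hz
  refine lt_of_le_of_lt ((wdist_triangle z y x).trans ?_) h
  rw [add_comm]
  gcongr

/-- The Lindelöf property of `Ω` provides the covers needed for quantization, even when `Ω` has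
several components at infinite distance. -/
lemma exists_countable_wdist_cover [Nonempty Ω] (hac : Continuous a) (hpos : ∀ x, 0 < a x)
    (ε : ENNReal) (hε : 0 < ε) : ∃ (ξ : ℕ → Ω) (A : ℕ → Set Ω), (∀ k, MeasurableSet (A k)) ∧
      (⋃ k, A k) = univ ∧ ∀ k, ∀ y ∈ A k, wdist a y (ξ k) ≤ ε := by
  obtain ⟨s, hs, hc⟩ := TopologicalSpace.countable_cover_nhds
    fun x => eventually_wdist_le hac hpos x hε
  have hsn : s.Nonempty := by
    by_contra h
    rw [not_nonempty_iff_eq_empty] at h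
    simp only [h, biUnion_empty] at hc
    exact empty_ne_univ hc
  obtain ⟨ξ, hξ⟩ := hs.exists_eq_range hsn
  refine ⟨ξ, fun k => {y | wdist a y (ξ k) ≤ ε},
    fun k => measurable_wdist hac hpos _ measurableSet_Iic, ?_, fun k y hy => hy⟩
  simpa [hξ] using hc

end WeightedDistance

end PDMP

/-! ### From Lipschitz contraction to Wasserstein contraction -/

namespace PDMP
open Set Filter Topology

variable {d : ℕ} {Ω : TopologicalSpace.Opens (E d)} {a : Ω → ℝ} {b : Ω → E d} {φ : ℝ → Ω → Ω}
  {lam : ℝ} {Q : Kernel Ω Ω}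

/-- The estimate dual to the contraction of the Wasserstein distance. -/
lemma lintegral_evolve_le [IsMarkovKernel Q] (hlam : 0 < lam)
    (hφ : Measurable fun p : ℝ × Ω => φ p.1 p.2) {t : ℝ} {L : ENNReal} (hL : L ≠ ⊤)
    {f : Ω → ENNReal} (hf : Measurable f)
    (h : ∀ x y, ∫⁻ z, f z ∂(transition φ lam Q t x) ≤
      ∫⁻ z, f z ∂(transition φ lam Q t y) + L * wdist a x y)
    {ν₁ ν₂ : Measure Ω} {π : Measure (Ω × Ω)}
    (hπ : π.map Prod.fst = ν₁ ∧ π.map Prod.snd = ν₂) :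
    ∫⁻ z, f z ∂(evolve φ lam Q t ν₁) ≤
      ∫⁻ z, f z ∂(evolve φ lam Q t ν₂) + L * ∫⁻ p, wdist a p.1 p.2 ∂π := by
  have hT := measurable_transition (Q := Q) hlam hφ t
  have hP : Measurable fun x => ∫⁻ z, f z ∂(transition φ lam Q t x) :=
    (Measure.measurable_lintegral hf).comp hT
  rw [evolve, evolve, Measure.lintegral_bind hT.aemeasurable hf.aemeasurable,
    Measure.lintegral_bind hT.aemeasurable hf.aemeasurable, ← hπ.1, ← hπ.2,
    lintegral_map hP measurable_fst, lintegral_map hP measurable_snd,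
    ← lintegral_const_mul' _ _ hL]
  -- Only the first summand has to be measurable, so joint measurability of `wdist a` is not needed.
  refine le_trans ?_ (lintegral_add_left (hP.comp measurable_snd) _).le
  exact lintegral_mono fun p => h p.1 p.2

end PDMP

theorem corollary2p1 (d : ℕ) (Ω : TopologicalSpace.Opens (PDMP.E d))
    -- the process: smooth vector field, its flow, constant jump rate, jump kernel
    (b : Ω → PDMP.E d) (hb : PDMP.SmoothOn b)
    (φ : ℝ → Ω → Ω) (hφ : PDMP.IsFlow b φ)
    (lam : ℝ) (hlam : 0 < lam)
    (Q : Kernel Ω Ω) [IsMarkovKernel Q]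
    -- `Q` fixes the class of test functions (those on which it is defined)
    (hQ : ∀ f ∈ PDMP.testFunctions Ω, (∀ x, Integrable f (Q x)) →
      PDMP.act Q f ∈ PDMP.testFunctions Ω)
    -- the weight
    (a : Ω → ℝ) (ha : a ∈ PDMP.testFunctions Ω) (ha_pos : ∀ x, 0 < a x)
    (haQ : ∀ x, Integrable a (Q x))
    (M : Ω → ℝ) (η : ℝ)
    -- `φ_a(Q f) ≤ M Q(φ_a(f))`
    (hM : ∀ f ∈ PDMP.testFunctions Ω, (∀ x, Integrable f (Q x)) →
      (∀ x, Integrable (PDMP.phi a f) (Q x)) →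
      ∀ x, PDMP.phi a (PDMP.act Q f) x ≤ M x * PDMP.act Q (PDMP.phi a f) x)
    -- the balance condition
    (hbal : ∀ (x : Ω) (u : PDMP.E d),
      2 * inner ℝ u (PDMP.jac b x u) +
        (lam * (M x - 1) - inner ℝ (b x) (PDMP.grad a x) / a x + η) * ‖u‖ ^ 2 ≤ 0)
    (t : ℝ) (ht : 0 ≤ t)
    (ν₁ ν₂ : Measure Ω) [IsProbabilityMeasure ν₁] [IsProbabilityMeasure ν₂]
    (hν₁ : PDMP.FiniteFirstMoment a ν₁) (hν₂ : PDMP.FiniteFirstMoment a ν₂)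
    (hPν₁ : PDMP.FiniteFirstMoment a (PDMP.evolve φ lam Q t ν₁))
    (hPν₂ : PDMP.FiniteFirstMoment a (PDMP.evolve φ lam Q t ν₂)) :
    PDMP.wasserstein a (PDMP.evolve φ lam Q t ν₁) (PDMP.evolve φ lam Q t ν₂) ≤
      ENNReal.ofReal (Real.exp (-(η / 2) * t)) * PDMP.wasserstein a ν₁ ν₂ := by
  have hac : Continuous a := ha.1.continuous
  obtain ⟨m, hmc, hm0, hm, hfb⟩ :=
    PDMP.exists_continuous_kernelBound hb hlam ha.1 ha_pos haQ hM hbal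
  -- From here on the flow is clamped at time zero, which makes it jointly continuous.
  rw [PDMP.evolve_max (φ := φ) ht ν₁] at hPν₁ ⊢
  rw [PDMP.evolve_max (φ := φ) ht ν₂] at hPν₂ ⊢
  have hψc := PDMP.continuous_flow hb hφ ha.1 ha_pos (by fun_prop) hfb
  have hψ := hφ.comp_max
  have hmax : ∀ s, (fun s => φ (max s 0)) (max s 0) = (fun s => φ (max s 0)) s := fun s => by
    simp
  set ψ : ℝ → Ω → Ω := fun s => φ (max s 0)
  have hψm : Measurable fun p : ℝ × Ω => ψ p.1 p.2 := hψc.measurable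
  have := PDMP.isProbabilityMeasure_evolve (Q := Q) hlam hψm ht ν₁
  have := PDMP.isProbabilityMeasure_evolve (Q := Q) hlam hψm ht ν₂
  obtain ⟨x₁, hx₁⟩ := hPν₁
  obtain ⟨x₂, hx₂⟩ := hPν₂
  have : Nonempty Ω := ⟨x₁⟩
  set Lt := Real.exp (-(η / 2) * t) with hLt
  have hLt0 : 0 < Lt := Real.exp_pos _
  have hL0 : ENNReal.ofReal Lt ≠ 0 := by simpa using hLt0
  have main : ∀ π : Measure (Ω × Ω), π.map Prod.fst = ν₁ ∧ π.map Prod.snd = ν₂ →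
      PDMP.wasserstein a (PDMP.evolve ψ lam Q t ν₁) (PDMP.evolve ψ lam Q t ν₂) ≤
        ENNReal.ofReal Lt * ∫⁻ p, PDMP.wdist a p.1 p.2 ∂π := by
    intro π hπ
    by_cases htop : ∫⁻ p, PDMP.wdist a p.1 p.2 ∂π = ⊤
    · rw [htop, ENNReal.mul_top hL0]
      exact le_top
    set I := (∫⁻ p, PDMP.wdist a p.1 p.2 ∂π).toReal with hI
    have hI0 : 0 ≤ I := ENNReal.toReal_nonneg
    -- The dual bound. Adding `K` makes `F` nonnegative, so the lower-integral estimates apply; the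
    -- constant cancels because both evolved laws are probabilities.
    have hD : ∀ F : Ω → ℝ, Measurable F → (∃ K, ∀ x, |F x| ≤ K) →
        (∀ x y, ENNReal.ofReal (F x - F y) ≤ PDMP.wdist a x y) →
        ∫ x, F x ∂(PDMP.evolve ψ lam Q t ν₁) - ∫ x, F x ∂(PDMP.evolve ψ lam Q t ν₂) ≤
          Lt * I := by
      rintro F hF ⟨K, hK⟩ hFl
      have hF0 : ∀ x, 0 ≤ F x + K := fun x => by linarith [(abs_le.1 (hK x)).1]
      have hint : ∀ μ : Measure Ω, IsProbabilityMeasure μ → Integrable (fun x => F x + K) μ ∧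
          ∫ x, F x + K ∂μ = ∫ x, F x ∂μ + K := fun μ _ => by
        have h1 : Integrable F μ := Integrable.of_bound hF.aestronglyMeasurable K (ae_of_all _ hK)
        refine ⟨h1.add (integrable_const K), ?_⟩
        rw [integral_add h1 (integrable_const K)]
        simp
      have h := PDMP.lintegral_evolve_le (a := a) (f := fun z => ENNReal.ofReal (F z + K)) hlam hψm
        (t := t) ENNReal.ofReal_ne_top (hF.add_const K).ennreal_ofReal (fun x y =>
          PDMP.transition_dlip hb hψ hψc hmax hlam hQ ha ha_pos haQ hmc hm0 hm hfb (K := K + K)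
            (fun x => by linarith [(abs_le.1 (hK x)).2]) (fun x y => by simpa using hFl x y)
            ht x y) hπ
      rw [← ofReal_integral_eq_lintegral_ofReal (hint _ ‹_›).1 (ae_of_all _ hF0),
        ← ofReal_integral_eq_lintegral_ofReal (hint _ ‹_›).1 (ae_of_all _ hF0),
        ← ENNReal.ofReal_toReal htop, ← ENNReal.ofReal_mul hLt0.le,
        ← ENNReal.ofReal_add (integral_nonneg hF0) (by positivity),
        ENNReal.ofReal_le_ofReal_iff (add_nonneg (integral_nonneg hF0) (by positivity)),
        (hint _ ‹_›).2, (hint _ ‹_›).2] at h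
      linarith
    have hε : ∀ ε : ℝ, 0 < ε →
        PDMP.wasserstein a (PDMP.evolve ψ lam Q t ν₁) (PDMP.evolve ψ lam Q t ν₂) ≤
          ENNReal.ofReal (Lt * I + 4 * ε) := by
      intro ε hε
      -- The finite first moments of the evolved laws enter here: they allow quantization.
      obtain ⟨ρ, hρ, h⟩ := PDMP.exists_coupling_of_dual PDMP.wdist_self PDMP.wdist_comm
        PDMP.wdist_triangle (PDMP.measurable_wdist hac ha_pos)
        (PDMP.exists_countable_wdist_cover hac ha_pos) _ _ hx₁ hx₂
        (mul_nonneg hLt0.le hI0) hD hε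
      exact (iInf₂_le ρ hρ).trans h
    rw [← ENNReal.ofReal_toReal htop, ← ENNReal.ofReal_mul hLt0.le]
    have hc : Continuous fun ε : ℝ => ENNReal.ofReal (Lt * I + 4 * ε) :=
      ENNReal.continuous_ofReal.comp (by fun_prop)
    have h0 := (hc.tendsto 0).mono_left (nhdsWithin_le_nhds (s := Set.Ioi 0))
    simp only [add_zero, mul_zero] at h0
    exact ge_of_tendsto h0 (eventually_nhdsWithin_of_forall hε)
  rw [PDMP.wasserstein.eq_1 a ν₁ ν₂, ENNReal.mul_iInf_of_ne hL0 ENNReal.ofReal_ne_top]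
  refine le_iInf fun π => ?_
  rw [ENNReal.mul_iInf_of_ne hL0 ENNReal.ofReal_ne_top]
  exact le_iInf fun hπ => main π hπ
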